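/- Let $G$ be a finite bipartite graph with $N\ge 2$ left nodes in which every left node has exactly $D$ neighbours. For a real number $e$, $G$ has *$e$-expansion up to $K$* if every set $S$ of at most $K$ left nodes has at least $e\cdot\#S$ right neighbours. The *dynamic matching game* on $G$ with parameters $K$ and $\ell$ is played by Requester and Matcher, who maintain a set $M$ of edges of $G$, initially empty. In each round Requester first removes zero or more edges from $M$, after which $M$ must contain at most $K-1$ edges, and selects a left node $x$; then Matcher may add one edge of $G$ to $M$, after which $x$ must be incident on an edge of $M$ and every right node must be incident on at most $\ell$ edges of $M$ (otherwise Matcher loses). $G$ has *dynamic matching up to $K$ with load $\ell$* if Matcher has a strategy in this game with which she never loses. **Theorem.** There are absolute constants $c$ and $C$ for which the following holds. If $G$ has $(\tfrac23 D+2)$-expansion up to $K$, then $G$ has dynamic matching up to $K$ with load at most $C\lfloor\log_2 N\rfloor$. Moreover, there is a data structure that plays the game for Matcher with load at most $C\lfloor\log_2 N\rfloor$, never losing, and that takes, in the worst case, at most $C\,D\lfloor\log_2 N\rfloor$ time to process each retraction of an edge and to compute each match. Here the data structure consists of two fixed programs (the same for all graphs and all $K$), one for requests and one for retractions, for a word RAM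 with words of $c\lceil\log_2(N+\#R)\rceil$ bits, where $R$ is the set of right nodes. It is started with $N$, $D$, $\#R$, $\min(K,N)$ and the adjacency lists of the left nodes of $G$ in memory, and with everything else zero; its memory is kept from one operation to the next. -/

import Mathlib

namespace DynMatch

/-! ### Bipartite graphs and expansion -/

/-- A bipartite graph with left nodes `Fin N`, right nodes `Fin R` and left degree `D`, given by
adjacency lists: `nbr x` lists the `D` distinct neighbours of the left node `x` (in any order). -/
structure LeftRegularGraph (N D R : ℕ) where
  nbr : Fin N → Fin D ↪ Fin R

namespace LeftRegularGraph

variable {N D R : ℕ}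

/-- The set of right neighbours of a left node. -/
def neighbors (G : LeftRegularGraph N D R) (x : Fin N) : Finset (Fin R) :=
  Finset.univ.map (G.nbr x)

/-- The set of right neighbours of a set of left nodes. -/
def neighborSet (G : LeftRegularGraph N D R) (S : Finset (Fin N)) : Finset (Fin R) :=
  S.biUnion G.neighbors

/-- `G` has `e`-expansion up to `K`. -/
def HasExpansion (G : LeftRegularGraph N D R) (e : ℝ) (K : ℕ) : Prop :=
  ∀ S : Finset (Fin N), S.card ≤ K → e * (S.card : ℝ) ≤ ((G.neighborSet S).card : ℝ)

end LeftRegularGraph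

/-! ### The dynamic matching game -/

/-- The number of edges of `M` that are incident on the right node `y`. -/
def load {N R : ℕ} (M : Finset (Fin N × Fin R)) (y : Fin R) : ℕ :=
  (M.filter fun e => e.2 = y).card

/-- A turn of Requester: the edges that he removes, and the left node that he selects. -/
structure Turn (N R : ℕ) where
  removed : Finset (Fin N × Fin R)
  request : Fin N

/-- A strategy of Matcher. Its argument is the list of all turns of Requester so far, the current
one first; its value is the edge that Matcher adds, if any. -/
abbrev Strategy (N R : ℕ) := List (Turn N R) → Option (Fin N × Fin R)

/-- The edge set after Matcher's reply. -/
def addReply {N R : ℕ} (M : Finset (Fin N × Fin R)) :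
    Option (Fin N × Fin R) → Finset (Fin N × Fin R)
  | none => M
  | some e => insert e M

/-- The edge set maintained in the game after the given turns of Requester (the last one first),
each answered according to `σ`. -/
def position {N R : ℕ} (σ : Strategy N R) : List (Turn N R) → Finset (Fin N × Fin R)
  | [] => ∅
  | u :: h => addReply (position σ h \ u.removed) (σ (u :: h))

/-- Requester has followed the rules: he removes edges that are present, and afterwards at most
`K - 1` edges are left. -/
def LegalPlay {N R : ℕ} (K : ℕ) (σ : Strategy N R) : List (Turn N R) → Prop
  | [] => True
  | u :: h => LegalPlay K σ h ∧ u.removed ⊆ position σ h ∧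
      (position σ h \ u.removed).card + 1 ≤ K

namespace LeftRegularGraph

variable {N D R : ℕ}

/-- `G` has dynamic matching up to `K` with load `ℓ`: Matcher has a strategy such that after each of
her turns, whatever (legal) turns Requester made, the edge that she added (if any) is an edge of
`G`, the selected node is incident on an edge, and every right node has load at most `ℓ`. -/
def HasDynamicMatching (G : LeftRegularGraph N D R) (K ℓ : ℕ) : Prop :=
  ∃ σ : Strategy N R, ∀ (u : Turn N R) (h : List (Turn N R)), LegalPlay K σ (u :: h) →
    (∀ e, σ (u :: h) = some e → e.2 ∈ G.neighbors e.1) ∧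
    (∃ y, (u.request, y) ∈ position σ (u :: h)) ∧
    ∀ y, load (position σ (u :: h)) y ≤ ℓ

end LeftRegularGraph

/-! ### A word RAM with a step count -/

/-- The state of the machine: registers and memory cells, each holding one word. A program mentions
only finitely many registers; memory is accessed by indirect addressing. -/
structure Store where
  reg : ℕ → ℕ
  mem : ℕ → ℕ

/-- Assign a register. -/
def Store.setReg (s : Store) (d v : ℕ) : Store :=
  { s with reg := Function.update s.reg d v }

/-- Assign a memory cell. -/
def Store.setMem (s : Store) (a v : ℕ) : Store :=
  { s with mem := Function.update s.mem a v }

/-- Elementary instructions. Here `d`, `a`, `b` are register numbers. -/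
inductive Instr
  | const (d c : ℕ)
  | move (d a : ℕ)
  | add (d a b : ℕ)
  | sub (d a b : ℕ)
  | mul (d a b : ℕ)
  | div (d a b : ℕ)
  | mod (d a b : ℕ)
  | load (d a : ℕ)
  | store (a b : ℕ)

/-- Execution of an instruction with words of `w` bits: results are reduced modulo `2 ^ w`
(subtraction is truncated at `0`). `load d a` reads the memory cell whose address is in register
`a`; `store a b` writes register `b` to the cell whose address is in register `a`. -/
def Instr.exec (w : ℕ) (s : Store) : Instr → Store
  | .const d c => s.setReg d (c % 2 ^ w)
  | .move d a => s.setReg d (s.reg a)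
  | .add d a b => s.setReg d ((s.reg a + s.reg b) % 2 ^ w)
  | .sub d a b => s.setReg d (s.reg a - s.reg b)
  | .mul d a b => s.setReg d ((s.reg a * s.reg b) % 2 ^ w)
  | .div d a b => s.setReg d (s.reg a / s.reg b)
  | .mod d a b => s.setReg d (s.reg a % s.reg b)
  | .load d a => s.setReg d (s.mem (s.reg a))
  | .store a b => s.setMem (s.reg a) (s.reg b)

/-- Comparisons of two registers. -/
inductive Test
  | lt (a b : ℕ)
  | eq (a b : ℕ)

/-- Evaluation of a comparison. -/
def Test.eval (s : Store) : Test → Bool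
  | .lt a b => decide (s.reg a < s.reg b)
  | .eq a b => decide (s.reg a = s.reg b)

/-- Structured programs of the machine: finite texts, independent of the input. -/
inductive Prog
  | skip
  | instr (i : Instr)
  | seq (p q : Prog)
  | ite (c : Test) (p q : Prog)
  | loop (c : Test) (p : Prog)

/-- One step of the machine, on a pair of a list of programs still to be executed and a store.
Every instruction and every evaluation of a test costs one step. The machine has halted when
nothing is left to execute. -/
def step (w : ℕ) : List Prog × Store → List Prog × Store
  | ([], s) => ([], s)
  | (.skip :: k, s) => (k, s)
  | (.instr i :: k, s) => (k, i.exec w s)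
  | (.seq p q :: k, s) => (p :: q :: k, s)
  | (.ite c p q :: k, s) => (if c.eval s then p :: k else q :: k, s)
  | (.loop c p :: k, s) => (if c.eval s then p :: .loop c p :: k else k, s)

/-- Started in the store `s`, the program `p` halts within `t` steps, in the store `s'`. -/
def HaltsWithin (w : ℕ) (p : Prog) (s : Store) (t : ℕ) (s' : Store) : Prop :=
  (step w)^[t] ([p], s) = ([], s')

/-! ### Data structures for dynamic matching -/

/-- A data structure for dynamic matching: one program that computes a match for a left node, and
one that processes the retraction of an edge. -/
structure DataStructure where
  request : Prog
  retract : Prog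

variable {N D R : ℕ}

/-- The store at the start of the game. Registers `0`, `1`, `2`, `3` hold `N`, `D`, `R` and
`min K N`, cell `x * D + i` holds the `i`-th neighbour of the left node `x`, and all other registers
and cells hold `0`. -/
def initStore (G : LeftRegularGraph N D R) (K : ℕ) : Store where
  reg j := if j = 0 then N else if j = 1 then D else if j = 2 then R else
    if j = 3 then min K N else 0
  mem a := if h : a < N * D then
      (G.nbr ⟨a / D, Nat.div_lt_of_lt_mul (by rwa [Nat.mul_comm] at h)⟩
        ⟨a % D, Nat.mod_lt _ (Nat.pos_of_ne_zero (by rintro rfl; simp at h))⟩ : ℕ)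
    else 0

/-- The request of the left node `x`: it is passed in register `4`. -/
def requestInput (s : Store) (x : Fin N) : Store := s.setReg 4 x

/-- The retraction of the edge `(x, y)`: it is passed in registers `4` and `5`. -/
def retractInput (s : Store) (x : Fin N) (y : Fin R) : Store := (s.setReg 4 x).setReg 5 y

/-- The pairs of a store of the data structure and an edge set of the game that can arise when
Requester plays by the rules (he retracts edges one after the other, in any order, and he selects a
left node only while at most `K - 1` edges are present), each retraction is processed by the
retraction program, and each match is the one that the request program leaves in register `5`. The
store is kept from one operation to the next. -/
inductive Reachable (P : DataStructure) (G : LeftRegularGraph N D R) (K w : ℕ) :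
    Store → Finset (Fin N × Fin R) → Prop
  | start : Reachable P G K w (initStore G K) ∅
  | retract {s s' : Store} {M : Finset (Fin N × Fin R)} {t : ℕ} (x : Fin N) (y : Fin R) :
      Reachable P G K w s M → (x, y) ∈ M →
      HaltsWithin w P.retract (retractInput s x y) t s' →
      Reachable P G K w s' (M.erase (x, y))
  | request {s s' : Store} {M : Finset (Fin N × Fin R)} {t : ℕ} (x : Fin N) (y : Fin R) :
      Reachable P G K w s M → M.card + 1 ≤ K →
      HaltsWithin w P.request (requestInput s x) t s' → s'.reg 5 = (y : ℕ) →
      Reachable P G K w s' (insert (x, y) M)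

/-- On a machine with words of `w` bits, the data structure `P` plays the matching game on `G` with
parameters `K` and `ℓ` for Matcher without ever losing, and it processes every single retraction and
computes every single match within `τ` steps. -/
structure DataStructure.PlaysWithin (P : DataStructure) (G : LeftRegularGraph N D R)
    (K ℓ τ w : ℕ) : Prop where
  retract : ∀ s M, Reachable P G K w s M → ∀ x y, (x, y) ∈ M →
    ∃ s', HaltsWithin w P.retract (retractInput s x y) τ s'
  request : ∀ s M, Reachable P G K w s M → M.card + 1 ≤ K → ∀ x : Fin N,
    ∃ s', HaltsWithin w P.request (requestInput s x) τ s' ∧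
      ∃ y : Fin R, s'.reg 5 = (y : ℕ) ∧ y ∈ G.neighbors x ∧
        ∀ z, load (insert (x, y) M) z ≤ ℓ

end DynMatch

/-! ### Greedy placement in one copy of the right side. -/

namespace DynMatch

open Finset

/-! Matcher assigns homes: a home of a left node is a right neighbour in one of `l + 2` copies of
the right side, and the edge of an active node leads to its home. The homes granted last in each
copy are recorded in a ring of `K` slots. A node in its ring keeps its home when its edge is
retracted, so a new request for it costs nothing. When its slot is reused, the node keeps the home
only as long as it is active. So a copy never has more than `2K` homes, `K` in the ring and `K`
active (`Lay.Ok.card_homes`).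

The first layer consists of `l` copies, the levels, in which a right node serves at most one home. A
node without a home takes the first level where it has a free neighbour. Consider a period in which
at most `K` nodes arrive at a level. Those that pass it are distinct, because they stay in rings
further on, and all their neighbours were occupied at some time in the period; at most `2K + K`
right nodes can have been. As `D ≥ 6`, expansion is at least sixfold, so at most `K / 2` nodes pass
(`Lay.arr_succ_le`). Halving at every level shows that `K` arrivals at the last layer need more than
`2 ^ (l - 1)` arrivals in total (`Lay.lt_arr`).

The last layer has two copies, used in turn for `K` homes each. A copy in use has a set `F` of
forbidden right nodes, which carry the old load, and a set `T` of reserved left nodes. Left nodes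
outside `T` have fewer than `D / 3` neighbours in `F`, so sets of at most `K` of them still expand
by `D / 3 + 2 ≥ 4` outside `F`. Placing up to `2K` of them greedily at a least loaded allowed
neighbour therefore gives only logarithmic load (`Net.Batch.cnt_le`). A reserved node has a place
prepared in advance.

While one copy is in use the other one is renewed. The places of its homes, fewer than `2K`, are
marked; a left node with at least `D / 3` marked neighbours is reserved and all its neighbours are
marked, until nothing changes. Each reservation marks at most `2D / 3` new right nodes, so expansion
by `2D / 3 + 2` stops this before `K` nodes are reserved (`Net.Pass.step`). The newly reserved nodes
are placed greedily by the old rules; then the marked nodes become the forbidden ones and the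
counters restart at zero (`Net.Frozen.done`). This takes `N + 4` passes over the left nodes. Every
request of a node without a home pays for one step, and `2 ^ (l - 1) ≥ N (N + 4)`, so the renewal is
complete before the copies are exchanged (`St.Inv.place`).

The total load is at most `l + 2 * Λ` (`St.Inv.load_le`), with `l` and the load `Λ` of a copy of
order `log N`. A request scans at most one neighbourhood per level and makes one renewal step, each
with `O(D)` work. The state is stored in a table in memory (`Tab`), the programs are verified in a
Hoare logic with a step count (`Run`), and `Reachable.sound` transfers the invariant to every
reachable store. -/

/-- A left-regular bipartite graph whose nodes are natural numbers, with a capacity `K`. -/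
structure Net where
  N : ℕ
  D : ℕ
  K : ℕ
  nb : ℕ → ℕ → ℕ

namespace Net

variable (g : Net)

/-- The neighbours of a left node. -/
def nbrs (x : ℕ) : Finset ℕ := (range g.D).image (g.nb x)

/-- The neighbours of a set of left nodes. -/
def nbrsOf (S : Finset ℕ) : Finset ℕ := S.biUnion g.nbrs

/-- The right nodes that have a neighbour. -/
def right : Finset ℕ := g.nbrsOf (range g.N)

/-- Expansion by the factor `2 D / 3 + 2` up to `K`, in integers. -/
structure Expanding : Prop where
  six_le : 6 ≤ g.D
  pos : 1 ≤ g.K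
  le : g.K ≤ g.N
  inj : ∀ x < g.N, Set.InjOn (g.nb x) (range g.D)
  expand : ∀ S ⊆ range g.N, S.card ≤ g.K → (2 * g.D + 6) * S.card ≤ 3 * (g.nbrsOf S).card

variable {g}

lemma card_nbrs_le (x : ℕ) : (g.nbrs x).card ≤ g.D := by
  unfold nbrs
  simpa using card_image_le (s := range g.D) (f := g.nb x)

lemma Expanding.card_nbrs (h : g.Expanding) {x : ℕ} (hx : x < g.N) : (g.nbrs x).card = g.D := by
  unfold nbrs
  rw [card_image_of_injOn (h.inj x hx), card_range]

lemma nbrs_subset_right {x : ℕ} (hx : x < g.N) : g.nbrs x ⊆ g.right :=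
  subset_biUnion_of_mem g.nbrs (mem_range.2 hx)

/-- Nodes with few neighbours in `F` expand outside `F`. -/
lemma Expanding.card_free (h : g.Expanding) {S F : Finset ℕ} (hS : S ⊆ range g.N)
    (hK : S.card ≤ g.K) (hF : ∀ x ∈ S, 3 * (g.nbrs x ∩ F).card < g.D) :
    4 * S.card ≤ (g.nbrsOf S \ F).card := by
  have h1 := h.expand S hS hK
  have h2 : (g.nbrsOf S ∩ F).card ≤ ∑ x ∈ S, (g.nbrs x ∩ F).card := by
    unfold nbrsOf
    rw [biUnion_inter]
    exact card_biUnion_le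
  have h3 : 3 * ∑ x ∈ S, (g.nbrs x ∩ F).card ≤ g.D * S.card := by
    rw [mul_sum, mul_comm, ← smul_eq_mul, ← sum_const]
    exact sum_le_sum fun x hx => (hF x hx).le
  have h4 := card_sdiff_add_card_inter (g.nbrsOf S) F
  -- Each node of `S` contributes `2D/3 + 2` on average and loses at most `D/3`; the rest, `D/3 +
  -- 2`, is at least `4` because `D ≥ 6`.
  have h5 := h.six_le
  have h6 : 6 * S.card ≤ g.D * S.card := Nat.mul_le_mul_right _ h5
  nlinarith

/-- The data of one copy of the right side: reserved left nodes `T`, forbidden right nodes `F`,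
the numbers of places taken at right nodes since `F` was fixed, and the places. -/
structure Copy where
  T : Finset ℕ
  F : Finset ℕ
  cnt : ℕ → ℕ
  pl : ℕ → ℕ

/-- Left nodes that are not reserved have few forbidden neighbours. -/
structure Closed (g : Net) (T F : Finset ℕ) : Prop where
  nbrs_subset : ∀ z ∈ T, g.nbrs z ⊆ F
  few : ∀ z < g.N, z ∉ T → 3 * (g.nbrs z ∩ F).card < g.D

/-- The counters arise from placing distinct nodes of `W` greedily. -/
def Batch (g : Net) (c : Copy) (W : Finset ℕ) : Prop :=
  ∃ X ⊆ W, ∃ ht : ℕ → ℕ, X ⊆ range g.N ∧ Disjoint X c.T ∧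
    (∀ x ∈ X, ∀ y ∈ g.nbrs x, y ∉ c.F → ht x ≤ c.cnt y) ∧
    ∀ j, (g.right.filter fun y => y ∉ c.F ∧ j < c.cnt y).card ≤ (X.filter fun x => j ≤ ht x).card

/-- The places of the nodes in `V` have bounded load. -/
structure Places (g : Net) (Λ : ℕ) (c : Copy) (V : Finset ℕ) : Prop where
  mem : ∀ z ∈ V, c.pl z ∈ g.nbrs z
  card : ∀ y, (V.filter fun z => c.pl z = y).card ≤ if y ∈ c.F then Λ else c.cnt y

/-- `y` is a neighbour of `x` that is not forbidden, of smallest count. -/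
structure Select (g : Net) (c : Copy) (x y : ℕ) : Prop where
  mem : y ∈ g.nbrs x
  notMem : y ∉ c.F
  le : ∀ y' ∈ g.nbrs x, y' ∉ c.F → c.cnt y ≤ c.cnt y'

/-- Place `x` at `y`. -/
def Copy.assign (c : Copy) (x y : ℕ) : Copy :=
  { c with cnt := Function.update c.cnt y (c.cnt y + 1), pl := Function.update c.pl x y }

/-- Otherwise all `D` neighbours would be forbidden, but fewer than a third are. -/
lemma Closed.exists_free (h : g.Expanding) {T F : Finset ℕ} (hc : g.Closed T F) {x : ℕ}
    (hx : x < g.N) (hT : x ∉ T) : ∃ y ∈ g.nbrs x, y ∉ F := by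
  by_contra! hn
  have h1 := hc.few x hx hT
  rw [inter_eq_left.2 hn, h.card_nbrs hx] at h1
  omega

lemma Batch.mono {c : Copy} {W W' : Finset ℕ} (h : g.Batch c W) (hW : W ⊆ W') : g.Batch c W' := by
  obtain ⟨X, hX, r⟩ := h
  exact ⟨X, hX.trans hW, r⟩

/-- Layered induction: a node of height at least `j + 1` had only allowed neighbours with counters
above `j`, and these are four times as many as such nodes by expansion outside `F`. Each of them is
paid for by a node of height at least `j`. So the number of nodes of height at least `j` falls by a
factor `4` with each `j`, starting from at most `2K`. -/
lemma Batch.cnt_le (h : g.Expanding) {c : Copy} {W : Finset ℕ} {Λ : ℕ} (hc : g.Closed c.T c.F)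
    (hb : g.Batch c W) (hW : W.card ≤ 2 * g.K) (hΛ : 2 * g.K < 4 ^ Λ) {y : ℕ} (hy : y ∈ g.right)
    (hyF : y ∉ c.F) : c.cnt y ≤ Λ := by
  obtain ⟨X, hX, ht, hXN, hXT, h1, h2⟩ := hb
  have hXc : X.card ≤ 2 * g.K := (card_le_card hX).trans hW
  have key : ∀ j, ∀ S ⊆ X.filter (fun x => j + 1 ≤ ht x), S.card ≤ g.K →
      4 * S.card ≤ (X.filter fun x => j ≤ ht x).card := by
    intro j S hS hSK
    have hSX : S ⊆ X := hS.trans (filter_subset _ _)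
    refine (h.card_free (hSX.trans hXN) hSK (F := c.F) fun x hx => ?_).trans
      ((card_le_card ?_).trans (h2 j))
    · exact hc.few x (mem_range.1 (hXN (hSX hx))) fun hxT => disjoint_left.1 hXT (hSX hx) hxT
    · intro y hy
      obtain ⟨hy1, hy2⟩ := mem_sdiff.1 hy
      obtain ⟨x, hx, hxy⟩ := mem_biUnion.1 hy1
      refine mem_filter.2 ⟨nbrs_subset_right (mem_range.1 (hXN (hSX hx))) hxy, hy2, ?_⟩
      have := (mem_filter.1 (hS hx)).2
      have := h1 x (hSX hx) y hxy hy2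
      omega
  have key2 : ∀ j, 4 ^ j * (X.filter fun x => j ≤ ht x).card ≤ 2 * g.K := by
    intro j
    induction j with
    | zero => simpa using hXc
    | succ j ih =>
      by_cases hcard : (X.filter fun x => j + 1 ≤ ht x).card ≤ g.K
      · have := key j _ Subset.rfl hcard
        calc _ = 4 ^ j * (4 * (X.filter fun x => j + 1 ≤ ht x).card) := by ring
          _ ≤ 4 ^ j * (X.filter fun x => j ≤ ht x).card := Nat.mul_le_mul_left _ this
          _ ≤ _ := ih
      -- Expansion covers only `K` nodes. If there were more of this height, `K` of them would force
      -- `4K` nodes one step lower, but there are at most `2K`.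
      · exfalso
        obtain ⟨S, hS, hSc⟩ := exists_subset_card_eq (not_le.1 hcard).le
        have := key j S hS hSc.le
        have h3 := (card_filter_le X fun x => j ≤ ht x).trans hXc
        have := h.pos
        omega
  by_contra! hlt
  have h3 : 1 ≤ (g.right.filter fun y => y ∉ c.F ∧ Λ < c.cnt y).card :=
    card_pos.2 ⟨y, mem_filter.2 ⟨hy, hyF, hlt⟩⟩
  have h4 := key2 Λ
  have h5 := h3.trans (h2 Λ)
  have h6 : 4 ^ Λ * 1 ≤ 4 ^ Λ * (X.filter fun x => Λ ≤ ht x).card := Nat.mul_le_mul_left _ h5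
  omega

lemma Places.mono {Λ : ℕ} {c : Copy} {V V' : Finset ℕ} (h : g.Places Λ c V) (hV : V' ⊆ V) :
    g.Places Λ c V' :=
  ⟨fun z hz => h.mem z (hV hz),
    fun y => (card_le_card (filter_subset_filter _ hV)).trans (h.card y)⟩

/-- On forbidden nodes the bound is inherited from the previous use of the copy; elsewhere the
counter dominates the load and is bounded by `Batch.cnt_le`. -/
lemma Places.load_le (h : g.Expanding) {c : Copy} {V W : Finset ℕ} {Λ : ℕ}
    (hc : g.Closed c.T c.F) (hb : g.Batch c W) (hW : W.card ≤ 2 * g.K) (hΛ : 2 * g.K < 4 ^ Λ)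
    (hp : g.Places Λ c V) (hV : V ⊆ range g.N) (y : ℕ) :
    (V.filter fun z => c.pl z = y).card ≤ Λ := by
  rcases (V.filter fun z => c.pl z = y).eq_empty_or_nonempty with h0 | ⟨z, hz⟩
  · simp [h0]
  · obtain ⟨hz1, rfl⟩ := mem_filter.1 hz
    refine (hp.card _).trans ?_
    split_ifs with hF
    · exact le_rfl
    · exact hb.cnt_le h hc hW hΛ (nbrs_subset_right (mem_range.1 (hV hz1)) (hp.mem z hz1)) hF

/-- The new node gets as height the old counter of `y`, which is a lower bound for the counters of
all its allowed neighbours by the choice of `y`. -/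
lemma Batch.assign {c : Copy} {W : Finset ℕ} {x y : ℕ} (hb : g.Batch c W) (hx : x < g.N)
    (hxT : x ∉ c.T) (hxW : x ∉ W) (hs : g.Select c x y) : g.Batch (c.assign x y) (insert x W) := by
  obtain ⟨X, hX, ht, hXN, hXT, h1, h2⟩ := hb
  have hxX : x ∉ X := fun hxX => hxW (hX hxX)
  have hne : ∀ x' ∈ X, x' ≠ x := fun x' hx' e => hxX (e ▸ hx')
  have hcnt : ∀ y', c.cnt y' ≤ (c.assign x y).cnt y' := by
    intro y'
    simp only [Copy.assign, Function.update_apply]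
    split_ifs with hy
    · subst hy; omega
    · exact le_rfl
  refine ⟨insert x X, insert_subset_insert _ hX, Function.update ht x (c.cnt y), ?_, ?_, ?_, ?_⟩
  · exact insert_subset (mem_range.2 hx) hXN
  · exact disjoint_insert_left.2 ⟨hxT, hXT⟩
  · intro x' hx' y' hy' hF
    refine le_trans ?_ (hcnt y')
    rcases mem_insert.1 hx' with rfl | hx'
    · simpa using hs.le y' hy' hF
    · rw [Function.update_of_ne (hne x' hx')]
      exact h1 x' hx' y' hy' hF
  · intro j
    have e1 : ((insert x X).filter fun x' => j ≤ Function.update ht x (c.cnt y) x').card =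
        (X.filter fun x' => j ≤ ht x').card + if j ≤ c.cnt y then 1 else 0 := by
      have : X.filter (fun x' => j ≤ Function.update ht x (c.cnt y) x') =
          X.filter fun x' => j ≤ ht x' :=
        filter_congr fun x' hx' => by rw [Function.update_of_ne (hne x' hx')]
      rw [filter_insert, this, Function.update_self]
      split_ifs
      · rw [card_insert_of_notMem fun hm => hxX (mem_filter.1 hm).1]
      · rfl
    rw [e1]
    have h3 := h2 j
    -- Only for this `j` does a further right node exceed `j`, and there the new node pays for it.
    by_cases hj : j = c.cnt y
    · have : (g.right.filter fun y' => y' ∉ (c.assign x y).F ∧ j < (c.assign x y).cnt y') ⊆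
          insert y (g.right.filter fun y' => y' ∉ c.F ∧ j < c.cnt y') := by
        intro y' hy'
        simp only [mem_filter, Copy.assign, Function.update_apply, mem_insert] at hy' ⊢
        split_ifs at hy' with e
        · exact Or.inl e
        · exact Or.inr hy'
      have h4 := (card_le_card this).trans (card_insert_le _ _)
      rw [if_pos hj.le]
      omega
    · have : (g.right.filter fun y' => y' ∉ (c.assign x y).F ∧ j < (c.assign x y).cnt y') ⊆
          (g.right.filter fun y' => y' ∉ c.F ∧ j < c.cnt y') := by
        intro y' hy'
        simp only [mem_filter, Copy.assign, Function.update_apply] at hy' ⊢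
        split_ifs at hy' with e
        · subst e
          exact ⟨hy'.1, hy'.2.1, by omega⟩
        · exact hy'
      have h4 := card_le_card this
      omega

lemma Places.assign {Λ : ℕ} {c : Copy} {V : Finset ℕ} {x y : ℕ} (hp : g.Places Λ c V)
    (hxV : x ∉ V) (hs : g.Select c x y) : g.Places Λ (c.assign x y) (insert x V) := by
  have hne : ∀ z ∈ V, z ≠ x := fun z hz e => hxV (e ▸ hz)
  constructor
  · intro z hz
    rcases mem_insert.1 hz with rfl | hz
    · simpa [Copy.assign] using hs.mem
    · simpa [Copy.assign, Function.update_of_ne (hne z hz)] using hp.mem z hz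
  · intro y'
    have e1 : V.filter (fun z => (c.assign x y).pl z = y') = V.filter fun z => c.pl z = y' :=
      filter_congr fun z hz => by simp [Copy.assign, Function.update_of_ne (hne z hz)]
    have h2 := hp.card y'
    rw [filter_insert, e1]
    simp only [Copy.assign, Function.update_self, Function.update_apply]
    by_cases hy : y = y'
    · subst hy
      have := hs.notMem
      rw [if_neg this] at h2
      rw [if_pos rfl, if_neg this, if_pos rfl]
      exact (card_insert_le _ _).trans (by omega)
    · rw [if_neg hy, if_neg (Ne.symm hy)]
      exact h2

end Net

end DynMatch

/-! ### Renewal of the copy that is not in use. -/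

namespace DynMatch

open Finset

namespace Net

variable {g : Net}

/-- One step of the background computation for the frozen copy `c` with homes `H`, in pass `p`, at
the left node `z`; `S` and `E` are the sets of reserved and of forbidden nodes under construction. -/
inductive BgStep (g : Net) (H : Finset ℕ) (c : Copy) (S E : Finset ℕ) :
    ℕ → ℕ → Copy → Finset ℕ → Finset ℕ → Prop
  | clear (z : ℕ) : BgStep g H c S E (g.N + 3) z c (S.erase z) (E \ g.nbrs z)
  | mark (z : ℕ) : z ∈ H → BgStep g H c S E (g.N + 2) z c S (insert (c.pl z) E)
  | markSkip (z : ℕ) : z ∉ H → BgStep g H c S E (g.N + 2) z c S E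
  | close (p z : ℕ) : 2 ≤ p → p < g.N + 2 → z ∉ S → g.D ≤ 3 * (g.nbrs z ∩ E).card →
      BgStep g H c S E p z c (insert z S) (E ∪ g.nbrs z)
  | closeSkip (p z : ℕ) : 2 ≤ p → p < g.N + 2 → (z ∈ S ∨ 3 * (g.nbrs z ∩ E).card < g.D) →
      BgStep g H c S E p z c S E
  | place (z y : ℕ) : z ∈ S → z ∉ c.T → z ∉ H → g.Select c z y →
      BgStep g H c S E 1 z (c.assign z y) S E
  | placeSkip (z : ℕ) : (z ∉ S ∨ z ∈ c.T ∨ z ∈ H) → BgStep g H c S E 1 z c S E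
  | finish (z : ℕ) : BgStep g H c S E 0 z
      { T := if z ∈ S then insert z c.T else c.T.erase z
        F := (c.F \ g.nbrs z) ∪ (E ∩ g.nbrs z)
        cnt := fun y => if y ∈ g.nbrs z then 0 else c.cnt y
        pl := c.pl } S E

/-- The new sets are complete. -/
structure Ready (g : Net) (c : Copy) (S E H : Finset ℕ) : Prop where
  closed : g.Closed S E
  card : S.card ≤ g.K
  home : ∀ z ∈ H, c.pl z ∈ E

/-- The properties of a copy that is in use. -/
structure Using (g : Net) (Λ : ℕ) (c : Copy) (V W : Finset ℕ) : Prop where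
  closed : g.Closed c.T c.F
  batch : g.Batch c W
  places : g.Places Λ c V

/-- The state of the background computation in pass `p` when `r` left nodes remain. -/
inductive Pass (g : Net) (Λ : ℕ) (c : Copy) (S E H W : Finset ℕ) : ℕ → ℕ → Prop
  | clear (r : ℕ) : g.Using Λ c (c.T ∪ H) W →
      (∀ z, r ≤ z → z < g.N → z ∉ S ∧ Disjoint (g.nbrs z) E) → Pass g Λ c S E H W (g.N + 3) r
  | mark (r : ℕ) : g.Using Λ c (c.T ∪ H) W → S = ∅ →
      E.card + (H.filter (· < r)).card < 2 * g.K → (∀ z ∈ H, r ≤ z → c.pl z ∈ E) →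
      Pass g Λ c S E H W (g.N + 2) r
  | close (p r : ℕ) : 2 ≤ p → p < g.N + 2 → g.Using Λ c (c.T ∪ H) W →
      (∀ z ∈ S, g.nbrs z ⊆ E) → (∀ z ∈ H, c.pl z ∈ E) → S.card < g.K →
      3 * E.card + 3 ≤ 6 * g.K + 2 * g.D * S.card →
      (g.N + 2 ≤ S.card + p ∨
        (g.N + 1 ≤ S.card + p ∧ ∀ z, r ≤ z → z < g.N → z ∈ S ∨ 3 * (g.nbrs z ∩ E).card < g.D) ∨
        ∀ z < g.N, z ∈ S ∨ 3 * (g.nbrs z ∩ E).card < g.D) → Pass g Λ c S E H W p r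
  | place (r : ℕ) : g.Ready c S E H →
      g.Using Λ c (c.T ∪ H ∪ S.filter (r ≤ ·)) (W ∪ S.filter (r ≤ ·)) → Pass g Λ c S E H W 1 r
  | finish (r : ℕ) : g.Ready c S E H → (∀ z ∈ H ∪ S, c.pl z ∈ g.nbrs z) →
      (∀ y, ((H ∪ S).filter fun z => c.pl z = y).card ≤ Λ) →
      (∀ z, r ≤ z → (z ∈ c.T ↔ z ∈ S)) →
      (∀ z, r ≤ z → z < g.N → ∀ y ∈ g.nbrs z, (y ∈ c.F ↔ y ∈ E) ∧ c.cnt y = 0) →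
      Pass g Λ c S E H W 0 r

/-- The sets of nodes in a frozen copy. -/
structure Sized (g : Net) (c : Copy) (S E H W : Finset ℕ) : Prop where
  homes : H ⊆ range g.N
  homes_card : H.card < 2 * g.K
  recent : W ⊆ H
  recent_card : W.card ≤ g.K
  reserved : c.T ⊆ range g.N
  forbidden : c.F ⊆ g.right
  reserved' : S ⊆ range g.N
  forbidden' : E ⊆ g.right

/-- The properties of a frozen copy when `rem` steps of the background computation remain. -/
def Frozen (g : Net) (Λ : ℕ) (c : Copy) (S E H W : Finset ℕ) (rem : ℕ) : Prop :=
  g.Sized c S E H W ∧ ∃ p r, r ≤ g.N ∧ rem = p * g.N + r ∧ g.Pass Λ c S E H W p r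

variable {Λ : ℕ} {c : Copy} {S E H W : Finset ℕ}

lemma Ready.mono {H' : Finset ℕ} (h : g.Ready c S E H) (hH : H' ⊆ H) : g.Ready c S E H' :=
  ⟨h.closed, h.card, fun z hz => h.home z (hH hz)⟩

lemma Using.mono {V V' W' : Finset ℕ} (h : g.Using Λ c V W) (hV : V' ⊆ V) (hW : W ⊆ W') :
    g.Using Λ c V' W' :=
  ⟨h.closed, h.batch.mono hW, h.places.mono hV⟩

/-- While a copy is being renewed it can only lose homes. Every clause about `H` survives this, so
Requester's retractions do not disturb the renewal. -/
lemma Pass.mono {H' : Finset ℕ} {p r : ℕ} (h : g.Pass Λ c S E H W p r) (hH : H' ⊆ H) :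
    g.Pass Λ c S E H' W p r := by
  have hT := union_subset_union_right (s := c.T) hH
  cases h with
  | clear r hu h1 => exact .clear r (hu.mono hT Subset.rfl) h1
  | mark r hu hS h1 h2 =>
    refine .mark r (hu.mono hT Subset.rfl) hS ?_ fun z hz => h2 z (hH hz)
    have := card_le_card (filter_subset_filter (· < r) hH)
    omega
  | close p r hp hp' hu h1 h2 h3 h4 h5 =>
    exact .close p r hp hp' (hu.mono hT Subset.rfl) h1 (fun z hz => h2 z (hH hz)) h3 h4 h5
  | place r hr hu => exact .place r (hr.mono hH) (hu.mono (union_subset_union_left hT) Subset.rfl)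
  | finish r hr h1 h2 h3 h4 =>
    have hU := union_subset_union_left (t := S) hH
    exact .finish r (hr.mono hH) (fun z hz => h1 z (hU hz))
      (fun y => (card_le_card (filter_subset_filter _ hU)).trans (h2 y)) h3 h4

lemma Frozen.mono {H' : Finset ℕ} {rem : ℕ} (h : g.Frozen Λ c S E H W rem) (hH : H' ⊆ H)
    (hW : W ⊆ H') : g.Frozen Λ c S E H' W rem := by
  obtain ⟨hs, p, r, hr, he, hp⟩ := h
  exact ⟨{ hs with
    homes := hH.trans hs.homes
    homes_card := (card_le_card hH).trans_lt hs.homes_card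
    recent := hW }, p, r, hr, he, hp.mono hH⟩

lemma not_le_of_mem_range {A : Finset ℕ} {n z : ℕ} (hA : A ⊆ range n) (hz : z ∈ A) : ¬ n ≤ z :=
  not_le.2 (mem_range.1 (hA hz))

/-- The end of a pass is the beginning of the next one. -/
lemma Pass.next (h : g.Expanding) (hΛ : 2 * g.K < 4 ^ Λ) (hs : g.Sized c S E H W) {p : ℕ}
    (hp : g.Pass Λ c S E H W (p + 1) 0) : g.Pass Λ c S E H W p g.N := by
  have hK := h.pos
  have hKN := h.le
  generalize hq : p + 1 = q at hp
  generalize hr0 : 0 = r at hp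
  cases hp with
  | clear r hu h1 =>
    subst hr0
    obtain rfl : p = g.N + 2 := by omega
    have hS : S = ∅ := eq_empty_of_forall_notMem fun z hz =>
      (h1 z (Nat.zero_le _) (mem_range.1 (hs.reserved' hz))).1 hz
    have hE : E = ∅ := by
      refine eq_empty_of_forall_notMem fun y hy => ?_
      obtain ⟨x, hx, hxy⟩ := mem_biUnion.1 (hs.forbidden' hy)
      exact disjoint_left.1 (h1 x (Nat.zero_le _) (mem_range.1 hx)).2 hxy hy
    refine .mark _ hu hS ?_ fun z hz hz' => absurd hz' (not_le_of_mem_range hs.homes hz)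
    rw [hE, card_empty, zero_add]
    exact (card_filter_le _ _).trans_lt hs.homes_card
  | mark r hu hS h1 h2 =>
    subst hr0
    obtain rfl : p = g.N + 1 := by omega
    -- The strict bound `E.card < 2K` gives the initial inequality `3 * E.card + 3 ≤ 6K`; the slack
    -- `3` later makes `S.card < K` strict.
    refine .close _ _ (by omega) (by omega) hu (by simp [hS]) (fun z hz => h2 z hz (Nat.zero_le _))
      (by simp [hS]; omega) (by simp [hS]; omega) (Or.inr (Or.inl ⟨by omega, fun z hz hz' => ?_⟩))
    omega
  | close p' r hp hp' hu h1 h2 h3 h4 h5 =>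
    subst hr0 hq
    have h6 : g.N + 2 ≤ S.card + (p + 1) ∨
        ∀ z < g.N, z ∈ S ∨ 3 * (g.nbrs z ∩ E).card < g.D := by
      rcases h5 with h5 | h5 | h5
      · exact Or.inl h5
      · exact Or.inr fun z hz => h5.2 z (Nat.zero_le _) hz
      · exact Or.inr h5
    by_cases hp2 : p = 1
    · subst hp2
      refine .place _ ⟨⟨h1, fun z hz hzS => ?_⟩, h3.le, h2⟩ (hu.mono ?_ subset_union_left)
      · rcases h6 with h6 | h6
        -- A pass that leaves something to do reserves a node. After `N` such passes `S` would have
        -- `N` elements, but `S.card < K ≤ N`.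
        · omega
        · exact (h6 z hz).resolve_left hzS
      · refine union_subset Subset.rfl fun z hz => ?_
        obtain ⟨hz1, hz2⟩ := mem_filter.1 hz
        exact absurd hz2 (not_le_of_mem_range hs.reserved' hz1)
    · refine .close _ _ (by omega) (by omega) hu h1 h2 h3 h4 ?_
      rcases h6 with h6 | h6
      · by_cases h7 : g.N + 2 ≤ S.card + p
        · exact Or.inl h7
        · exact Or.inr (Or.inl ⟨by omega, fun z hz hz' => by omega⟩)
      · exact Or.inr (Or.inr h6)
  | place r hr hu =>
    subst hr0
    obtain rfl : p = 0 := by omega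
    have e : S.filter (0 ≤ ·) = S := filter_true_of_mem fun z _ => Nat.zero_le z
    rw [e] at hu
    have hV : H ∪ S ⊆ c.T ∪ H ∪ S := union_subset_union_left subset_union_right
    have hVN : c.T ∪ H ∪ S ⊆ range g.N :=
      union_subset (union_subset hs.reserved hs.homes) hs.reserved'
    -- The batch of a copy: at most `K` homes granted in its last use, and at most `K` newly
    -- reserved nodes. This is why `Batch.cnt_le` admits `2K` nodes.
    have hW : (W ∪ S).card ≤ 2 * g.K := by
      have := card_union_le W S
      have := hs.recent_card
      have := hr.card
      omega
    refine .finish _ hr (fun z hz => hu.places.mem z (hV hz)) (fun y => ?_) (fun z hz => ?_)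
      fun z hz hz' => by omega
    · exact (card_le_card (filter_subset_filter _ hV)).trans
        (hu.places.load_le h hu.closed hu.batch hW hΛ hVN y)
    · exact iff_of_false (fun hm => not_le_of_mem_range hs.reserved hm hz)
        fun hm => not_le_of_mem_range hs.reserved' hm hz
  | finish => omega

lemma card_filter_lt_succ (H : Finset ℕ) (r : ℕ) :
    (H.filter (· < r + 1)).card = (H.filter (· < r)).card + if r ∈ H then 1 else 0 := by
  split_ifs with hr
  · have : H.filter (· < r + 1) = insert r (H.filter (· < r)) := by
      ext z
      simp only [mem_filter, mem_insert]
      constructor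
      · rintro ⟨h1, h2⟩
        by_cases e : z = r
        · exact Or.inl e
        · exact Or.inr ⟨h1, by omega⟩
      · rintro (rfl | ⟨h1, h2⟩)
        · exact ⟨hr, by omega⟩
        · exact ⟨h1, by omega⟩
    rw [this, card_insert_of_notMem (by simp)]
  · rw [add_zero]
    congr 1
    refine filter_congr fun z hz => ?_
    have : z ≠ r := fun e => hr (e ▸ hz)
    omega

lemma filter_le_eq_insert {S : Finset ℕ} {r : ℕ} (hr : r ∈ S) :
    S.filter (r ≤ ·) = insert r (S.filter (r + 1 ≤ ·)) := by
  ext z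
  simp only [mem_filter, mem_insert]
  constructor
  · rintro ⟨h1, h2⟩
    by_cases e : z = r
    · exact Or.inl e
    · exact Or.inr ⟨h1, by omega⟩
  · rintro (rfl | ⟨h1, h2⟩)
    · exact ⟨hr, le_rfl⟩
    · exact ⟨h1, by omega⟩

lemma eq_or_succ_le {r z : ℕ} (h : r ≤ z) : z = r ∨ r + 1 ≤ z := by omega

/-- The critical case is the closure. With `3 * E.card + 3 ≤ 6K + 2D * S.card` and all neighbours of
`S` in `E`, expansion of `S` gives `6 * S.card + 3 ≤ 6K`, so the closure reserves fewer than `K`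
nodes. Progress is measured by `S.card + p`: as long as the closure is incomplete, the reserved
nodes keep up with the passes made. -/
lemma Pass.step (h : g.Expanding) (hs : g.Sized c S E H W) {p r : ℕ} (hr : r < g.N)
    (hp : g.Pass Λ c S E H W p (r + 1)) {c' : Copy} {S' E' : Finset ℕ}
    (hb : g.BgStep H c S E p r c' S' E') :
    g.Sized c' S' E' H W ∧ g.Pass Λ c' S' E' H W p r := by
  have hK := h.pos
  have hKN := h.le
  have hD := h.six_le
  generalize hp0 : p = p0 at hb
  generalize hr0 : r + 1 = r1 at hp
  cases hb with
  | clear z =>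
    refine ⟨{ hs with
      reserved' := (erase_subset _ _).trans hs.reserved'
      forbidden' := sdiff_subset.trans hs.forbidden' }, ?_⟩
    cases hp with
    | clear r' hu h1 =>
      refine .clear _ hu fun z' hz hz' => ?_
      rcases eq_or_succ_le hz with rfl | hz
      · exact ⟨notMem_erase _ _, disjoint_sdiff⟩
      · obtain ⟨h3, h4⟩ := h1 z' (hr0 ▸ hz) hz'
        exact ⟨fun hm => h3 (mem_of_mem_erase hm), h4.mono_right sdiff_subset⟩
    | _ => omega
  | mark z hz =>
    refine ⟨{ hs with forbidden' := insert_subset ?_ hs.forbidden' }, ?_⟩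
    · cases hp with
      | mark r' hu =>
        exact nbrs_subset_right hr (hu.places.mem _ (mem_union_right _ hz))
      | _ => omega
    · cases hp with
      | mark r' hu hS h1 h2 =>
        subst hr0
        refine .mark _ hu hS ?_ fun z' hz1 hz2 => ?_
        · rw [card_filter_lt_succ, if_pos hz] at h1
          have := card_insert_le (c.pl r) E
          omega
        · rcases eq_or_succ_le hz2 with rfl | hz2
          · exact mem_insert_self _ _
          · exact mem_insert_of_mem (h2 z' hz1 hz2)
      | _ => omega
  | markSkip z hz =>
    refine ⟨hs, ?_⟩
    cases hp with
    | mark r' hu hS h1 h2 =>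
      subst hr0
      refine .mark _ hu hS ?_ fun z' hz1 hz2 => ?_
      · rwa [card_filter_lt_succ, if_neg hz] at h1
      · rcases eq_or_succ_le hz2 with rfl | hz2
        · exact absurd hz1 hz
        · exact h2 z' hz1 hz2
    | _ => omega
  | close p' z hp1 hp2 hz hf =>
    subst hp0
    refine ⟨{ hs with
      reserved' := insert_subset (mem_range.2 hr) hs.reserved'
      forbidden' := union_subset hs.forbidden' (nbrs_subset_right hr) }, ?_⟩
    cases hp with
    | close p' r' _ _ hu h1 h2 h3 h4 h5 =>
      have hc : (insert r S).card = S.card + 1 := card_insert_of_notMem hz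
      have hsub : ∀ x ∈ insert r S, g.nbrs x ⊆ E ∪ g.nbrs r := by
        intro x hx
        rcases mem_insert.1 hx with rfl | hx
        · exact subset_union_right
        · exact (h1 x hx).trans subset_union_left
      -- At least a third of the `D` neighbours of `r` were marked already, so at most `2D/3` are
      -- new.
      have hE : 3 * (E ∪ g.nbrs r).card ≤ 3 * E.card + 2 * g.D := by
        have e1 := card_union_add_card_inter E (g.nbrs r)
        rw [inter_comm] at e1
        have e2 := card_nbrs_le (g := g) r
        omega
      have h4' : 3 * (E ∪ g.nbrs r).card + 3 ≤ 6 * g.K + 2 * g.D * (insert r S).card := by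
        rw [hc, mul_add, mul_one]
        omega
      -- Expansion may be applied to the enlarged set, because `S.card < K` before the insertion; it
      -- then yields the strict bound again.
      have hexp := h.expand (insert r S) (insert_subset (mem_range.2 hr) hs.reserved') (by omega)
      have hle : (g.nbrsOf (insert r S)).card ≤ (E ∪ g.nbrs r).card :=
        card_le_card (biUnion_subset.2 hsub)
      refine .close _ _ hp1 hp2 hu hsub (fun z' hz' => mem_union_left _ (h2 z' hz')) ?_ h4' ?_
      · rw [add_mul] at hexp
        omega
      -- The reservation compensates for the end of this pass in advance. If the closure had been
      -- complete, `r` would not have been reserved.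
      · left
        rcases h5 with h5 | h5 | h5
        · omega
        · omega
        · have := (h5 r hr).resolve_left hz
          omega
    | _ => omega
  | closeSkip p' z hp1 hp2 hz =>
    subst hp0
    refine ⟨hs, ?_⟩
    cases hp with
    | close p' r' _ _ hu h1 h2 h3 h4 h5 =>
      refine .close _ _ hp1 hp2 hu h1 h2 h3 h4 ?_
      rcases h5 with h5 | h5 | h5
      · exact Or.inl h5
      · refine Or.inr (Or.inl ⟨h5.1, fun z' h6 h7 => ?_⟩)
        rcases eq_or_succ_le h6 with rfl | h6
        · exact hz
        · exact h5.2 z' (hr0 ▸ h6) h7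
      · exact Or.inr (Or.inr h5)
    | _ => omega
  | place z y hzS hzT hzH hsel =>
    refine ⟨{ hs with
      reserved := hs.reserved
      forbidden := hs.forbidden }, ?_⟩
    cases hp with
    | place r' hrd hu =>
      subst hr0
      have hzf : r ∉ S.filter (r + 1 ≤ ·) := fun hm => by simpa using (mem_filter.1 hm).2
      refine .place _ ⟨hrd.closed, hrd.card, fun z' hz' => ?_⟩ ⟨hu.closed, ?_, ?_⟩
      · have : z' ≠ r := fun e => hzH (e ▸ hz')
        simpa [Copy.assign, Function.update_of_ne this] using hrd.home z' hz'
      · rw [filter_le_eq_insert hzS, union_insert]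
        refine hu.batch.assign hr hzT (fun hm => ?_) hsel
        rcases mem_union.1 hm with hm | hm
        · exact hzH (hs.recent hm)
        · exact hzf hm
      · rw [filter_le_eq_insert hzS, union_insert]
        refine hu.places.assign (fun hm => ?_) hsel
        rcases mem_union.1 hm with hm | hm
        · rcases mem_union.1 hm with hm | hm
          · exact hzT hm
          · exact hzH hm
        · exact hzf hm
    | close => omega
    | _ => omega
  | placeSkip z hz =>
    refine ⟨hs, ?_⟩
    cases hp with
    | place r' hrd hu =>
      subst hr0
      have hf : ∀ z ∈ S, r ≤ z → z = r ∨ z ∈ S.filter (r + 1 ≤ ·) := fun z h1 h2 =>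
        (eq_or_succ_le h2).imp_right fun h2 => mem_filter.2 ⟨h1, h2⟩
      refine .place _ hrd (hu.mono ?_ ?_)
      -- A skipped node of `S` needs no new place: it was reserved before or has a home in this
      -- copy.
      · refine union_subset subset_union_left fun z' hz' => ?_
        obtain ⟨h1, h2⟩ := mem_filter.1 hz'
        rcases hf z' h1 h2 with rfl | h3
        · rcases hz with hz | hz | hz
          · exact absurd h1 hz
          · exact mem_union_left _ (mem_union_left _ hz)
          · exact mem_union_left _ (mem_union_right _ hz)
        · exact mem_union_right _ h3
      · refine union_subset_union_right fun z' hz' => ?_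
        obtain ⟨h1, h2⟩ := mem_filter.1 hz'
        exact mem_filter.2 ⟨h1, by omega⟩
    | close => omega
    | _ => omega
  | finish z =>
    cases hp with
    | finish r' hrd h1 h2 h3 h4 =>
      subst hr0
      refine ⟨{ hs with
        reserved := ?_
        forbidden := ?_ }, .finish _ ⟨hrd.closed, hrd.card, hrd.home⟩ h1 h2
          (fun z' hz => ?_) fun z' hz hz' y hy => ?_⟩
      · dsimp only
        split_ifs
        · exact insert_subset (mem_range.2 hr) hs.reserved
        · exact (erase_subset _ _).trans hs.reserved
      · exact union_subset (sdiff_subset.trans hs.forbidden)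
          (inter_subset_left.trans hs.forbidden')
      · dsimp only
        rcases eq_or_succ_le hz with rfl | hz1
        · split_ifs with hzS <;> simp [hzS]
        · have hne : z' ≠ r := by omega
          rw [← h3 z' hz1]
          split_ifs <;> simp [hne]
      · dsimp only
        by_cases hyr : y ∈ g.nbrs r
        · simp [hyr]
        · rcases eq_or_succ_le hz with rfl | hz1
          · exact absurd hy hyr
          · simpa [hyr] using h4 z' hz1 hz' y hy
    | close => omega
    | _ => omega

/-- A step of the background computation. -/
lemma Frozen.step (h : g.Expanding) (hΛ : 2 * g.K < 4 ^ Λ) {q : ℕ}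
    (hf : g.Frozen Λ c S E H W (q + 1)) {c' : Copy} {S' E' : Finset ℕ}
    (hb : g.BgStep H c S E (q / g.N) (q % g.N) c' S' E') : g.Frozen Λ c' S' E' H W q := by
  obtain ⟨hs, p, r, hr, he, hp⟩ := hf
  have hK := h.pos
  have hKN := h.le
  -- The number of remaining steps encodes the pass and the left node as quotient and remainder by
  -- `N`. The end of pass `p + 1` is first reread as the start of pass `p`.
  obtain ⟨p, r, hr, rfl, hp⟩ : ∃ p r, r < g.N ∧ q = p * g.N + r ∧
      g.Pass Λ c S E H W p (r + 1) := by
    rcases r with _ | r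
    · rcases p with _ | p
      · omega
      · rw [add_mul, one_mul] at he
        refine ⟨p, g.N - 1, by omega, by omega, ?_⟩
        rw [show g.N - 1 + 1 = g.N by omega]
        exact hp.next h hΛ hs
    · exact ⟨p, r, by omega, by omega, hp⟩
  rw [mul_comm, Nat.mul_add_div (by omega), Nat.div_eq_of_lt hr, add_zero, Nat.mul_add_mod,
    Nat.mod_eq_of_lt hr] at hb
  obtain ⟨h1, h2⟩ := hp.step h hs hr hb
  exact ⟨h1, p, r, hr.le, rfl, h2⟩

/-- When the background computation is complete, the copy can be used. -/
lemma Frozen.done (h : g.Expanding) (hf : g.Frozen Λ c S E H W 0) :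
    g.Using Λ c (c.T ∪ H) ∅ := by
  obtain ⟨hs, p, r, -, he, hp⟩ := hf
  have hN : 1 ≤ g.N := h.pos.trans h.le
  obtain ⟨h1, rfl⟩ : p * g.N = 0 ∧ r = 0 := by omega
  obtain rfl : p = 0 := by
    rcases Nat.mul_eq_zero.1 h1 with h1 | h1
    · exact h1
    · omega
  cases hp with
  | close => omega
  | finish _ hrd h1 h2 h3 h4 =>
    have hT : c.T = S := by
      ext z
      exact h3 z (Nat.zero_le _)
    have hcnt : ∀ y ∈ g.right, (y ∈ c.F ↔ y ∈ E) ∧ c.cnt y = 0 := by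
      intro y hy
      obtain ⟨x, hx, hxy⟩ := mem_biUnion.1 hy
      exact h4 x (Nat.zero_le _) (mem_range.1 hx) y hxy
    have hF : c.F = E := by
      ext y
      exact ⟨fun hy => (hcnt y (hs.forbidden hy)).1.1 hy,
        fun hy => (hcnt y (hs.forbidden' hy)).1.2 hy⟩
    have hV : c.T ∪ H = H ∪ S := by rw [hT, union_comm]
    rw [hV]
    refine ⟨hT ▸ hF ▸ hrd.closed, ⟨∅, Subset.rfl, fun _ => 0, by simp, by simp, by simp, ?_⟩,
      h1, fun y => ?_⟩
    · intro j
      rw [filter_false_of_mem, card_empty]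
      · exact Nat.zero_le _
      · rintro y hy ⟨-, h5⟩
        rw [(hcnt y hy).2] at h5
        omega
    · split_ifs with hy
      · exact h2 y
      · rw [filter_false_of_mem, card_empty]
        · exact Nat.zero_le _
        -- Outside the new forbidden set nothing is placed, so zero counters are correct: homes were
        -- marked, and a reserved node is placed at one of its neighbours, all of which are marked.
        · rintro z hz rfl
          rcases mem_union.1 hz with hz | hz
          · exact hy (hF ▸ hrd.home z hz)
          · exact hy (hF ▸ hrd.closed.nbrs_subset z hz (h1 z (mem_union_right _ hz)))

/-- A copy is frozen at the beginning of the background computation. -/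
lemma Using.freeze (hs : g.Sized c S E H W) (hu : g.Using Λ c (c.T ∪ H) W) :
    g.Frozen Λ c S E H W (g.N * (g.N + 4)) :=
  ⟨hs, g.N + 3, g.N, le_rfl, by ring, .clear _ hu fun z hz hz' => by omega⟩

/-- Every copy in any state has bounded load. -/
lemma Frozen.load_le (h : g.Expanding) (hΛ : 2 * g.K < 4 ^ Λ) {rem : ℕ}
    (hf : g.Frozen Λ c S E H W rem) (y : ℕ) : (H.filter fun z => c.pl z = y).card ≤ Λ := by
  obtain ⟨hs, p, r, -, he, hp⟩ := hf
  have hTH : c.T ∪ H ⊆ range g.N := union_subset hs.reserved hs.homes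
  have key : g.Using Λ c (c.T ∪ H) W → (H.filter fun z => c.pl z = y).card ≤ Λ := fun hu =>
    (card_le_card (filter_subset_filter _ subset_union_right)).trans
      (hu.places.load_le h hu.closed hu.batch (hs.recent_card.trans (by omega)) hΛ hTH y)
  cases hp with
  | clear _ hu => exact key hu
  | mark _ hu => exact key hu
  | close _ _ _ _ hu => exact key hu
  | place _ hrd hu =>
    have hS := filter_subset (r ≤ ·) S
    have hW : (W ∪ S.filter (r ≤ ·)).card ≤ 2 * g.K := by
      have := card_union_le W (S.filter (r ≤ ·))
      have := card_le_card hS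
      have := hs.recent_card
      have := hrd.card
      omega
    exact (card_le_card (filter_subset_filter _
      (subset_union_right.trans subset_union_left))).trans (hu.places.load_le h hu.closed hu.batch
        hW hΛ (union_subset hTH (hS.trans hs.reserved')) y)
  | finish _ _ _ h2 => exact (card_le_card (filter_subset_filter _ subset_union_left)).trans (h2 y)

/-- A left node can be placed in the virtual pass. -/
lemma Frozen.closed (h : g.Expanding) {q : ℕ} (hf : g.Frozen Λ c S E H W (q + 1))
    (hq : q / g.N = 1) : g.Closed c.T c.F := by
  obtain ⟨hs, p, r, hr, he, hp⟩ := hf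
  have hK := h.pos
  have hKN := h.le
  cases hp with
  | clear _ hu => exact hu.closed
  | mark _ hu => exact hu.closed
  | close _ _ _ _ hu => exact hu.closed
  | place _ hrd hu => exact hu.closed
  | finish =>
    rw [Nat.div_eq_of_lt (by omega)] at hq
    omega

end Net

end DynMatch

/-! ### Homes, rings and their invariant. -/

namespace DynMatch

open Finset

/-- The homes of the left nodes: `hl x` is the kind of the home of `x` plus one (`0` if there is
none), `hy x` its right node. Kinds `0` and `1` are the two copies of the last layer, kind `i + 2` is
level `i` of the first layer. The homes granted last in kind `k` are in `ring k`. The number of homes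
ever granted in kind `k` is `nh k` (`nh 0` counts kinds `0` and `1`), and `arr i` is the number of
nodes that ever reached level `i`. -/
structure Lay where
  hl : ℕ → ℕ
  hy : ℕ → ℕ
  act : Finset ℕ
  inr : Finset ℕ
  occ : ℕ → Finset ℕ
  ring : ℕ → ℕ → ℕ
  nh : ℕ → ℕ
  arr : ℕ → ℕ

namespace Lay

variable (g : Net) (l : ℕ)

/-- The copy of the last layer that is in use. -/
def cur (s : Lay) : ℕ := s.nh 0 / g.K % 2

/-- The next slot of the ring of kind `k`. -/
def ptr (s : Lay) (k : ℕ) : ℕ :=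
  if k < 2 then (if s.cur g = k then s.nh 0 % g.K else 0) else s.nh k % g.K

/-- Release the home of `x` in kind `k`. -/
def release (k x : ℕ) (s : Lay) : Lay :=
  { s with
    hl := Function.update s.hl x 0
    occ := Function.update s.occ k ((s.occ k).erase (s.hy x)) }

/-- The edge of `x` is retracted. -/
def retract (x : ℕ) (s : Lay) : Lay :=
  if x ∈ s.inr then { s with act := s.act.erase x }
  else ({ s with act := s.act.erase x } : Lay).release (s.hl x - 1) x

/-- Clear a slot of a ring. -/
def clearSlot (k p : ℕ) (s : Lay) : Lay :=
  { s with ring := Function.update s.ring k (Function.update (s.ring k) p 0) }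

/-- Evict the node in slot `p` of the ring of kind `k`. -/
def evict (k p : ℕ) (s : Lay) : Lay :=
  if s.ring k p = 0 then s
  else if s.ring k p - 1 ∈ s.act then
    ({ s with inr := s.inr.erase (s.ring k p - 1) } : Lay).clearSlot k p
  else (s.release k (s.ring k p - 1)).clearSlot k p

/-- Put `x` with the home `y` into slot `p` of the ring of kind `k`. -/
def put (k p x y : ℕ) (s : Lay) : Lay :=
  { hl := Function.update s.hl x (k + 1)
    hy := Function.update s.hy x y
    act := insert x s.act
    inr := insert x s.inr
    occ := Function.update s.occ k (insert y (s.occ k))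
    ring := Function.update s.ring k (Function.update (s.ring k) p (x + 1))
    nh := Function.update s.nh (if k < 2 then 0 else k) (s.nh (if k < 2 then 0 else k) + 1)
    arr := fun i => if i ≤ (if k < 2 then l else k - 2) then s.arr i + 1 else s.arr i }

/-- Grant the home `y` in kind `k` to `x`. -/
def place (k x y : ℕ) (s : Lay) : Lay :=
  (s.evict k (s.ptr g k)).put l k (s.ptr g k) x y

/-- The invariant of the homes. -/
structure Ok (s : Lay) : Prop where
  act_hl : ∀ x ∈ s.act, s.hl x ≠ 0
  act_card : s.act.card ≤ g.K
  lt : ∀ x, s.hl x ≠ 0 → x < g.N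
  hl_le : ∀ x, s.hl x ≤ l + 2
  hy_mem : ∀ x, s.hl x ≠ 0 → s.hy x ∈ g.nbrs x
  ring_val : ∀ k p x, p < g.K → s.ring k p = x + 1 → s.hl x = k + 1 ∧ x ∈ s.inr
  ring_inj : ∀ k p p' x, p < g.K → p' < g.K → s.ring k p = x + 1 → s.ring k p' = x + 1 → p = p'
  inr_ring : ∀ k x, s.hl x = k + 1 → x ∈ s.inr → ∃ p < g.K, s.ring k p = x + 1
  out_act : ∀ x, s.hl x ≠ 0 → x ∉ s.inr → x ∈ s.act
  occ_hl : ∀ k y, 2 ≤ k → y ∈ s.occ k → ∃ x, s.hl x = k + 1 ∧ s.hy x = y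
  hl_occ : ∀ k x, 2 ≤ k → s.hl x = k + 1 → s.hy x ∈ s.occ k
  occ_inj : ∀ k x x', 2 ≤ k → s.hl x = k + 1 → s.hl x' = k + 1 → s.hy x = s.hy x' → x = x'

variable {g l}

/-- Covers both ways of losing a home: by retraction, when `x` is in no ring and `r` is the old
ring, and by eviction, when `x` is already inactive and `r` has its slot cleared. -/
lemma Ok.drop {s : Lay} (h : s.Ok g l) {k x : ℕ} (hx : s.hl x = k + 1) {r : ℕ → ℕ → ℕ}
    (hr : ∀ k' p z, p < g.K → (r k' p = z + 1 ↔ s.ring k' p = z + 1 ∧ z ≠ x)) :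
    Ok g l { s with
      hl := Function.update s.hl x 0
      occ := Function.update s.occ k ((s.occ k).erase (s.hy x))
      act := s.act.erase x
      ring := r } := by
  have hu : ∀ z, Function.update s.hl x 0 z ≠ 0 → z ≠ x ∧ Function.update s.hl x 0 z = s.hl z := by
    intro z hz
    have : z ≠ x := by rintro rfl; simp at hz
    exact ⟨this, Function.update_of_ne this _ _⟩
  have hu' : ∀ z m, Function.update s.hl x 0 z = m + 1 → z ≠ x ∧ s.hl z = m + 1 := by
    intro z m hz
    obtain ⟨h1, h2⟩ := hu z (by omega)
    exact ⟨h1, by omega⟩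
  constructor
  · intro z hz
    obtain ⟨h1, h2⟩ := mem_erase.1 hz
    simpa [Function.update_of_ne h1] using h.act_hl z h2
  · exact (card_le_card (erase_subset _ _)).trans h.act_card
  · intro z hz
    obtain ⟨-, h2⟩ := hu z hz
    exact h.lt z (h2 ▸ hz)
  · intro z
    dsimp only
    by_cases e : z = x
    · simp [e]
    · simpa [Function.update_of_ne e] using h.hl_le z
  · intro z hz
    obtain ⟨-, h2⟩ := hu z hz
    exact h.hy_mem z (h2 ▸ hz)
  · intro k' p z hp hz
    obtain ⟨h1, h2⟩ := (hr k' p z hp).1 hz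
    simpa [Function.update_of_ne h2] using h.ring_val k' p z hp h1
  · intro k' p p' z hp hp' hz hz'
    exact h.ring_inj k' p p' z hp hp' ((hr k' p z hp).1 hz).1 ((hr k' p' z hp').1 hz').1
  · intro k' z hz hzr
    obtain ⟨h1, h2⟩ := hu' z k' hz
    obtain ⟨p, hp, h3⟩ := h.inr_ring k' z h2 hzr
    exact ⟨p, hp, (hr k' p z hp).2 ⟨h3, h1⟩⟩
  · intro z hz hzr
    obtain ⟨h1, h2⟩ := hu z hz
    exact mem_erase.2 ⟨h1, h.out_act z (h2 ▸ hz) hzr⟩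
  · intro k' y hk hy
    have : y ∈ s.occ k' ∧ (k' = k → y ≠ s.hy x) := by
      simp only [Function.update_apply] at hy
      split_ifs at hy with e
      · subst e
        exact ⟨(mem_erase.1 hy).2, fun _ => (mem_erase.1 hy).1⟩
      · exact ⟨hy, fun e' => absurd e' e⟩
    obtain ⟨z, hz, rfl⟩ := h.occ_hl k' y hk this.1
    have hzx : z ≠ x := by
      rintro rfl
      exact this.2 (by omega) rfl
    exact ⟨z, by simpa [Function.update_of_ne hzx] using hz, rfl⟩
  · intro k' z hk hz
    obtain ⟨h1, h2⟩ := hu' z k' hz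
    have h3 := h.hl_occ k' z hk h2
    simp only [Function.update_apply]
    split_ifs with e
    · subst e
      exact mem_erase.2 ⟨fun e => h1 (h.occ_inj k' z x hk h2 hx e), h3⟩
    · exact h3
  · intro k' z z' hk hz hz' e
    exact h.occ_inj k' z z' hk (hu' z k' hz).2 (hu' z' k' hz').2 e

lemma Ok.touch {s : Lay} (h : s.Ok g l) {x : ℕ} (hx : s.hl x ≠ 0)
    (hc : (insert x s.act).card ≤ g.K) : Ok g l { s with act := insert x s.act } := by
  refine { h with
    act_hl := fun z hz => ?_
    act_card := hc
    out_act := fun z hz hzr => mem_insert_of_mem (h.out_act z hz hzr) }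
  rcases mem_insert.1 hz with rfl | hz
  · exact hx
  · exact h.act_hl z hz

/-- A node in its ring may have a home without being active, so only a node outside the rings gives
up its home here. -/
lemma Ok.retract {s : Lay} (h : s.Ok g l) {x : ℕ} (hx : x ∈ s.act) : Ok g l (s.retract x) := by
  unfold Lay.retract
  split_ifs with hr
  · exact { h with
      act_hl := fun z hz => h.act_hl z (mem_of_mem_erase hz)
      act_card := (card_le_card (erase_subset _ _)).trans h.act_card
      out_act := fun z hz hzr =>
        mem_erase.2 ⟨fun e => hzr (e ▸ hr), h.out_act z hz hzr⟩ }
  · have := h.act_hl x hx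
    refine h.drop (k := s.hl x - 1) (by omega) fun k' p z hp => ⟨fun hz => ⟨hz, ?_⟩, fun hz => hz.1⟩
    rintro rfl
    exact hr (h.ring_val k' p z hp hz).2

/-- A node occupies only one slot in all rings: `ring_inj` excludes two slots of one ring, and `hl`
determines the kind. So clearing one slot removes exactly `u`. -/
lemma Ok.clear_iff {s : Lay} (h : s.Ok g l) {k p u : ℕ} (hp : p < g.K) (hu : s.ring k p = u + 1)
    (k' p' z : ℕ) (hp' : p' < g.K) :
    Function.update s.ring k (Function.update (s.ring k) p 0) k' p' = z + 1 ↔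
      s.ring k' p' = z + 1 ∧ z ≠ u := by
  by_cases e : k' = k
  · subst e
    rw [Function.update_self]
    by_cases e : p' = p
    · subst e
      rw [Function.update_self, hu]
      omega
    · rw [Function.update_of_ne e]
      exact ⟨fun h2 => ⟨h2, fun e' => e (h.ring_inj k' p' p u hp' hp (e' ▸ h2) hu)⟩,
        fun h2 => h2.1⟩
  · rw [Function.update_of_ne e]
    refine ⟨fun h2 => ⟨h2, ?_⟩, fun h2 => h2.1⟩
    rintro rfl
    have h3 := (h.ring_val k' p' z hp' h2).1
    have h4 := (h.ring_val k p z hp hu).1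
    omega

lemma Ok.evict {s : Lay} (h : s.Ok g l) {k p : ℕ} (hp : p < g.K) : Ok g l (s.evict k p) := by
  unfold Lay.evict
  split_ifs with h0 h1
  · exact h
  · obtain ⟨u, hu⟩ : ∃ u, s.ring k p = u + 1 := ⟨s.ring k p - 1, by omega⟩
    rw [hu, Nat.add_sub_cancel] at h1 ⊢
    have hr := h.clear_iff hp hu
    refine { h with
      ring_val := fun k' p' z hp' hz => ?_
      ring_inj := fun k' p1 p2 z hp1 hp2 hz hz' => ?_
      inr_ring := fun k' z hz hzr => ?_
      out_act := fun z hz hzr => ?_ }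
    · obtain ⟨h2, h3⟩ := (hr k' p' z hp').1 hz
      obtain ⟨h4, h5⟩ := h.ring_val k' p' z hp' h2
      exact ⟨h4, mem_erase.2 ⟨h3, h5⟩⟩
    · exact h.ring_inj k' p1 p2 z hp1 hp2 ((hr k' p1 z hp1).1 hz).1 ((hr k' p2 z hp2).1 hz').1
    · obtain ⟨h2, h3⟩ := mem_erase.1 hzr
      obtain ⟨q, hq, h4⟩ := h.inr_ring k' z hz h3
      exact ⟨q, hq, (hr k' q z hq).2 ⟨h4, h2⟩⟩
    · by_cases e : z = u
      · exact e ▸ h1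
      · exact h.out_act z hz fun hm => hzr (mem_erase.2 ⟨e, hm⟩)
  · obtain ⟨u, hu⟩ : ∃ u, s.ring k p = u + 1 := ⟨s.ring k p - 1, by omega⟩
    rw [hu, Nat.add_sub_cancel] at h1 ⊢
    have hd := h.drop (k := k) (x := u) (h.ring_val k p u hp hu).1
      (r := Function.update s.ring k (Function.update (s.ring k) p 0)) (h.clear_iff hp hu)
    rw [erase_eq_of_notMem h1] at hd
    exact hd

lemma evict_ring_self (s : Lay) (k p : ℕ) : (s.evict k p).ring k p = 0 := by
  unfold evict
  split_ifs with h0 h1 <;> simp [clearSlot, h0]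

end Lay

end DynMatch

/-! ### Granting a home, and the number of homes of a kind. -/

namespace DynMatch

open Finset

namespace Lay

variable {g : Net} {l : ℕ}

lemma Ok.put {s : Lay} (h : s.Ok g l) {k p x y : ℕ} (hp : p < g.K) (hr : s.ring k p = 0)
    (hx : s.hl x = 0) (hxN : x < g.N) (hy : y ∈ g.nbrs x) (hk : k < l + 2)
    (hocc : 2 ≤ k → y ∉ s.occ k) (hc : (insert x s.act).card ≤ g.K) :
    Ok g l (s.put l k p x y) := by
  -- A node without a home is in no ring, so the new slot will be its only one.
  have hxring : ∀ k' p', p' < g.K → s.ring k' p' ≠ x + 1 := fun k' p' hp' e => by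
    have := (h.ring_val k' p' x hp' e).1
    omega
  have hring : ∀ k' p' z, p' < g.K → ((s.put l k p x y).ring k' p' = z + 1 ↔
      s.ring k' p' = z + 1 ∨ (k' = k ∧ p' = p ∧ z = x)) := by
    intro k' p' z hp'
    simp only [Lay.put]
    by_cases e : k' = k
    · subst e
      rw [Function.update_self]
      by_cases e : p' = p
      · subst e
        rw [Function.update_self, hr]
        constructor
        · intro h1
          exact Or.inr ⟨rfl, rfl, by omega⟩
        · rintro (h1 | ⟨-, -, h1⟩) <;> omega
      · rw [Function.update_of_ne e]
        simp [e]
    · rw [Function.update_of_ne e]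
      simp [e]
  have hhl : ∀ z, z ≠ x → (s.put l k p x y).hl z = s.hl z :=
    fun z hz => Function.update_of_ne hz _ _
  have hhx : (s.put l k p x y).hl x = k + 1 := Function.update_self _ _ _
  have hhy : ∀ z, z ≠ x → (s.put l k p x y).hy z = s.hy z :=
    fun z hz => Function.update_of_ne hz _ _
  have hhyx : (s.put l k p x y).hy x = y := Function.update_self _ _ _
  have hocc' : ∀ k' y', y' ∈ (s.put l k p x y).occ k' ↔ y' ∈ s.occ k' ∨ (k' = k ∧ y' = y) := by
    intro k' y'
    simp only [Lay.put, Function.update_apply]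
    split_ifs with e
    · subst e
      simp [or_comm]
    · simp [e]
  constructor
  · intro z hz
    by_cases e : z = x
    · rw [e, hhx]
      omega
    · rw [hhl z e]
      exact h.act_hl z ((mem_insert.1 hz).resolve_left e)
  · exact hc
  · intro z hz
    by_cases e : z = x
    · exact e ▸ hxN
    · exact h.lt z (hhl z e ▸ hz)
  · intro z
    by_cases e : z = x
    · rw [e, hhx]
      omega
    · rw [hhl z e]
      exact h.hl_le z
  · intro z hz
    by_cases e : z = x
    · rw [e, hhyx]
      exact hy
    · rw [hhy z e]
      exact h.hy_mem z (hhl z e ▸ hz)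
  · intro k' p' z hp' hz
    rcases (hring k' p' z hp').1 hz with h1 | ⟨rfl, rfl, rfl⟩
    · have e : z ≠ x := fun e => hxring k' p' hp' (e ▸ h1)
      obtain ⟨h2, h3⟩ := h.ring_val k' p' z hp' h1
      exact ⟨hhl z e ▸ h2, mem_insert_of_mem h3⟩
    · exact ⟨hhx, mem_insert_self _ _⟩
  · intro k' p1 p2 z hp1 hp2 hz hz'
    rcases (hring k' p1 z hp1).1 hz with h1 | ⟨h1, rfl, rfl⟩ <;>
      rcases (hring k' p2 z hp2).1 hz' with h2 | ⟨h2, rfl, h3⟩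
    · exact h.ring_inj k' p1 p2 z hp1 hp2 h1 h2
    · exact absurd (h3 ▸ h1) (hxring k' p1 hp1)
    · exact absurd h2 (hxring k' p2 hp2)
    · rfl
  · intro k' z hz hzr
    by_cases e : z = x
    · subst e
      rw [hhx] at hz
      exact ⟨p, hp, (hring k' p z hp).2 (Or.inr ⟨by omega, rfl, rfl⟩)⟩
    · rw [hhl z e] at hz
      obtain ⟨q, hq, h1⟩ := h.inr_ring k' z hz ((mem_insert.1 hzr).resolve_left e)
      exact ⟨q, hq, (hring k' q z hq).2 (Or.inl h1)⟩
  · intro z hz hzr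
    by_cases e : z = x
    · exact e ▸ mem_insert_self _ _
    · exact mem_insert_of_mem
        (h.out_act z (hhl z e ▸ hz) fun hm => hzr (mem_insert_of_mem hm))
  · intro k' y' hk' hy'
    rcases (hocc' k' y').1 hy' with h1 | ⟨rfl, rfl⟩
    · obtain ⟨z, hz, rfl⟩ := h.occ_hl k' y' hk' h1
      have e : z ≠ x := by rintro rfl; omega
      exact ⟨z, hhl z e ▸ hz, hhy z e⟩
    · exact ⟨x, hhx, hhyx⟩
  · intro k' z hk' hz
    by_cases e : z = x
    · subst e
      rw [hhx] at hz
      exact (hocc' _ _).2 (Or.inr ⟨by omega, hhyx⟩)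
    · rw [hhl z e] at hz
      rw [hhy z e]
      exact (hocc' _ _).2 (Or.inl (h.hl_occ k' z hk' hz))
  · have key : ∀ z, 2 ≤ k → z ≠ x → s.hl z = k + 1 → s.hy z ≠ y := fun z hk' e hz e' =>
      hocc hk' (e' ▸ h.hl_occ k z hk' hz)
    intro k' z z' hk' hz hz' e
    by_cases e1 : z = x <;> by_cases e2 : z' = x
    · rw [e1, e2]
    · subst e1
      rw [hhx] at hz
      rw [hhl z' e2] at hz'
      rw [hhyx, hhy z' e2] at e
      obtain rfl : k = k' := by omega
      exact absurd e.symm (key z' hk' e2 hz')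
    · subst e2
      rw [hhx] at hz'
      rw [hhl z e1] at hz
      rw [hhyx, hhy z e1] at e
      obtain rfl : k = k' := by omega
      exact absurd e (key z hk' e1 hz)
    · rw [hhl z e1] at hz
      rw [hhl z' e2] at hz'
      rw [hhy z e1, hhy z' e2] at e
      exact h.occ_inj k' z z' hk' hz hz' e

lemma evict_act (s : Lay) (k p : ℕ) : (s.evict k p).act = s.act := by
  unfold evict
  split_ifs <;> rfl

lemma evict_hy (s : Lay) (k p : ℕ) : (s.evict k p).hy = s.hy := by
  unfold evict
  split_ifs <;> rfl

lemma evict_nh (s : Lay) (k p : ℕ) : (s.evict k p).nh = s.nh := by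
  unfold evict
  split_ifs <;> rfl

lemma evict_arr (s : Lay) (k p : ℕ) : (s.evict k p).arr = s.arr := by
  unfold evict
  split_ifs <;> rfl

lemma evict_hl (s : Lay) (k p z : ℕ) : (s.evict k p).hl z = s.hl z ∨
    ((s.evict k p).hl z = 0 ∧ s.ring k p = z + 1) := by
  unfold evict
  split_ifs with h0 h1
  · exact Or.inl rfl
  · exact Or.inl rfl
  · simp only [clearSlot, release, Function.update_apply]
    split_ifs with e
    · exact Or.inr ⟨rfl, by omega⟩
    · exact Or.inl rfl

lemma evict_occ_subset (s : Lay) (k p k' : ℕ) : (s.evict k p).occ k' ⊆ s.occ k' := by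
  unfold evict
  split_ifs with h0 h1
  · exact Subset.rfl
  · exact Subset.rfl
  · simp only [clearSlot, release, Function.update_apply]
    split_ifs with e
    · subst e
      exact erase_subset _ _
    · exact Subset.rfl

lemma evict_ring_of_ne (s : Lay) {k p k' p' : ℕ} (h : ¬(k' = k ∧ p' = p)) :
    (s.evict k p).ring k' p' = s.ring k' p' := by
  have : Function.update s.ring k (Function.update (s.ring k) p 0) k' p' = s.ring k' p' := by
    simp only [Function.update_apply]
    split_ifs with e
    · subst e
      rw [Function.update_of_ne fun e => h ⟨rfl, e⟩]
    · rfl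
  unfold evict
  split_ifs with h0 h1
  · rfl
  · exact this
  · exact this

lemma put_ring_of_ne (s : Lay) {k p k' p' x y : ℕ} (h : ¬(k' = k ∧ p' = p)) :
    (s.put l k p x y).ring k' p' = s.ring k' p' := by
  simp only [put, Function.update_apply]
  split_ifs with e
  · subst e
    rw [Function.update_of_ne fun e => h ⟨rfl, e⟩]
  · rfl

lemma put_ring_self (s : Lay) (k p x y : ℕ) : (s.put l k p x y).ring k p = x + 1 := by
  simp [put]

lemma ptr_lt (hK : 1 ≤ g.K) (s : Lay) (k : ℕ) : s.ptr g k < g.K := by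
  unfold ptr
  split_ifs
  · exact Nat.mod_lt _ hK
  · exact hK
  · exact Nat.mod_lt _ hK

/-- `x`, which has no home, can get the home `y` in kind `k`. -/
structure Arrive (g : Net) (l : ℕ) (s : Lay) (k x y : ℕ) : Prop where
  hl : s.hl x = 0
  lt : x < g.N
  mem : y ∈ g.nbrs x
  kind : k < l + 2
  cur : k < 2 → s.cur g = k
  free : 2 ≤ k → y ∉ s.occ k
  full : ∀ i < l, (2 ≤ k → i + 2 < k) → g.nbrs x ⊆ s.occ (i + 2)
  card : (insert x s.act).card ≤ g.K

/-- The changes of the homes in one operation. -/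
inductive Step (g : Net) (l : ℕ) (s : Lay) : Lay → Prop
  | touch (x : ℕ) : s.hl x ≠ 0 → (insert x s.act).card ≤ g.K →
      Step g l s { s with act := insert x s.act }
  | retract (x : ℕ) : x ∈ s.act → Step g l s (s.retract x)
  | place (k x y : ℕ) : s.Arrive g l k x y → Step g l s (s.place g l k x y)

lemma Arrive.hl_evict {s : Lay} {k x y : ℕ} (ha : s.Arrive g l k x y) (k' p : ℕ) :
    (s.evict k' p).hl x = 0 := by
  rcases s.evict_hl k' p x with h | h
  · rw [h, ha.hl]
  · exact h.1

lemma Ok.place {s : Lay} (h : s.Ok g l) (hK : 1 ≤ g.K) {k x y : ℕ} (ha : s.Arrive g l k x y) :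
    Ok g l (s.place g l k x y) := by
  have hp := s.ptr_lt hK k
  refine (h.evict hp).put hp (s.evict_ring_self _ _) (ha.hl_evict _ _) ha.lt ha.mem ha.kind
    (fun hk hm => ha.free hk (s.evict_occ_subset _ _ _ hm)) ?_
  rw [evict_act]
  exact ha.card

lemma Ok.step {s s' : Lay} (h : s.Ok g l) (hK : 1 ≤ g.K) (hs : s.Step g l s') : s'.Ok g l := by
  cases hs with
  | touch x hx hc => exact h.touch hx hc
  | retract x hx => exact h.retract hx
  | place k x y ha => exact h.place hK ha

lemma Ok.steps {s s' : Lay} (h : s.Ok g l) (hK : 1 ≤ g.K)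
    (hs : Relation.ReflTransGen (Step g l) s s') : s'.Ok g l := by
  induction hs with
  | refl => exact h
  | tail _ hs ih => exact ih.step hK hs

/-- The left nodes with a home in kind `k`. -/
def homes (g : Net) (s : Lay) (k : ℕ) : Finset ℕ := (range g.N).filter fun x => s.hl x = k + 1

/-- The left nodes in the first `n` slots of the ring of kind `k`. -/
def recent (s : Lay) (k n : ℕ) : Finset ℕ :=
  ((range n).filter fun p => s.ring k p ≠ 0).image fun p => s.ring k p - 1

lemma mem_homes {s : Lay} (h : s.Ok g l) {k x : ℕ} : x ∈ s.homes g k ↔ s.hl x = k + 1 := by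
  unfold homes
  rw [mem_filter, mem_range]
  exact ⟨fun hx => hx.2, fun hx => ⟨h.lt x (by omega), hx⟩⟩

lemma mem_recent {s : Lay} {k n x : ℕ} : x ∈ s.recent k n ↔ ∃ p < n, s.ring k p = x + 1 := by
  unfold recent
  simp only [mem_image, mem_filter, mem_range]
  constructor
  · rintro ⟨p, ⟨h1, h2⟩, h3⟩
    exact ⟨p, h1, by omega⟩
  · rintro ⟨p, h1, h2⟩
    exact ⟨p, ⟨h1, by omega⟩, by omega⟩

lemma card_recent_le (s : Lay) (k n : ℕ) : (s.recent k n).card ≤ n := by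
  refine card_image_le.trans ((card_filter_le _ _).trans ?_)
  rw [card_range]

lemma Ok.recent_subset {s : Lay} (h : s.Ok g l) (k : ℕ) : s.recent k g.K ⊆ s.homes g k := by
  intro x hx
  obtain ⟨p, hp, he⟩ := mem_recent.1 hx
  exact (mem_homes h).2 (h.ring_val k p x hp he).1

/-- The ring is removed from the active nodes on the right because the strict bound `< 2K` at an
exchange of copies comes from a node that is both active and in the ring. -/
lemma Ok.homes_subset {s : Lay} (h : s.Ok g l) (k : ℕ) :
    s.homes g k ⊆ s.recent k g.K ∪ (s.act \ s.recent k g.K) := by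
  intro x hx
  have hl := (mem_homes h).1 hx
  rw [union_sdiff_self_eq_union]
  by_cases hr : x ∈ s.inr
  · exact mem_union_left _ (mem_recent.2 (h.inr_ring k x hl hr))
  · exact mem_union_right _ (h.out_act x (by omega) hr)

lemma Ok.card_homes {s : Lay} (h : s.Ok g l) (k : ℕ) : (s.homes g k).card ≤ 2 * g.K := by
  have h1 := card_le_card (h.homes_subset k)
  have h2 := card_union_le (s.recent k g.K) (s.act \ s.recent k g.K)
  have h3 := s.card_recent_le k g.K
  have h4 := card_le_card (sdiff_subset : s.act \ s.recent k g.K ⊆ s.act)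
  have h5 := h.act_card
  omega

lemma Ok.card_occ {s : Lay} (h : s.Ok g l) {k : ℕ} (hk : 2 ≤ k) : (s.occ k).card ≤ 2 * g.K := by
  have : s.occ k ⊆ (s.homes g k).image s.hy := by
    intro y hy
    obtain ⟨x, hx, rfl⟩ := h.occ_hl k y hk hy
    exact mem_image_of_mem _ ((mem_homes h).2 hx)
  exact (card_le_card this).trans (card_image_le.trans (h.card_homes k))

end Lay

end DynMatch

/-! ### At most half of the nodes that reach a level pass it. -/

namespace DynMatch

open Finset

namespace Lay

variable {g : Net} {l : ℕ}

/-- In the interval from `s₀` to `s`, the nodes of `P` passed level `i`, and the right nodes that were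
ever occupied at level `i` are in `Y`. -/
structure Window (g : Net) (l i : ℕ) (s₀ s : Lay) (P Y : Finset ℕ) : Prop where
  card_P : P.card + s₀.arr (i + 1) = s.arr (i + 1)
  card_P_le : P.card + s₀.arr i ≤ s.arr i
  card_Y : Y.card + s₀.arr i ≤ 2 * g.K + s.arr i
  occ : s.occ (i + 2) ⊆ Y
  lt : ∀ x ∈ P, x < g.N
  nbrs : ∀ x ∈ P, g.nbrs x ⊆ Y
  nh_mono : ∀ t, s₀.nh t ≤ s.nh t
  nh_le : ∀ t, (t = 0 ∨ i + 2 < t) → s.nh t + s₀.arr i ≤ s₀.nh t + s.arr i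
  slot : ∀ x ∈ P, ∃ t b, ((t = 0 ∧ s.ring (b / g.K % 2) (b % g.K) = x + 1) ∨
    (i + 2 < t ∧ s.ring t (b % g.K) = x + 1)) ∧ s₀.nh t ≤ b ∧ b < s.nh t

lemma window_refl {s : Lay} (h : s.Ok g l) (i : ℕ) : Window g l i s s ∅ (s.occ (i + 2)) where
  card_P := by simp
  card_P_le := by simp
  card_Y := by
    have := h.card_occ (k := i + 2) (by omega)
    omega
  occ := Subset.rfl
  lt := by simp
  nbrs := by simp
  nh_mono := fun _ => le_rfl
  nh_le := fun _ _ => le_rfl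
  slot := by simp

/-- A slot of a ring is reused only after `K` further homes of that kind. -/
lemma eq_of_mod_eq {K b n : ℕ} (h : b % K = n % K) (h1 : b ≤ n) (h2 : n < b + K) : b = n := by
  have h3 : K ∣ n - b := (Nat.modEq_iff_dvd' h1).1 h
  have := Nat.eq_zero_of_dvd_of_lt h3 (by omega)
  omega

lemma Window.of_eq {i : ℕ} {s₀ s s' : Lay} {P Y : Finset ℕ} (h : Window g l i s₀ s P Y)
    (hocc : s'.occ (i + 2) ⊆ s.occ (i + 2)) (hring : s'.ring = s.ring) (hnh : s'.nh = s.nh)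
    (harr : s'.arr = s.arr) : Window g l i s₀ s' P Y where
  card_P := harr ▸ h.card_P
  card_P_le := harr ▸ h.card_P_le
  card_Y := harr ▸ h.card_Y
  occ := hocc.trans h.occ
  lt := h.lt
  nbrs := h.nbrs
  nh_mono := hnh ▸ h.nh_mono
  nh_le := harr ▸ hnh ▸ h.nh_le
  slot := hring ▸ hnh ▸ h.slot

lemma release_occ_subset (k x k' : ℕ) (s : Lay) : (s.release k x).occ k' ⊆ s.occ k' := by
  simp only [release, Function.update_apply]
  split_ifs with e
  · subst e
    exact erase_subset _ _
  · exact Subset.rfl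

lemma retract_occ_subset (x k' : ℕ) (s : Lay) : (s.retract x).occ k' ⊆ s.occ k' := by
  unfold retract
  split_ifs
  · exact Subset.rfl
  · exact release_occ_subset _ _ _ _

lemma retract_ring (x : ℕ) (s : Lay) : (s.retract x).ring = s.ring := by
  unfold retract
  split_ifs <;> rfl

lemma retract_nh (x : ℕ) (s : Lay) : (s.retract x).nh = s.nh := by
  unfold retract
  split_ifs <;> rfl

lemma retract_arr (x : ℕ) (s : Lay) : (s.retract x).arr = s.arr := by
  unfold retract
  split_ifs <;> rfl

lemma place_arr (k x y i : ℕ) (s : Lay) : (s.place g l k x y).arr i =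
    if i ≤ (if k < 2 then l else k - 2) then s.arr i + 1 else s.arr i := by
  simp only [place, put, evict_arr]

lemma place_nh (k x y t : ℕ) (s : Lay) : (s.place g l k x y).nh t =
    if t = (if k < 2 then 0 else k) then s.nh t + 1 else s.nh t := by
  simp only [place, put, evict_nh, Function.update_apply]
  split_ifs <;> simp_all

lemma place_ring_of_ne (s : Lay) {k k' p' x y : ℕ} (h : ¬(k' = k ∧ p' = s.ptr g k)) :
    (s.place g l k x y).ring k' p' = s.ring k' p' := by
  rw [place, put_ring_of_ne _ h, evict_ring_of_ne _ h]

lemma place_occ_subset (k x y k' : ℕ) (s : Lay) :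
    (s.place g l k x y).occ k' ⊆ if k' = k then insert y (s.occ k') else s.occ k' := by
  simp only [place, put, Function.update_apply]
  split_ifs with e
  · subst e
    exact insert_subset_insert _ (evict_occ_subset _ _ _ _)
  · exact evict_occ_subset _ _ _ _

lemma Step.arr_le {s s' : Lay} (hs : s.Step g l s') (i : ℕ) :
    s.arr i ≤ s'.arr i ∧ s'.arr i ≤ s.arr i + 1 := by
  cases hs with
  | touch => exact ⟨le_rfl, Nat.le_succ _⟩
  | retract x => rw [retract_arr]; exact ⟨le_rfl, Nat.le_succ _⟩
  | place k x y => rw [place_arr]; split_ifs <;> omega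

/-- A grant beyond level `i` adds `x` to `P` and leaves `Y` alone; a grant at level `i` adds one
right node to `Y` and is paid for by one arrival; a grant at an earlier level concerns neither. -/
lemma Window.step (hK : 1 ≤ g.K) {i : ℕ} (hi : i < l) {s₀ s s' : Lay} {P Y : Finset ℕ}
    (ok : s.Ok g l) (h : Window g l i s₀ s P Y) (hs : s.Step g l s')
    (hle : s'.arr i ≤ s₀.arr i + g.K) : ∃ P' Y', Window g l i s₀ s' P' Y' := by
  cases hs with
  | touch x => exact ⟨P, Y, h.of_eq Subset.rfl rfl rfl rfl⟩
  | retract x =>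
    exact ⟨P, Y, h.of_eq (retract_occ_subset _ _ _) (retract_ring _ _) (retract_nh _ _)
      (retract_arr _ _)⟩
  | place k x y ha =>
    rw [place_arr] at hle
    -- The nodes of `P` are still in rings and hence have homes, whereas `x` has none. So no node
    -- passes twice in a window and `P` counts the passages exactly.
    have hxP : x ∉ P := by
      intro hx
      obtain ⟨t, b, h1, -⟩ := h.slot x hx
      have h2 := ha.hl
      rcases h1 with ⟨-, h1⟩ | ⟨-, h1⟩ <;>
      · have := (ok.ring_val _ _ x (Nat.mod_lt _ hK) h1).1
        omega
    -- the slots of the nodes in `P` are not overwritten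
    have hslot : i ≤ (if k < 2 then l else k - 2) → ∀ z ∈ P, ∃ t b,
        ((t = 0 ∧ (s.place g l k x y).ring (b / g.K % 2) (b % g.K) = z + 1) ∨
        (i + 2 < t ∧ (s.place g l k x y).ring t (b % g.K) = z + 1)) ∧ s₀.nh t ≤ b ∧
        b < (s.place g l k x y).nh t := by
      intro hik z hz
      rw [if_pos hik] at hle
      obtain ⟨t, b, h1, h2, h3⟩ := h.slot z hz
      refine ⟨t, b, ?_, h2, ?_⟩
      · have key : ∀ k', (t = 0 ∧ k' = b / g.K % 2 ∨ i + 2 < t ∧ k' = t) →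
            ¬(k' = k ∧ b % g.K = s.ptr g k) := by
          rintro k' h4 ⟨rfl, h5⟩
          have h6 : b % g.K = s.nh t % g.K ∧ (t = 0 ∨ i + 2 < t) := by
            rcases h4 with ⟨rfl, h4⟩ | ⟨h4, rfl⟩
            · have : k' < 2 := by omega
              rw [ptr, if_pos this, if_pos (ha.cur this)] at h5
              exact ⟨h5, Or.inl rfl⟩
            · rw [ptr, if_neg (by omega)] at h5
              exact ⟨h5, Or.inr h4⟩
          -- Every grant in this ring passed level `i`, so fewer than `K` were made in the window
          -- before this one; the slot cannot have come around.
          have h7 := h.nh_le t h6.2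
          have := eq_of_mod_eq h6.1 h3.le (by omega)
          omega
        rcases h1 with ⟨rfl, h1⟩ | ⟨h0, h1⟩
        · exact Or.inl ⟨rfl, by rw [place_ring_of_ne _ (key _ (Or.inl ⟨rfl, rfl⟩)), h1]⟩
        · exact Or.inr ⟨h0, by rw [place_ring_of_ne _ (key _ (Or.inr ⟨h0, rfl⟩)), h1]⟩
      · rw [place_nh]
        split_ifs <;> omega
    have hmono : ∀ t, s₀.nh t ≤ (s.place g l k x y).nh t := by
      intro t
      rw [place_nh]
      have := h.nh_mono t
      split_ifs <;> omega
    by_cases hk1 : k < 2 ∨ i + 2 < k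
    · -- `x` passes level `i`
      have hlvl : i + 1 ≤ (if k < 2 then l else k - 2) := by split_ifs <;> omega
      -- Passing level `i` means that all neighbours of `x` are occupied there now, hence lie in
      -- `Y`.
      have hfull := ha.full i hi fun _ => by omega
      refine ⟨insert x P, Y, ?_, ?_, ?_, ?_, ?_, ?_, hmono, ?_, ?_⟩
      · rw [card_insert_of_notMem hxP, place_arr, if_pos hlvl]
        have := h.card_P
        omega
      · rw [card_insert_of_notMem hxP, place_arr, if_pos (by omega)]
        have := h.card_P_le
        omega
      · rw [place_arr, if_pos (by omega)]
        have := h.card_Y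
        omega
      · refine (place_occ_subset _ _ _ _ _).trans ?_
        rw [if_neg (by omega)]
        exact h.occ
      · intro z hz
        rcases mem_insert.1 hz with rfl | hz
        · exact ha.lt
        · exact h.lt z hz
      · intro z hz
        rcases mem_insert.1 hz with rfl | hz
        · exact hfull.trans h.occ
        · exact h.nbrs z hz
      · intro t ht
        have e : (s.place g l k x y).arr i = s.arr i + 1 := by rw [place_arr, if_pos (by omega)]
        rw [place_nh, e]
        have := h.nh_le t ht
        split_ifs <;> omega
      · intro z hz
        rcases mem_insert.1 hz with rfl | hz
        · have hs : (s.place g l k z y).ring k (s.ptr g k) = z + 1 := put_ring_self _ _ _ _ _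
          by_cases hk : k < 2
          · refine ⟨0, s.nh 0, Or.inl ⟨rfl, ?_⟩, ?_, ?_⟩
            · have e : s.nh 0 / g.K % 2 = k := ha.cur hk
              rw [ptr, if_pos hk, if_pos (ha.cur hk)] at hs
              rw [e, hs]
            · exact h.nh_mono _
            · rw [place_nh, if_pos hk, if_pos rfl]
              omega
          · refine ⟨k, s.nh k, Or.inr ⟨by omega, ?_⟩, ?_, ?_⟩
            · rw [ptr, if_neg hk] at hs
              exact hs
            · exact h.nh_mono _
            · rw [place_nh, if_neg hk, if_pos rfl]
              omega
        · exact hslot (by omega) z hz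
    · by_cases hk2 : k = i + 2
      · have hlvl : (if k < 2 then l else k - 2) = i := by split_ifs <;> omega
        rw [hlvl] at hle
        refine ⟨P, insert y Y, ?_, ?_, ?_, ?_, h.lt, ?_, hmono, ?_, hslot (by omega)⟩
        · rw [place_arr, hlvl, if_neg (by omega)]
          exact h.card_P
        · rw [place_arr, hlvl, if_pos le_rfl]
          have := h.card_P_le
          omega
        · rw [place_arr, hlvl, if_pos le_rfl]
          have := h.card_Y
          have := card_insert_le y Y
          omega
        · refine (place_occ_subset _ _ _ _ _).trans ?_
          rw [if_pos hk2.symm]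
          exact insert_subset_insert _ h.occ
        · exact fun z hz => (h.nbrs z hz).trans (subset_insert _ _)
        · intro t ht
          rw [place_nh, place_arr, hlvl, if_pos le_rfl]
          have := h.nh_le t ht
          split_ifs <;> omega
      · have hlvl : (if k < 2 then l else k - 2) < i := by split_ifs <;> omega
        refine ⟨P, Y, ?_, ?_, ?_, ?_, h.lt, h.nbrs, hmono, ?_, ?_⟩
        · rw [place_arr, if_neg (by omega)]
          exact h.card_P
        · rw [place_arr, if_neg (by omega)]
          exact h.card_P_le
        · rw [place_arr, if_neg (by omega)]
          exact h.card_Y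
        · refine (place_occ_subset _ _ _ _ _).trans ?_
          rw [if_neg (Ne.symm hk2)]
          exact h.occ
        · intro t ht
          have e : (s.place g l k x y).arr i = s.arr i := by rw [place_arr, if_neg (by omega)]
          rw [place_nh, e, if_neg (by split_ifs <;> omega)]
          exact h.nh_le t ht
        · intro z hz
          obtain ⟨t, b, h1, h2, h3⟩ := h.slot z hz
          refine ⟨t, b, ?_, h2, ?_⟩
          · refine h1.imp (fun h1 => ⟨h1.1, ?_⟩) fun h1 => ⟨h1.1, ?_⟩
            · rw [place_ring_of_ne _ (by omega), h1.2]
            · rw [place_ring_of_ne _ (by omega), h1.2]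
          · rw [place_nh]
            split_ifs <;> omega

open Relation in
lemma window_of_steps (hK : 1 ≤ g.K) {i : ℕ} (hi : i < l) {s₀ s : Lay} (ok : s₀.Ok g l)
    (hs : ReflTransGen (Step g l) s₀ s) (hle : s.arr i ≤ s₀.arr i + g.K) :
    ∃ P Y, Window g l i s₀ s P Y := by
  induction hs with
  | refl => exact ⟨_, _, window_refl ok i⟩
  | tail hs h1 ih =>
    obtain ⟨P, Y, h⟩ := ih ((h1.arr_le i).1.trans hle)
    exact h.step hK hi (ok.steps hK hs) h1 hle

open Relation in
/-- Of `K` nodes that reach a level in a row, at most half pass it. -/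
lemma arr_succ_le (h : g.Expanding) {i : ℕ} (hi : i < l) {s₀ s : Lay} (ok : s₀.Ok g l)
    (hs : ReflTransGen (Step g l) s₀ s) (hle : s.arr i ≤ s₀.arr i + g.K) :
    2 * s.arr (i + 1) ≤ 2 * s₀.arr (i + 1) + g.K := by
  obtain ⟨P, Y, hw⟩ := window_of_steps h.pos hi ok hs hle
  have h1 := h.expand P (fun x hx => mem_range.2 (hw.lt x hx)) (by have := hw.card_P_le; omega)
  have h2 : (g.nbrsOf P).card ≤ Y.card := card_le_card (biUnion_subset.2 hw.nbrs)
  have h3 := hw.card_Y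
  have h4 := hw.card_P
  -- With `D ≥ 6` the expansion reads `18 * P.card ≤ 3 * Y.card ≤ 9K`: there are at most `2K`
  -- occupied right nodes at the start and at most `K` arrivals.
  have h5 : 12 * P.card ≤ 2 * g.D * P.card := Nat.mul_le_mul_right _ (by have := h.six_le; omega)
  rw [add_mul] at h1
  omega

open Relation in
-- An operation raises `arr i` by at most one, so a history can be cut exactly after `B` arrivals.
lemma exists_split {i : ℕ} (B : ℕ) {s₀ s : Lay} (hs : ReflTransGen (Step g l) s₀ s) :
    ∃ m, ReflTransGen (Step g l) s₀ m ∧ ReflTransGen (Step g l) m s ∧ m.arr i ≤ s₀.arr i + B ∧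
      (m = s ∨ m.arr i = s₀.arr i + B) := by
  induction hs with
  | refl => exact ⟨s₀, .refl, .refl, by omega, Or.inl rfl⟩
  | tail hs h1 ih =>
    rename_i a b
    obtain ⟨m, h2, h3, h4, h5⟩ := ih
    rcases h5 with rfl | h5
    · have := h1.arr_le i
      by_cases h6 : m.arr i = s₀.arr i + B
      · exact ⟨m, h2, h3.tail h1, h4, Or.inr h6⟩
      · exact ⟨b, h2.tail h1, .refl, by omega, Or.inl rfl⟩
    · exact ⟨m, h2, h3.tail h1, h4, Or.inr h5⟩

open Relation in
-- Cut the history into `n` windows of `K` arrivals and add up `arr_succ_le`.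
lemma arr_succ_le_mul (h : g.Expanding) {i : ℕ} (hi : i < l) (n : ℕ) {s₀ s : Lay}
    (ok : s₀.Ok g l) (hs : ReflTransGen (Step g l) s₀ s) (hle : s.arr i ≤ s₀.arr i + n * g.K)
    (hn : 1 ≤ n) : 2 * s.arr (i + 1) ≤ 2 * s₀.arr (i + 1) + n * g.K := by
  induction n, hn using Nat.le_induction generalizing s₀ with
  | base =>
    rw [one_mul] at hle ⊢
    exact arr_succ_le h hi ok hs hle
  | succ n hn ih =>
    rw [add_mul, one_mul] at hle ⊢
    obtain ⟨m, h2, h3, h4, h5⟩ := exists_split (i := i) g.K hs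
    have h6 := arr_succ_le h hi ok h2 h4
    have h7 := ih (ok.steps h.pos h2) h3 (by
      rcases h5 with rfl | h5
      · exact Nat.le_add_right _ _
      · omega)
    omega

open Relation in
-- Each level halves the bound on the arrivals, from `2 ^ j * K` down to `K` after `j` levels.
lemma arr_add_le (h : g.Expanding) {s₀ s : Lay} (ok : s₀.Ok g l)
    (hs : ReflTransGen (Step g l) s₀ s) (j i : ℕ) (hij : i + j ≤ l)
    (hle : s.arr i ≤ s₀.arr i + 2 ^ j * g.K) : s.arr (i + j) ≤ s₀.arr (i + j) + g.K := by
  induction j generalizing i with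
  | zero => simpa using hle
  | succ j ih =>
    have h1 := arr_succ_le_mul h (by omega) (2 ^ (j + 1)) ok hs hle Nat.one_le_two_pow
    rw [pow_succ', mul_assoc] at h1
    have h2 := ih (i + 1) (by omega) (by omega)
    rwa [show i + 1 + j = i + (j + 1) by omega] at h2

open Relation in
/-- Between two changes of the copy in use there are many requests. -/
lemma lt_arr (h : g.Expanding) {s₀ s : Lay} (ok : s₀.Ok g l)
    (hs : ReflTransGen (Step g l) s₀ s) (hl : 1 ≤ l) (hle : s₀.arr l + g.K ≤ s.arr l) :
    s₀.arr 0 + 2 ^ (l - 1) < s.arr 0 := by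
  by_contra! hlt
  have hK := h.pos
  have h0 : 2 ^ (l - 1) * 1 ≤ 2 ^ (l - 1) * g.K := Nat.mul_le_mul_left _ hK
  -- At most `K` nodes reach level `l - 1`. One more halving leaves at most `K / 2` for the last
  -- layer, contradicting the `K` assumed there.
  have h1 := arr_add_le h ok hs (l - 1) 0 (by omega) (by omega)
  rw [zero_add] at h1
  have h2 := arr_succ_le h (by omega) ok hs h1
  rw [show l - 1 + 1 = l by omega] at h2
  omega

end Lay

end DynMatch

/-! ### The whole state, its invariant, and the effect of retractions and renewal steps. -/

namespace DynMatch

open Finset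

lemma succ_mod {K : ℕ} (hK : 1 ≤ K) (n : ℕ) :
    (n + 1) % K = if n % K + 1 = K then 0 else n % K + 1 := by
  rw [Nat.add_mod_eq_ite]
  have := Nat.mod_lt n hK
  rcases Nat.lt_or_ge 1 K with h | h
  · rw [Nat.mod_eq_of_lt h]
    split_ifs <;> omega
  · obtain rfl : K = 1 := by omega
    simp [Nat.mod_one]

lemma succ_div {K : ℕ} (hK : 1 ≤ K) (n : ℕ) :
    (n + 1) / K = if n % K + 1 = K then n / K + 1 else n / K := by
  have h1 := Nat.div_add_mod n K
  have h2 := Nat.div_add_mod (n + 1) K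
  rw [succ_mod hK] at h2
  split_ifs at h2 ⊢ with h
  · have : K * ((n + 1) / K) = K * (n / K + 1) := by rw [mul_add, mul_one]; omega
    exact Nat.eq_of_mul_eq_mul_left hK this
  · have : K * ((n + 1) / K) = K * (n / K) := by omega
    exact Nat.eq_of_mul_eq_mul_left hK this

/-- The state of the data structure: the homes, the two copies of the last layer, the sets under
construction for the copy that is not in use, and the number of remaining steps of this
construction. -/
structure St where
  lay : Lay
  cp : ℕ → Net.Copy
  S : Finset ℕ
  E : Finset ℕ
  rem : ℕ

namespace Lay

variable {g : Net} {l : ℕ}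

lemma cur_lt (s : Lay) : s.cur g < 2 := Nat.mod_lt _ (by omega)

lemma place_cur (hK : 1 ≤ g.K) (s : Lay) {k x y : ℕ} (hcur : k < 2 → s.cur g = k) :
    (s.place g l k x y).cur g =
      if k < 2 ∧ s.ptr g k + 1 = g.K then 1 - s.cur g else s.cur g := by
  have hc := s.cur_lt (g := g)
  by_cases hk : k < 2
  · have e : (s.place g l k x y).nh 0 = s.nh 0 + 1 := by rw [place_nh, if_pos hk, if_pos rfl]
    have hp : s.ptr g k = s.nh 0 % g.K := by rw [ptr, if_pos hk, if_pos (hcur hk)]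
    rw [hp]
    simp only [cur, e, succ_div hK] at hc ⊢
    by_cases h : s.nh 0 % g.K + 1 = g.K
    · rw [if_pos h, if_pos ⟨hk, h⟩]
      omega
    · rw [if_neg h, if_neg fun h' => h h'.2]
  · have e : (s.place g l k x y).nh 0 = s.nh 0 := by
      rw [place_nh, if_neg hk, if_neg (by omega)]
    rw [if_neg fun h => hk h.1]
    simp only [cur, e]

/-- The machine stores the pointers but not the unbounded counters `nh`, so a pointer must be
computable from its old value. When a copy fills up, its pointer wraps to `0`, which is also the
pointer of the copy that takes over. -/
lemma place_ptr (hK : 1 ≤ g.K) (s : Lay) {k x y : ℕ} (hcur : k < 2 → s.cur g = k) (k' : ℕ) :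
    (s.place g l k x y).ptr g k' =
      if k' = k then (if s.ptr g k + 1 = g.K then 0 else s.ptr g k + 1) else s.ptr g k' := by
  have hc := s.cur_lt (g := g)
  have hc' := place_cur (l := l) (x := x) (y := y) hK s hcur
  by_cases hk : k < 2
  · have e : (s.place g l k x y).nh 0 = s.nh 0 + 1 := by rw [place_nh, if_pos hk, if_pos rfl]
    have hp : s.ptr g k = s.nh 0 % g.K := by rw [ptr, if_pos hk, if_pos (hcur hk)]
    have hcur := hcur hk
    by_cases hk' : k' < 2
    · rw [ptr, if_pos hk', hc', e, succ_mod hK, ← hp]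
      by_cases h : s.ptr g k + 1 = g.K
      · have hkh : k < 2 ∧ s.ptr g k + 1 = g.K := ⟨hk, h⟩
        rw [if_pos hkh, if_pos h, ite_self]
        by_cases h2 : k' = k
        · rw [if_pos h2]
        · have h3 : s.cur g ≠ k' := by omega
          rw [if_neg h2, ptr, if_pos hk', if_neg h3]
      · have hkh : ¬(k < 2 ∧ s.ptr g k + 1 = g.K) := fun h' => h h'.2
        rw [if_neg hkh, if_neg h, hcur]
        by_cases h2 : k' = k
        · rw [if_pos h2.symm, if_pos h2]
        · have h3 : s.cur g ≠ k' := by omega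
          rw [if_neg (Ne.symm h2), if_neg h2, ptr, if_pos hk', if_neg h3]
    · rw [ptr, if_neg hk', if_neg (by omega), place_nh, if_pos hk, if_neg (by omega), ptr,
        if_neg hk']
  · have e : (s.place g l k x y).nh 0 = s.nh 0 := by
      rw [place_nh, if_neg hk, if_neg (by omega)]
    rw [if_neg fun h => hk h.1] at hc'
    by_cases hk' : k' < 2
    · have h2 : k' ≠ k := by omega
      rw [if_neg h2, ptr, if_pos hk', hc', e, ptr, if_pos hk']
    · rw [ptr, if_neg hk', place_nh, if_neg hk]
      by_cases h2 : k' = k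
      · rw [if_pos h2, if_pos h2, ptr, if_neg hk, h2, succ_mod hK]
      · rw [if_neg h2, if_neg h2, ptr, if_neg hk']

lemma place_hl_self (s : Lay) (k x y : ℕ) : (s.place g l k x y).hl x = k + 1 :=
  Function.update_self _ _ _

lemma place_hl_of_ne (s : Lay) {k x y z : ℕ} (hz : z ≠ x) :
    (s.place g l k x y).hl z = (s.evict k (s.ptr g k)).hl z :=
  Function.update_of_ne hz _ _

lemma place_hy_self (s : Lay) (k x y : ℕ) : (s.place g l k x y).hy x = y :=
  Function.update_self _ _ _

lemma place_hy_of_ne (s : Lay) {k x y z : ℕ} (hz : z ≠ x) :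
    (s.place g l k x y).hy z = s.hy z := by
  simp only [place, put, Function.update_of_ne hz, evict_hy]

lemma place_act (s : Lay) (k x y : ℕ) : (s.place g l k x y).act = insert x s.act := by
  simp only [place, put, evict_act]

lemma hl_of_place {s : Lay} {k x y z m : ℕ} (hz : z ≠ x)
    (h : (s.place g l k x y).hl z = m + 1) : s.hl z = m + 1 := by
  rw [place_hl_of_ne s hz] at h
  rcases s.evict_hl k (s.ptr g k) z with h1 | h1 <;> omega

lemma homes_place_subset {s : Lay} {k x y : ℕ} (ok : s.Ok g l)
    (ok' : (s.place g l k x y).Ok g l) (k' : ℕ) :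
    (s.place g l k x y).homes g k' ⊆ if k' = k then insert x (s.homes g k') else s.homes g k' := by
  intro z hz
  have hz' := (mem_homes ok').1 hz
  by_cases e : z = x
  · subst e
    rw [place_hl_self] at hz'
    rw [if_pos (by omega)]
    exact mem_insert_self _ _
  · have h1 := (mem_homes ok).2 (hl_of_place e hz')
    split_ifs
    · exact mem_insert_of_mem h1
    · exact h1

lemma recent_place_of_ne {s : Lay} {k x y k' : ℕ} (h : k' ≠ k) (n : ℕ) :
    (s.place g l k x y).recent k' n = s.recent k' n := by
  ext z
  simp only [mem_recent]
  refine exists_congr fun p => and_congr_right fun _ => ?_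
  rw [place_ring_of_ne _ fun h' => h h'.1]

lemma recent_place_self {s : Lay} {k x y : ℕ} :
    insert x (s.recent k (s.ptr g k)) ⊆ (s.place g l k x y).recent k (s.ptr g k + 1) := by
  intro z hz
  rw [mem_recent]
  rcases mem_insert.1 hz with rfl | hz
  · exact ⟨s.ptr g k, by omega, put_ring_self _ _ _ _ _⟩
  · obtain ⟨p, hp, h1⟩ := mem_recent.1 hz
    exact ⟨p, by omega, by rw [place_ring_of_ne _ fun h' => by omega, h1]⟩

lemma retract_hl (s : Lay) (x z : ℕ) : (s.retract x).hl z = s.hl z ∨ (s.retract x).hl z = 0 := by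
  unfold retract
  split_ifs
  · exact Or.inl rfl
  · simp only [release, Function.update_apply]
    split_ifs
    · exact Or.inr rfl
    · exact Or.inl rfl

lemma retract_hy (s : Lay) (x : ℕ) : (s.retract x).hy = s.hy := by
  unfold retract
  split_ifs <;> rfl

lemma retract_act (s : Lay) (x : ℕ) : (s.retract x).act = s.act.erase x := by
  unfold retract
  split_ifs <;> rfl

lemma homes_retract_subset {s : Lay} (x k : ℕ) : (s.retract x).homes g k ⊆ s.homes g k := by
  intro z hz
  obtain ⟨h1, h2⟩ := mem_filter.1 hz
  refine mem_filter.2 ⟨h1, ?_⟩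
  rcases s.retract_hl x z with h | h <;> omega

lemma recent_retract (s : Lay) (x k n : ℕ) : (s.retract x).recent k n = s.recent k n := by
  unfold recent
  rw [retract_ring]

lemma cur_retract (s : Lay) (x : ℕ) : (s.retract x).cur g = s.cur g := by
  unfold cur
  rw [retract_nh]

lemma ptr_retract (s : Lay) (x k : ℕ) : (s.retract x).ptr g k = s.ptr g k := by
  unfold ptr
  rw [retract_nh, cur_retract]

end Lay

namespace St

open Relation

/-- The number of steps of a background computation. -/
def total (g : Net) : ℕ := g.N * (g.N + 4)

/-- The invariant of the data structure. -/
structure Inv (g : Net) (l Λ d : ℕ) (s : St) : Prop where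
  ok : s.lay.Ok g l
  pl : ∀ c < 2, ∀ x, s.lay.hl x = c + 1 → (s.cp c).pl x = s.lay.hy x
  reserved : (s.cp (s.lay.cur g)).T ⊆ range g.N
  forbidden : (s.cp (s.lay.cur g)).F ⊆ g.right
  inUse : g.Using Λ (s.cp (s.lay.cur g)) ((s.cp (s.lay.cur g)).T ∪ s.lay.homes g (s.lay.cur g))
    (s.lay.recent (s.lay.cur g) (s.lay.ptr g (s.lay.cur g)))
  frozen : g.Frozen Λ (s.cp (1 - s.lay.cur g)) s.S s.E (s.lay.homes g (1 - s.lay.cur g))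
    (s.lay.recent (1 - s.lay.cur g) g.K) s.rem
  arr : s.lay.arr l = s.lay.nh 0
  epoch : ∃ s₀ : Lay, s₀.Ok g l ∧ ReflTransGen (Lay.Step g l) s₀ s.lay ∧ s₀.arr l = s₀.nh 0 ∧
    s₀.nh 0 = s.lay.nh 0 / g.K * g.K ∧ (s.rem = 0 ∨ s.rem + d + s.lay.arr 0 ≤ total g + s₀.arr 0)

/-- A step of the background computation, if one remains. -/
inductive Bg (g : Net) (s : St) : St → Prop
  | idle : s.rem = 0 → Bg g s s
  | step (q : ℕ) (c : Net.Copy) (S E : Finset ℕ) : s.rem = q + 1 →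
      g.BgStep (s.lay.homes g (1 - s.lay.cur g)) (s.cp (1 - s.lay.cur g)) s.S s.E
        (q / g.N) (q % g.N) c S E →
      Bg g s ⟨s.lay, Function.update s.cp (1 - s.lay.cur g) c, S, E, q⟩

/-- Grant the home `y` in kind `k` to `x`, and exchange the copies if the ring is full. -/
def place (g : Net) (l k x y : ℕ) (s : St) : St :=
  { s with
    lay := s.lay.place g l k x y
    rem := if k < 2 ∧ s.lay.ptr g k + 1 = g.K then total g else s.rem }

/-- Place `x` at `y` in the copy that is in use. -/
def assign (g : Net) (x y : ℕ) (s : St) : St :=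
  { s with cp := Function.update s.cp (s.lay.cur g) ((s.cp (s.lay.cur g)).assign x y) }

/-- The choice of a home for `x`: the kind `k`, the right node `y`, and the state after updating the
copies. -/
inductive Choice (g : Net) (l : ℕ) (s : St) (x : ℕ) : ℕ → ℕ → St → Prop
  | level (i y : ℕ) : i < l → (∀ j < i, g.nbrs x ⊆ s.lay.occ (j + 2)) → y ∈ g.nbrs x →
      y ∉ s.lay.occ (i + 2) → Choice g l s x (i + 2) y s
  | reserved : (∀ j < l, g.nbrs x ⊆ s.lay.occ (j + 2)) → x ∈ (s.cp (s.lay.cur g)).T →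
      Choice g l s x (s.lay.cur g) ((s.cp (s.lay.cur g)).pl x) s
  | select (y : ℕ) : (∀ j < l, g.nbrs x ⊆ s.lay.occ (j + 2)) → x ∉ (s.cp (s.lay.cur g)).T →
      g.Select (s.cp (s.lay.cur g)) x y → Choice g l s x (s.lay.cur g) y (s.assign g x y)

variable {g : Net} {l Λ d : ℕ}

lemma Inv.touch (hK : 1 ≤ g.K) {s : St} (h : s.Inv g l Λ 0) {x : ℕ} (hx : s.lay.hl x ≠ 0)
    (hc : (insert x s.lay.act).card ≤ g.K) :
    Inv g l Λ 0 { s with lay := { s.lay with act := insert x s.lay.act } } := by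
  have hs : s.lay.Step g l { s.lay with act := insert x s.lay.act } := .touch x hx hc
  obtain ⟨s₀, h1, h2, h3⟩ := h.epoch
  exact { h with
    ok := h.ok.step hK hs
    epoch := ⟨s₀, h1, h2.tail hs, h3⟩ }

lemma Inv.retract (hK : 1 ≤ g.K) {s : St} (h : s.Inv g l Λ 0) {x : ℕ} (hx : x ∈ s.lay.act) :
    Inv g l Λ 0 { s with lay := s.lay.retract x } := by
  have hs : s.lay.Step g l (s.lay.retract x) := .retract x hx
  have ok := h.ok.step hK hs
  obtain ⟨s₀, h1, h2, h3⟩ := h.epoch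
  constructor
  · exact ok
  · intro c hc z hz
    dsimp only at hz ⊢
    rw [Lay.retract_hy]
    refine h.pl c hc z ?_
    rcases s.lay.retract_hl x z with h | h <;> omega
  · simpa only [Lay.cur_retract] using h.reserved
  · simpa only [Lay.cur_retract] using h.forbidden
  · simp only [Lay.cur_retract, Lay.ptr_retract, Lay.recent_retract]
    exact h.inUse.mono (union_subset_union_right (Lay.homes_retract_subset _ _)) Subset.rfl
  · simp only [Lay.cur_retract, Lay.recent_retract]
    refine h.frozen.mono (Lay.homes_retract_subset _ _) ?_
    have := ok.recent_subset (1 - s.lay.cur g)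
    rwa [Lay.recent_retract] at this
  · dsimp only
    rw [Lay.retract_arr, Lay.retract_nh]
    exact h.arr
  · dsimp only
    refine ⟨s₀, h1, h2.tail hs, ?_⟩
    rwa [Lay.retract_arr, Lay.retract_nh]

/-- The parameter `d` of the invariant is credit: a renewal step lowers `rem` and raises `d` to `1`,
and the arrival that follows in the same request spends it. -/
lemma Inv.bg (hg : g.Expanding) (hΛ : 2 * g.K < 4 ^ Λ) {s s' : St} (h : s.Inv g l Λ 0)
    (hb : s.Bg g s') : s'.Inv g l Λ 1 ∧ s'.lay = s.lay := by
  obtain ⟨s₀, h1, h2, h3, h4, h5⟩ := h.epoch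
  cases hb with
  | idle h0 => exact ⟨{ h with epoch := ⟨s₀, h1, h2, h3, h4, Or.inl h0⟩ }, rfl⟩
  | step q c S E hq hb =>
    have hne : s.lay.cur g ≠ 1 - s.lay.cur g := by
      have := s.lay.cur_lt (g := g)
      omega
    refine ⟨⟨h.ok, ?_, ?_, ?_, ?_, ?_, h.arr, s₀, h1, h2, h3, h4, ?_⟩, rfl⟩
    · intro c' hc' x hx
      dsimp only at hx ⊢
      by_cases e : c' = 1 - s.lay.cur g
      · subst e
        rw [Function.update_self, ← h.pl _ hc' x hx]
        have hxH : x ∈ s.lay.homes g (1 - s.lay.cur g) := (Lay.mem_homes h.ok).2 hx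
        generalize q / g.N = p at hb
        generalize q % g.N = r at hb
        cases hb with
        -- Only this kind of step assigns a place, and never to a node with a home in the copy, so
        -- no edge of Matcher moves.
        | place y hy hzS hzT hzH hs =>
          have : x ≠ r := fun e => hzH (e ▸ hxH)
          simp [Net.Copy.assign, Function.update_of_ne this]
        | _ => rfl
      · rw [Function.update_of_ne e]
        exact h.pl c' hc' x hx
    · dsimp only
      rw [Function.update_of_ne hne]
      exact h.reserved
    · dsimp only
      rw [Function.update_of_ne hne]
      exact h.forbidden
    · dsimp only
      rw [Function.update_of_ne hne]
      exact h.inUse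
    · dsimp only
      rw [Function.update_self]
      exact Net.Frozen.step hg hΛ (hq ▸ h.frozen) hb
    · dsimp only
      omega

end St

end DynMatch

/-! ### The choice of a home, the exchange of the copies, and the load. -/

namespace DynMatch

open Finset

namespace St

open Relation

variable {g : Net} {l Λ d : ℕ}

lemma Choice.lay {s s' : St} {x k y : ℕ} (hc : s.Choice g l x k y s') : s'.lay = s.lay := by
  cases hc <;> rfl

lemma Choice.sets {s s' : St} {x k y : ℕ} (hc : s.Choice g l x k y s') :
    s'.S = s.S ∧ s'.E = s.E ∧ s'.rem = s.rem := by
  cases hc <;> exact ⟨rfl, rfl, rfl⟩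

lemma Choice.arrive {s s' : St} (h : s.Inv g l Λ d) {x k y : ℕ} (hc : s.Choice g l x k y s')
    (hx : s.lay.hl x = 0) (hxN : x < g.N) (hcard : (insert x s.lay.act).card ≤ g.K) :
    s.lay.Arrive g l k x y := by
  have hcur := s.lay.cur_lt (g := g)
  cases hc with
  | level i _ hi hfull hy hyo =>
    exact ⟨hx, hxN, hy, by omega, fun h => by omega, fun _ => hyo,
      fun j _ hj' => hfull j (by have := hj' (by omega); omega), hcard⟩
  | reserved hfull hT =>
    exact ⟨hx, hxN, h.inUse.places.mem x (mem_union_left _ hT), by omega, fun _ => rfl,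
      fun h => by omega, fun j hj _ => hfull j hj, hcard⟩
  | select _ hfull hT hs =>
    exact ⟨hx, hxN, hs.mem, by omega, fun _ => rfl, fun h => by omega, fun j hj _ => hfull j hj,
      hcard⟩

lemma assign_cp_self (s : St) (x y : ℕ) :
    (s.assign g x y).cp (s.lay.cur g) = (s.cp (s.lay.cur g)).assign x y :=
  Function.update_self _ _ _

lemma assign_cp_of_ne (s : St) (x y : ℕ) {c : ℕ} (hc : c ≠ s.lay.cur g) :
    (s.assign g x y).cp c = s.cp c :=
  Function.update_of_ne hc _ _

/-- A reserved node takes its prepared place, which `Places` has counted all along; any other node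
is placed greedily and joins the batch. -/
lemma Choice.inUse {s s' : St} (hK : 1 ≤ g.K) (h : s.Inv g l Λ d) {x k y : ℕ}
    (hc : s.Choice g l x k y s') (hx : s.lay.hl x = 0) (hxN : x < g.N) (hk : k < 2) :
    k = s.lay.cur g ∧ g.Using Λ (s'.cp k) ((s.cp k).T ∪ insert x (s.lay.homes g k))
      (insert x (s.lay.recent k (s.lay.ptr g k))) := by
  cases hc with
  | level i => omega
  | reserved hfull hT =>
    refine ⟨rfl, h.inUse.mono ?_ (subset_insert _ _)⟩
    rw [union_insert]
    exact insert_subset (mem_union_left _ hT) Subset.rfl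
  | select _ hfull hT hs =>
    have hxH : x ∉ s.lay.homes g (s.lay.cur g) := by
      rw [Lay.mem_homes h.ok]
      omega
    have hxr : x ∉ s.lay.recent (s.lay.cur g) (s.lay.ptr g (s.lay.cur g)) := by
      intro hm
      obtain ⟨p, hp, h1⟩ := Lay.mem_recent.1 hm
      have := (h.ok.ring_val _ p x (hp.trans (s.lay.ptr_lt hK _)) h1).1
      omega
    refine ⟨rfl, ?_⟩
    rw [assign_cp_self, union_insert]
    refine ⟨h.inUse.closed, h.inUse.batch.assign hxN hT hxr hs, h.inUse.places.assign ?_ hs⟩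
    rw [mem_union]
    exact fun h => h.elim hT hxH

lemma Choice.T {s s' : St} {x k y : ℕ} (hc : s.Choice g l x k y s') (c : ℕ) :
    (s'.cp c).T = (s.cp c).T ∧ (s'.cp c).F = (s.cp c).F := by
  cases hc with
  | level => exact ⟨rfl, rfl⟩
  | reserved => exact ⟨rfl, rfl⟩
  | select y =>
    by_cases e : c = s.lay.cur g
    · subst e
      rw [assign_cp_self]
      exact ⟨rfl, rfl⟩
    · rw [assign_cp_of_ne _ _ _ e]
      exact ⟨rfl, rfl⟩

lemma Choice.cp_of_ne {s s' : St} {x k y : ℕ} (hc : s.Choice g l x k y s') {c : ℕ}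
    (hne : c ≠ s.lay.cur g) : s'.cp c = s.cp c := by
  cases hc with
  | level => rfl
  | reserved => rfl
  | select y => exact assign_cp_of_ne _ _ _ hne

lemma Choice.cp_of_le {s s' : St} {x k y : ℕ} (hc : s.Choice g l x k y s') (hk : 2 ≤ k) :
    s' = s := by
  have := s.lay.cur_lt (g := g)
  cases hc with
  | level => rfl
  | reserved => rfl
  | select y => omega

lemma Choice.pl {s s' : St} (h : s.Inv g l Λ d) {x k y : ℕ} (hc : s.Choice g l x k y s')
    (hx : s.lay.hl x = 0) {c : ℕ} (hc2 : c < 2) {z : ℕ}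
    (hz : (s.lay.place g l k x y).hl z = c + 1) :
    (s'.cp c).pl z = (s.lay.place g l k x y).hy z := by
  by_cases e : z = x
  · subst e
    rw [Lay.place_hl_self] at hz
    rw [Lay.place_hy_self]
    cases hc with
    | level => omega
    | reserved =>
      obtain rfl : s.lay.cur g = c := by omega
      rfl
    | select y =>
      obtain rfl : s.lay.cur g = c := by omega
      rw [assign_cp_self]
      simp [Net.Copy.assign]
  · rw [Lay.place_hy_of_ne _ e, ← h.pl c hc2 z (Lay.hl_of_place e hz)]
    cases hc with
    | level => rfl
    | reserved => rfl
    | select y =>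
      by_cases e' : c = s.lay.cur g
      · subst e'
        rw [assign_cp_self]
        simp [Net.Copy.assign, Function.update_of_ne e]
      · rw [assign_cp_of_ne _ _ _ e']

/-- The point is the exchange. The copy that takes over has been renewed in time and starts with an
empty batch; the full copy is frozen and a renewal of `total g` steps begins. A grant in the first
layer, or in a copy that is not yet full, only advances the epoch. -/
lemma Inv.place (hg : g.Expanding) (hl : 1 ≤ l) (hG : total g ≤ 2 ^ (l - 1)) {s s' : St}
    (h : s.Inv g l Λ 1) {x k y : ℕ} (hc : s.Choice g l x k y s') (hx : s.lay.hl x = 0)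
    (hxN : x < g.N) (hcard : (insert x s.lay.act).card ≤ g.K) :
    Inv g l Λ 0 (s'.place g l k x y) := by
  have hK := hg.pos
  have ha := hc.arrive h hx hxN hcard
  have hs : s.lay.Step g l (s.lay.place g l k x y) := .place k x y ha
  have ok := h.ok.step hK hs
  have hcur := s.lay.place_cur (l := l) (x := x) (y := y) hK ha.cur
  have hptr := s.lay.place_ptr (l := l) (x := x) (y := y) hK ha.cur
  have hhom := Lay.homes_place_subset (k := k) (x := x) (y := y) h.ok ok
  have hlt := s.lay.cur_lt (g := g)
  have hlay := hc.lay
  obtain ⟨s₀, e1, e2, e3, e4, e5⟩ := h.epoch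
  have hsteps := e2.tail hs
  have harr0 : (s.lay.place g l k x y).arr 0 = s.lay.arr 0 + 1 := by
    rw [Lay.place_arr, if_pos (Nat.zero_le _)]
  have harr : (s.lay.place g l k x y).arr l = (s.lay.place g l k x y).nh 0 := by
    have := ha.kind
    have := h.arr
    rw [Lay.place_arr, Lay.place_nh]
    by_cases hk : k < 2
    · simp [hk, h.arr]
    · rw [if_neg hk, if_neg hk, if_neg (by omega), if_neg (by omega), h.arr]
  by_cases hk : k < 2
  · obtain ⟨rfl, hu⟩ := hc.inUse hK h hx hxN hk
    have hu' : g.Using Λ (s'.cp (s.lay.cur g)) ((s'.cp (s.lay.cur g)).T ∪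
        (s.lay.place g l (s.lay.cur g) x y).homes g (s.lay.cur g))
        ((s.lay.place g l (s.lay.cur g) x y).recent (s.lay.cur g)
          (s.lay.ptr g (s.lay.cur g) + 1)) := by
      refine hu.mono ?_ Lay.recent_place_self
      rw [(hc.T _).1]
      have := hhom (s.lay.cur g)
      rw [if_pos rfl] at this
      exact union_subset_union_right this
    have hne : 1 - s.lay.cur g ≠ s.lay.cur g := by omega
    have hhom' : (s.lay.place g l (s.lay.cur g) x y).homes g (1 - s.lay.cur g) ⊆
        s.lay.homes g (1 - s.lay.cur g) := by
      have := hhom (1 - s.lay.cur g)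
      rwa [if_neg hne] at this
    have hrec : (s.lay.place g l (s.lay.cur g) x y).recent (1 - s.lay.cur g) g.K =
        s.lay.recent (1 - s.lay.cur g) g.K := Lay.recent_place_of_ne hne _
    have hfro : g.Frozen Λ (s'.cp (1 - s.lay.cur g)) s.S s.E
        ((s.lay.place g l (s.lay.cur g) x y).homes g (1 - s.lay.cur g))
        ((s.lay.place g l (s.lay.cur g) x y).recent (1 - s.lay.cur g) g.K) s.rem := by
      rw [hc.cp_of_ne hne]
      rw [hrec]
      refine h.frozen.mono hhom' ?_
      rw [← hrec]
      exact ok.recent_subset _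
    have hSE := hc.sets
    have hnh : (s.lay.place g l (s.lay.cur g) x y).nh 0 = s.lay.nh 0 + 1 := by
      rw [Lay.place_nh, if_pos hk, if_pos rfl]
    have hp : s.lay.ptr g (s.lay.cur g) = s.lay.nh 0 % g.K := by
      rw [Lay.ptr, if_pos hk, if_pos rfl]
    by_cases hsw : s.lay.ptr g (s.lay.cur g) + 1 = g.K
    · -- the copies are exchanged
      have hkh : s.lay.cur g < 2 ∧ s.lay.ptr g (s.lay.cur g) + 1 = g.K := ⟨hk, hsw⟩
      rw [if_pos hkh] at hcur
      have hdiv : (s.lay.nh 0 + 1) / g.K * g.K = s.lay.nh 0 + 1 := by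
        have h1 := Nat.div_add_mod (s.lay.nh 0) g.K
        rw [succ_div hK, if_pos (hp ▸ hsw), add_mul, one_mul, mul_comm]
        omega
      -- This grant is number `K` of the epoch in the last layer, so `Lay.lt_arr` gives more than `2
      -- ^ (l - 1) ≥ total g` arrivals since the epoch began, and each has paid for one step.
      have hrem : s.rem = 0 := by
        rcases e5 with e5 | e5
        · exact e5
        · have h1 := Lay.lt_arr hg e1 hsteps hl (by
            have h1 := Nat.div_add_mod (s.lay.nh 0) g.K
            rw [mul_comm] at h1
            rw [harr, hnh, e3, e4]
            omega)
          omega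
      rw [hrem] at hfro
      have hdone := Net.Frozen.done hg hfro
      have hsz := hfro.1
      constructor
      · exact (congrArg (fun t => Lay.Ok g l (t.place g l (s.lay.cur g) x y)) hlay).mpr ok
      · intro c hc2 z hz
        simp only [St.place, hlay] at hz ⊢
        exact hc.pl h hx hc2 hz
      · simp only [St.place, hlay, hcur]
        exact hsz.reserved
      · simp only [St.place, hlay, hcur]
        exact hsz.forbidden
      · simp only [St.place, hlay, hcur]
        exact hdone.mono Subset.rfl (empty_subset _)
      · simp only [St.place, hlay, hcur, if_pos hkh]
        rw [show 1 - (1 - s.lay.cur g) = s.lay.cur g by omega]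
        rw [hsw] at hu'
        refine Net.Using.freeze ⟨filter_subset _ _, ?_, ok.recent_subset _,
          Lay.card_recent_le _ _ _, ?_, ?_, ?_, ?_⟩ hu'
        · have h1 := card_le_card (ok.homes_subset (s.lay.cur g))
          have h2 := card_union_le
            ((s.lay.place g l (s.lay.cur g) x y).recent (s.lay.cur g) g.K)
            ((s.lay.place g l (s.lay.cur g) x y).act \
              (s.lay.place g l (s.lay.cur g) x y).recent (s.lay.cur g) g.K)
          have h3 := (s.lay.place g l (s.lay.cur g) x y).card_recent_le (s.lay.cur g) g.K
          have h4 := ok.act_card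
          -- The node just placed is active and in the ring, so the number of homes is strictly
          -- below `2K`. The closure needs this strictness.
          have h5 : ((s.lay.place g l (s.lay.cur g) x y).act \
              (s.lay.place g l (s.lay.cur g) x y).recent (s.lay.cur g) g.K).card <
              (s.lay.place g l (s.lay.cur g) x y).act.card := by
            refine card_lt_card (ssubset_iff_of_subset sdiff_subset |>.2 ⟨x, ?_, ?_⟩)
            · rw [Lay.place_act]
              exact mem_insert_self _ _
            · rw [mem_sdiff]
              refine fun h' => h'.2 ?_
              have := Lay.recent_place_self (g := g) (l := l) (s := s.lay) (k := s.lay.cur g)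
                (x := x) (y := y)
              rw [hsw] at this
              exact this (mem_insert_self _ _)
          omega
        · rw [(hc.T _).1]
          exact h.reserved
        · rw [(hc.T _).2]
          exact h.forbidden
        · rw [hSE.1]
          exact hsz.reserved'
        · rw [hSE.2.1]
          exact hsz.forbidden'
      · simp only [St.place, hlay]
        exact harr
      · simp only [St.place, hlay, if_pos hkh]
        refine ⟨_, ok, .refl, harr, ?_, Or.inr (by omega)⟩
        rw [hnh, hdiv]
    · have hkh : ¬(s.lay.cur g < 2 ∧ s.lay.ptr g (s.lay.cur g) + 1 = g.K) := fun h => hsw h.2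
      rw [if_neg hkh] at hcur
      have hptr' := hptr (s.lay.cur g)
      rw [if_pos rfl, if_neg hsw] at hptr'
      constructor
      · exact (congrArg (fun t => Lay.Ok g l (t.place g l (s.lay.cur g) x y)) hlay).mpr ok
      · intro c hc2 z hz
        simp only [St.place, hlay] at hz ⊢
        exact hc.pl h hx hc2 hz
      · simp only [St.place, hlay, hcur]
        rw [(hc.T _).1]
        exact h.reserved
      · simp only [St.place, hlay, hcur]
        rw [(hc.T _).2]
        exact h.forbidden
      · simp only [St.place, hlay, hcur, hptr']
        exact hu'
      · simp only [St.place, hlay, hcur, if_neg hkh, hSE]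
        exact hfro
      · simp only [St.place, hlay]
        exact harr
      · simp only [St.place, hlay, if_neg hkh, hSE]
        refine ⟨s₀, e1, hsteps, e3, ?_, ?_⟩
        · rw [e4, hnh, succ_div hK, if_neg (hp ▸ hsw)]
        · rw [harr0]
          omega
  · have hss := hc.cp_of_le (by omega)
    subst hss
    have hkh : ¬(k < 2 ∧ s'.lay.ptr g k + 1 = g.K) := fun h => hk h.1
    rw [if_neg hkh] at hcur
    have hptr' := hptr (s'.lay.cur g)
    rw [if_neg (by omega)] at hptr'
    have hnh : (s'.lay.place g l k x y).nh 0 = s'.lay.nh 0 := by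
      rw [Lay.place_nh, if_neg hk, if_neg (by omega)]
    have hhom' : ∀ c < 2, (s'.lay.place g l k x y).homes g c ⊆ s'.lay.homes g c := by
      intro c hc2
      have := hhom c
      rwa [if_neg (by omega)] at this
    have hrec : ∀ c < 2, ∀ n, (s'.lay.place g l k x y).recent c n = s'.lay.recent c n :=
      fun c hc2 n => Lay.recent_place_of_ne (by omega) n
    constructor
    · exact ok
    · intro c hc2 z hz
      exact hc.pl h hx hc2 hz
    · simp only [St.place, hcur]
      exact h.reserved
    · simp only [St.place, hcur]
      exact h.forbidden
    · simp only [St.place, hcur, hptr', hrec _ hlt]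
      exact h.inUse.mono (union_subset_union_right (hhom' _ hlt)) Subset.rfl
    · simp only [St.place, hcur, if_neg hkh]
      have h1 := hrec (1 - s'.lay.cur g) (by omega) g.K
      rw [h1]
      refine h.frozen.mono (hhom' _ (by omega)) ?_
      rw [← h1]
      exact ok.recent_subset _
    · exact harr
    · simp only [St.place, if_neg hkh]
      refine ⟨s₀, e1, hsteps, e3, ?_, ?_⟩
      · rw [e4, hnh]
      · rw [harr0]
        omega

/-- The initial state. -/
def init : St where
  lay := ⟨fun _ => 0, fun _ => 0, ∅, ∅, fun _ => ∅, fun _ _ => 0, fun _ => 0, fun _ => 0⟩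
  cp := fun _ => ⟨∅, ∅, fun _ => 0, fun _ => 0⟩
  S := ∅
  E := ∅
  rem := 0

/-- With nothing reserved, forbidden or placed, the other copy counts as completely renewed, in its
last pass with no node remaining. -/
lemma init_inv (hg : g.Expanding) : init.Inv g l Λ 0 := by
  have hK := hg.pos
  have hD := hg.six_le
  have ok : init.lay.Ok g l := by
    constructor <;> simp [init]
  have hh : ∀ k, init.lay.homes g k = ∅ := by
    intro k
    simp [Lay.homes, init]
  have hr : ∀ k n, init.lay.recent k n = ∅ := by
    intro k n
    simp [Lay.recent, init]
  have hcl : g.Closed ∅ ∅ := ⟨by simp, fun z hz _ => by simp; omega⟩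
  constructor
  · exact ok
  · intro c hc x hx
    simp [init] at hx
  · simp [init]
  · simp [init]
  · rw [hh, hr]
    refine ⟨hcl, ⟨∅, by simp, fun _ => 0, by simp, by simp, by simp, by simp [init]⟩, ?_⟩
    exact ⟨by simp [init], by simp [init]⟩
  · rw [hh, hr]
    refine ⟨⟨by simp, by simp; omega, by simp, by simp, by simp [init], by simp [init],
      by simp [init], by simp [init]⟩, 0, 0, by omega, by simp [init], ?_⟩
    refine .finish _ ⟨hcl, by simp [init], by simp⟩ ?_ ?_ ?_ ?_ <;> simp [init]
  · rfl
  · exact ⟨init.lay, ok, .refl, rfl, by simp [init], Or.inl rfl⟩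

/-- Each of the `l` levels contributes at most one edge at `y`, and each of the two copies of the
last layer at most `Λ`, the frozen one included. -/
lemma Inv.load_le (hg : g.Expanding) (hΛ : 2 * g.K < 4 ^ Λ) {s : St} (h : s.Inv g l Λ d) (y : ℕ) :
    (s.lay.act.filter fun x => s.lay.hy x = y).card ≤ l + 2 * Λ := by
  have hcur := s.lay.cur_lt (g := g)
  have hB : ∀ c < 2, ((s.lay.homes g c).filter fun x => (s.cp c).pl x = y).card ≤ Λ := by
    intro c hc
    by_cases e : c = s.lay.cur g
    · subst e
      refine (card_le_card (filter_subset_filter _ subset_union_right)).trans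
        (h.inUse.places.load_le hg h.inUse.closed h.inUse.batch ?_ hΛ
          (union_subset h.reserved (filter_subset _ _)) y)
      have h1 := s.lay.card_recent_le (s.lay.cur g) (s.lay.ptr g (s.lay.cur g))
      have h2 := s.lay.ptr_lt hg.pos (s.lay.cur g)
      omega
    · obtain rfl : c = 1 - s.lay.cur g := by omega
      exact h.frozen.load_le hg hΛ y
  have hA : ∀ k, 2 ≤ k → ((s.lay.homes g k).filter fun x => s.lay.hy x = y).card ≤ 1 := by
    intro k hk
    rw [card_le_one]
    intro a ha b hb
    obtain ⟨ha1, ha2⟩ := mem_filter.1 ha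
    obtain ⟨hb1, hb2⟩ := mem_filter.1 hb
    exact h.ok.occ_inj k a b hk ((Lay.mem_homes h.ok).1 ha1) ((Lay.mem_homes h.ok).1 hb1)
      (ha2.trans hb2.symm)
  have hsub : (s.lay.act.filter fun x => s.lay.hy x = y) ⊆
      ((range 2).biUnion fun c => (s.lay.homes g c).filter fun x => (s.cp c).pl x = y) ∪
      ((Ico 2 (l + 2)).biUnion fun k => (s.lay.homes g k).filter fun x => s.lay.hy x = y) := by
    intro x hx
    obtain ⟨hx1, hx2⟩ := mem_filter.1 hx
    have h1 := h.ok.act_hl x hx1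
    have h2 := h.ok.hl_le x
    have h3 : s.lay.hl x = s.lay.hl x - 1 + 1 := by omega
    have h4 := (Lay.mem_homes h.ok).2 h3
    by_cases h5 : s.lay.hl x - 1 < 2
    · refine mem_union_left _ (mem_biUnion.2 ⟨_, mem_range.2 h5, mem_filter.2 ⟨h4, ?_⟩⟩)
      rw [h.pl _ h5 x h3, hx2]
    · exact mem_union_right _ (mem_biUnion.2 ⟨_, mem_Ico.2 ⟨by omega, by omega⟩,
        mem_filter.2 ⟨h4, hx2⟩⟩)
  refine (card_le_card hsub).trans ((card_union_le _ _).trans ?_)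
  have h1 := card_biUnion_le_card_mul (range 2)
    (fun c => (s.lay.homes g c).filter fun x => (s.cp c).pl x = y) Λ
    fun c hc => hB c (mem_range.1 hc)
  have h2 := card_biUnion_le_card_mul (Ico 2 (l + 2))
    (fun k => (s.lay.homes g k).filter fun x => s.lay.hy x = y) 1
    fun k hk => hA k (mem_Ico.1 hk).1
  rw [card_range] at h1
  rw [Nat.card_Ico] at h2
  omega

end St

end DynMatch

/-! ### A program logic with step counts for the word RAM. -/

namespace DynMatch

section Semantics

variable {w : ℕ}

/-- The program `p`, started in the store `s` when `n` steps have been made, halts, and `Q` holds of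
the number of steps and of the store at the end. -/
def WP (w : ℕ) (p : Prog) (Q : ℕ → Store → Prop) (n : ℕ) (s : Store) : Prop :=
  ∃ t s', (∀ k, (step w)^[t] (p :: k, s) = (k, s')) ∧ Q (n + t) s'

lemma WP.instr {i : Instr} {Q : ℕ → Store → Prop} {n : ℕ} {s : Store}
    (h : Q (n + 1) (i.exec w s)) : WP w (.instr i) Q n s :=
  ⟨1, _, fun _ => rfl, h⟩

lemma WP.skip {Q : ℕ → Store → Prop} {n : ℕ} {s : Store} (h : Q (n + 1) s) :
    WP w .skip Q n s :=
  ⟨1, _, fun _ => rfl, h⟩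

lemma WP.seq {p q : Prog} {Q : ℕ → Store → Prop} {n : ℕ} {s : Store}
    (h : WP w p (fun n s => WP w q Q n s) (n + 1) s) : WP w (.seq p q) Q n s := by
  obtain ⟨t, s', h1, t', s'', h2, h3⟩ := h
  refine ⟨t' + t + 1, s'', fun k => ?_, ?_⟩
  · rw [Function.iterate_succ_apply, Function.iterate_add_apply]
    exact (congrArg _ (h1 (q :: k))).trans (h2 k)
  · rwa [show n + (t' + t + 1) = n + 1 + t + t' by omega]

lemma WP.ite {c : Test} {p q : Prog} {Q : ℕ → Store → Prop} {n : ℕ} {s : Store}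
    (h1 : c.eval s = true → WP w p Q (n + 1) s) (h2 : c.eval s = false → WP w q Q (n + 1) s) :
    WP w (.ite c p q) Q n s := by
  cases hc : c.eval s with
  | true =>
    obtain ⟨t, s', h3, h4⟩ := h1 hc
    refine ⟨t + 1, s', fun k => ?_, by rwa [show n + (t + 1) = n + 1 + t by omega]⟩
    rw [Function.iterate_succ_apply]
    simpa [step, hc] using h3 k
  | false =>
    obtain ⟨t, s', h3, h4⟩ := h2 hc
    refine ⟨t + 1, s', fun k => ?_, by rwa [show n + (t + 1) = n + 1 + t by omega]⟩
    rw [Function.iterate_succ_apply]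
    simpa [step, hc] using h3 k

lemma WP.mono {p : Prog} {Q Q' : ℕ → Store → Prop} {n : ℕ} {s : Store} (h : WP w p Q n s)
    (hQ : ∀ n s, Q n s → Q' n s) : WP w p Q' n s := by
  obtain ⟨t, s', h1, h2⟩ := h
  exact ⟨t, s', h1, hQ _ _ h2⟩

/-- A loop with `m` iterations. -/
lemma WP.loop (I : ℕ → ℕ → Store → Prop) (m : ℕ) {c : Test} {p : Prog} {Q : ℕ → Store → Prop}
    {n : ℕ} {s : Store} (h0 : I 0 n s)
    (h1 : ∀ i < m, ∀ n s, I i n s → c.eval s = true ∧ WP w p (I (i + 1)) (n + 1) s)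
    (h2 : ∀ n s, I m n s → c.eval s = false ∧ Q (n + 1) s) : WP w (.loop c p) Q n s := by
  have key : ∀ j i, i + j = m → ∀ n s, I i n s → WP w (.loop c p) Q n s := by
    intro j
    induction j with
    | zero =>
      intro i hi n s h
      obtain ⟨h3, h4⟩ := h2 n s ((show i = m by omega) ▸ h)
      exact ⟨1, s, fun k => by simp [step, h3], h4⟩
    | succ j ih =>
      intro i hi n s h
      obtain ⟨h3, t, s', h4, h5⟩ := h1 i (by omega) n s h
      obtain ⟨t', s'', h6, h7⟩ := ih (i + 1) (by omega) _ _ h5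
      refine ⟨t' + t + 1, s'', fun k => ?_, ?_⟩
      · rw [Function.iterate_succ_apply, Function.iterate_add_apply]
        refine Eq.trans (congrArg _ ?_) (h6 k)
        simpa [step, h3] using h4 (.loop c p :: k)
      · rwa [show n + (t' + t + 1) = n + 1 + t + t' by omega]
  exact key m 0 (by omega) n s h0

lemma iterate_step_nil (t : ℕ) (s : Store) : (step w)^[t] ([], s) = ([], s) :=
  Function.iterate_fixed rfl t

lemma WP.halts {p : Prog} {Q : ℕ → Store → Prop} {s : Store} {τ : ℕ} (h : WP w p Q 0 s)
    (hQ : ∀ n s, Q n s → n ≤ τ) : ∃ s', HaltsWithin w p s τ s' ∧ ∃ n, Q n s' := by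
  obtain ⟨t, s', h1, h2⟩ := h
  have := hQ _ _ h2
  refine ⟨s', ?_, _, h2⟩
  unfold HaltsWithin
  rw [show τ = (τ - t) + t by omega, Function.iterate_add_apply, h1]
  exact iterate_step_nil _ _

/-- `Reachable` allows any number of steps in which a program halts. Since the machine is
deterministic and stays halted, the store is the one found by the verification. -/
lemma HaltsWithin.unique {p : Prog} {s s₁ s₂ : Store} {t₁ t₂ : ℕ} (h₁ : HaltsWithin w p s t₁ s₁)
    (h₂ : HaltsWithin w p s t₂ s₂) : s₁ = s₂ := by
  unfold HaltsWithin at h₁ h₂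
  rcases le_total t₁ t₂ with h | h
  · rw [show t₂ = (t₂ - t₁) + t₁ by omega, Function.iterate_add_apply, h₁, iterate_step_nil] at h₂
    exact (Prod.ext_iff.1 h₂).2
  · rw [show t₁ = (t₁ - t₂) + t₂ by omega, Function.iterate_add_apply, h₂, iterate_step_nil] at h₁
    exact (Prod.ext_iff.1 h₁).2.symm

end Semantics

/-! ### The layout of the memory -/

/-- Update of a table. -/
def upd (A : ℕ → ℕ → ℕ) (i j v : ℕ) : ℕ → ℕ → ℕ :=
  Function.update A i (Function.update (A i) j v)

/-- The sizes: the number `R` of right nodes, the number of rows of the table, and the word size. -/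
structure Sizes where
  R : ℕ
  rows : ℕ
  w : ℕ

/-- The address of an entry of the table. -/
def cellAddr (g : Net) (z : Sizes) (i j : ℕ) : ℕ := g.N * g.D + i * (g.N + z.R) + j

/-- The words are large enough. -/
structure Fits (g : Net) (z : Sizes) : Prop where
  addr : g.N * g.D + z.rows * (g.N + z.R) < 2 ^ z.w
  count : 4 * (g.N * (g.N + 4)) < 2 ^ z.w
  deg : 3 * g.D < 2 ^ z.w
  const : 100 < 2 ^ z.w
  nb : ∀ x < g.N, ∀ j < g.D, g.nb x j < z.R

/-- The parameters are in registers. -/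
structure Params (g : Net) (z : Sizes) (ρ : ℕ → ℕ) : Prop where
  r0 : ρ 0 = g.N
  r1 : ρ 1 = g.D
  r2 : ρ 2 = z.R
  r3 : ρ 3 = g.K
  r8 : ρ 8 = 1
  r9 : ρ 9 = 0
  r10 : ρ 10 = g.N * g.D
  r11 : ρ 11 = g.N + z.R

/-- The memory holds the graph and the table `A`. -/
structure Holds (g : Net) (z : Sizes) (A : ℕ → ℕ → ℕ) (m : ℕ → ℕ) : Prop where
  adj : ∀ x < g.N, ∀ j < g.D, m (x * g.D + j) = g.nb x j
  cell : ∀ i < z.rows, ∀ j < g.N + z.R, m (cellAddr g z i j) = A i j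

/-- The store represents the register contents `ρ` (registers `12` to `15` are not represented) and
the table `A`. -/
structure Rep (g : Net) (z : Sizes) (ρ : ℕ → ℕ) (A : ℕ → ℕ → ℕ) (s : Store) : Prop where
  params : Params g z ρ
  holds : Holds g z A s.mem
  reg : ∀ r, (r < 12 ∨ 16 ≤ r) → s.reg r = ρ r

variable {g : Net} {z : Sizes} {A : ℕ → ℕ → ℕ} {ρ : ℕ → ℕ}

lemma Fits.cellAddr_lt (h : Fits g z) {i j : ℕ} (hi : i < z.rows) (hj : j < g.N + z.R) :
    cellAddr g z i j < 2 ^ z.w := by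
  refine lt_of_lt_of_le ?_ h.addr.le
  have : (i + 1) * (g.N + z.R) ≤ z.rows * (g.N + z.R) := Nat.mul_le_mul_right _ hi
  rw [add_mul, one_mul] at this
  unfold cellAddr
  omega

lemma adjAddr_lt {x j : ℕ} (hx : x < g.N) (hj : j < g.D) : x * g.D + j < g.N * g.D := by
  have : (x + 1) * g.D ≤ g.N * g.D := Nat.mul_le_mul_right _ hx
  rw [add_mul, one_mul] at this
  omega

lemma cellAddr_inj {i j i' j' : ℕ} (hj : j < g.N + z.R) (hj' : j' < g.N + z.R)
    (h : cellAddr g z i j = cellAddr g z i' j') : i = i' ∧ j = j' := by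
  unfold cellAddr at h
  have h1 : i * (g.N + z.R) + j = i' * (g.N + z.R) + j' := by omega
  have hi : i = i' := by
    have e1 := congrArg (· / (g.N + z.R)) h1
    simp only [mul_comm _ (g.N + z.R)] at e1
    rwa [Nat.mul_add_div (by omega), Nat.mul_add_div (by omega), Nat.div_eq_of_lt hj,
      Nat.div_eq_of_lt hj', add_zero, add_zero] at e1
  subst hi
  exact ⟨rfl, by omega⟩

lemma Holds.write {m : ℕ → ℕ} (h : Holds g z A m) {i j : ℕ} (hj : j < g.N + z.R) (v : ℕ) :
    Holds g z (upd A i j v) (Function.update m (cellAddr g z i j) v) where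
  adj := by
    intro x hx k hk
    have := adjAddr_lt hx hk
    refine (Function.update_of_ne ?_ _ _).trans (h.adj x hx k hk)
    unfold cellAddr
    omega
  cell := by
    intro i' hi' j' hj'
    by_cases e : i' = i ∧ j' = j
    · obtain ⟨rfl, rfl⟩ := e
      simp [upd]
    · rw [Function.update_of_ne fun h' => e (cellAddr_inj hj' hj h'), h.cell _ hi' _ hj']
      by_cases e' : i' = i
      · subst e'
        simp only [upd, Function.update_self]
        rw [Function.update_of_ne fun h' => e ⟨rfl, h'⟩]
      · simp only [upd]
        rw [Function.update_of_ne e']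

lemma Params.set (h : Params g z ρ) {d : ℕ} (hd : 4 ≤ d ∧ d < 8 ∨ 12 ≤ d) (v : ℕ) :
    Params g z (Function.update ρ d v) := by
  have : ∀ r, (r < 4 ∨ 8 ≤ r ∧ r < 12) → Function.update ρ d v r = ρ r :=
    fun r hr => Function.update_of_ne (by omega) _ _
  exact ⟨by rw [this 0 (by omega), h.r0], by rw [this 1 (by omega), h.r1],
    by rw [this 2 (by omega), h.r2], by rw [this 3 (by omega), h.r3],
    by rw [this 8 (by omega), h.r8], by rw [this 9 (by omega), h.r9],
    by rw [this 10 (by omega), h.r10], by rw [this 11 (by omega), h.r11]⟩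

lemma Rep.set {s : Store} (h : Rep g z ρ A s) {d : ℕ} (hd : 4 ≤ d ∧ d < 8 ∨ 16 ≤ d) (v : ℕ) :
    Rep g z (Function.update ρ d v) A (s.setReg d v) where
  params := h.params.set (by omega) v
  holds := h.holds
  reg := by
    intro r hr
    simp only [Store.setReg, Function.update_apply]
    split_ifs
    · rfl
    · exact h.reg r hr

lemma Rep.scratch {s : Store} (h : Rep g z ρ A s) {d : ℕ} (hd : 12 ≤ d ∧ d < 16) (v : ℕ) :
    Rep g z ρ A (s.setReg d v) where
  params := h.params
  holds := h.holds
  reg := fun r hr => (Function.update_of_ne (by omega) _ _).trans (h.reg r hr)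

/-- The program `p` halts if it is started when `n` steps have been made, in a store that represents
`ρ` and `A`, and then `Q` holds of the number of steps and what the store represents. -/
def Run (g : Net) (z : Sizes) (p : Prog) (Q : ℕ → (ℕ → ℕ) → (ℕ → ℕ → ℕ) → Prop) (n : ℕ)
    (ρ : ℕ → ℕ) (A : ℕ → ℕ → ℕ) : Prop :=
  ∀ s, Rep g z ρ A s → WP z.w p (fun n s => ∃ ρ A, Rep g z ρ A s ∧ Q n ρ A) n s

section Run

variable {Q Q' : ℕ → (ℕ → ℕ) → (ℕ → ℕ → ℕ) → Prop} {n : ℕ} {p q : Prog}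

lemma Run.mono (h : Run g z p Q n ρ A) (hQ : ∀ n ρ A, Params g z ρ → Q n ρ A → Q' n ρ A) :
    Run g z p Q' n ρ A := fun s hs =>
  (h s hs).mono fun _ _ ⟨ρ, A, h1, h2⟩ => ⟨ρ, A, h1, hQ _ _ _ h1.params h2⟩

lemma Run.of_params (h : Params g z ρ → Run g z p Q n ρ A) : Run g z p Q n ρ A :=
  fun s hs => h hs.params s hs

lemma Run.seq (h : Run g z p (fun n ρ A => Run g z q Q n ρ A) (n + 1) ρ A) :
    Run g z (.seq p q) Q n ρ A := fun s hs =>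
  .seq ((h s hs).mono fun _ s' ⟨_, _, h1, h2⟩ => h2 s' h1)

lemma Run.skip (h : Q (n + 1) ρ A) : Run g z .skip Q n ρ A :=
  fun _ hs => .skip ⟨_, _, hs, h⟩

lemma Run.ite_lt {a b : ℕ} (ha : a < 12 ∨ 16 ≤ a) (hb : b < 12 ∨ 16 ≤ b)
    (h1 : ρ a < ρ b → Run g z p Q (n + 1) ρ A) (h2 : ρ b ≤ ρ a → Run g z q Q (n + 1) ρ A) :
    Run g z (.ite (.lt a b) p q) Q n ρ A := by
  intro s hs
  rw [← hs.reg a ha, ← hs.reg b hb] at h1 h2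
  exact .ite (fun h => h1 (by simpa [Test.eval] using h) s hs)
    (fun h => h2 (by simpa [Test.eval] using h) s hs)

lemma Run.ite_eq {a b : ℕ} (ha : a < 12 ∨ 16 ≤ a) (hb : b < 12 ∨ 16 ≤ b)
    (h1 : ρ a = ρ b → Run g z p Q (n + 1) ρ A) (h2 : ρ a ≠ ρ b → Run g z q Q (n + 1) ρ A) :
    Run g z (.ite (.eq a b) p q) Q n ρ A := by
  intro s hs
  rw [← hs.reg a ha, ← hs.reg b hb] at h1 h2
  exact .ite (fun h => h1 (by simpa [Test.eval] using h) s hs)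
    (fun h => h2 (by simpa [Test.eval] using h) s hs)

lemma Run.loop_lt (I : ℕ → ℕ → (ℕ → ℕ) → (ℕ → ℕ → ℕ) → Prop) (m : ℕ) {a b : ℕ}
    (ha : a < 12 ∨ 16 ≤ a) (hb : b < 12 ∨ 16 ≤ b) (h0 : I 0 n ρ A)
    (h1 : ∀ i < m, ∀ n ρ A, I i n ρ A → ρ a < ρ b ∧ Run g z p (I (i + 1)) (n + 1) ρ A)
    (h2 : ∀ n ρ A, I m n ρ A → ρ b ≤ ρ a ∧ Q (n + 1) ρ A) :
    Run g z (.loop (.lt a b) p) Q n ρ A := by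
  intro s hs
  refine .loop (fun i n s => ∃ ρ A, Rep g z ρ A s ∧ I i n ρ A) m ⟨ρ, A, hs, h0⟩ ?_ ?_
  · rintro i hi n s ⟨ρ, A, hs, h⟩
    obtain ⟨h3, h4⟩ := h1 i hi n ρ A h
    rw [← hs.reg a ha, ← hs.reg b hb] at h3
    exact ⟨by simpa [Test.eval] using h3, h4 s hs⟩
  · rintro n s ⟨ρ, A, hs, h⟩
    obtain ⟨h3, h4⟩ := h2 n ρ A h
    rw [← hs.reg a ha, ← hs.reg b hb] at h3
    exact ⟨by simpa [Test.eval] using h3, ρ, A, hs, h4⟩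

variable {d a b c : ℕ}

lemma Run.setReg {i : Instr} {v : ℕ} (hd : 4 ≤ d ∧ d < 8 ∨ 16 ≤ d)
    (hi : ∀ s, Rep g z ρ A s → i.exec z.w s = s.setReg d v)
    (h : Q (n + 1) (Function.update ρ d v) A) : Run g z (.instr i) Q n ρ A := by
  intro s hs
  refine WP.instr ?_
  rw [hi s hs]
  exact ⟨_, _, hs.set hd v, h⟩

lemma Run.const (hd : 4 ≤ d ∧ d < 8 ∨ 16 ≤ d) (hc : c < 2 ^ z.w)
    (h : Q (n + 1) (Function.update ρ d c) A) : Run g z (.instr (.const d c)) Q n ρ A :=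
  Run.setReg hd (fun s _ => by simp only [Instr.exec, Nat.mod_eq_of_lt hc]) h

lemma Run.move (hd : 4 ≤ d ∧ d < 8 ∨ 16 ≤ d) (ha : a < 12 ∨ 16 ≤ a)
    (h : Q (n + 1) (Function.update ρ d (ρ a)) A) : Run g z (.instr (.move d a)) Q n ρ A :=
  Run.setReg hd (fun s hs => by simp only [Instr.exec, hs.reg a ha]) h

lemma Run.add (hd : 4 ≤ d ∧ d < 8 ∨ 16 ≤ d) (ha : a < 12 ∨ 16 ≤ a) (hb : b < 12 ∨ 16 ≤ b)
    (hv : ρ a + ρ b < 2 ^ z.w)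
    (h : Q (n + 1) (Function.update ρ d (ρ a + ρ b)) A) : Run g z (.instr (.add d a b)) Q n ρ A :=
  Run.setReg hd
    (fun s hs => by simp only [Instr.exec, hs.reg a ha, hs.reg b hb, Nat.mod_eq_of_lt hv]) h

lemma Run.sub (hd : 4 ≤ d ∧ d < 8 ∨ 16 ≤ d) (ha : a < 12 ∨ 16 ≤ a) (hb : b < 12 ∨ 16 ≤ b)
    (h : Q (n + 1) (Function.update ρ d (ρ a - ρ b)) A) : Run g z (.instr (.sub d a b)) Q n ρ A :=
  Run.setReg hd (fun s hs => by simp only [Instr.exec, hs.reg a ha, hs.reg b hb]) h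

lemma Run.mul (hd : 4 ≤ d ∧ d < 8 ∨ 16 ≤ d) (ha : a < 12 ∨ 16 ≤ a) (hb : b < 12 ∨ 16 ≤ b)
    (hv : ρ a * ρ b < 2 ^ z.w)
    (h : Q (n + 1) (Function.update ρ d (ρ a * ρ b)) A) : Run g z (.instr (.mul d a b)) Q n ρ A :=
  Run.setReg hd
    (fun s hs => by simp only [Instr.exec, hs.reg a ha, hs.reg b hb, Nat.mod_eq_of_lt hv]) h

lemma Run.div (hd : 4 ≤ d ∧ d < 8 ∨ 16 ≤ d) (ha : a < 12 ∨ 16 ≤ a) (hb : b < 12 ∨ 16 ≤ b)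
    (h : Q (n + 1) (Function.update ρ d (ρ a / ρ b)) A) : Run g z (.instr (.div d a b)) Q n ρ A :=
  Run.setReg hd (fun s hs => by simp only [Instr.exec, hs.reg a ha, hs.reg b hb]) h

lemma Run.mod (hd : 4 ≤ d ∧ d < 8 ∨ 16 ≤ d) (ha : a < 12 ∨ 16 ≤ a) (hb : b < 12 ∨ 16 ≤ b)
    (h : Q (n + 1) (Function.update ρ d (ρ a % ρ b)) A) : Run g z (.instr (.mod d a b)) Q n ρ A :=
  Run.setReg hd (fun s hs => by simp only [Instr.exec, hs.reg a ha, hs.reg b hb]) h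

end Run

/-! ### Access to the table and to the graph -/

/-- Compute the address of the entry in row `i` and column `j` (given by registers). -/
def addrOf (i j : ℕ) : Prog :=
  .seq (.instr (.mul 12 i 11)) (.seq (.instr (.add 12 12 10)) (.instr (.add 12 12 j)))

/-- Read the entry in row `i` and column `j` (given by registers) into register `d`. -/
def rdr (d i j : ℕ) : Prog := .seq (addrOf i j) (.instr (.load d 12))

/-- Write register `v` to the entry in row `i` and column `j` (given by registers). -/
def wrr (i j v : ℕ) : Prog := .seq (addrOf i j) (.instr (.store 12 v))

/-- Read the entry in row `k` (a constant) and column `j` into register `d`. -/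
def rdc (d k j : ℕ) : Prog := .seq (.instr (.const 13 k)) (rdr d 13 j)

/-- Write register `v` to the entry in row `k` (a constant) and column `j`. -/
def wrc (k j v : ℕ) : Prog := .seq (.instr (.const 13 k)) (wrr 13 j v)

/-- Read neighbour number `j` (in register `16`) of the left node in register `30`. -/
def nbr : Prog :=
  .seq (.instr (.mul 12 30 1)) (.seq (.instr (.add 12 12 16)) (.instr (.load 17 12)))

section Access

variable {Q : ℕ → (ℕ → ℕ) → (ℕ → ℕ → ℕ) → Prop} {n d i j v k : ℕ}

lemma Rep.addrOf {s : Store} (hf : Fits g z) (hs : Rep g z ρ A s)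
    {Q : ℕ → Store → Prop} (hj : j < 12 ∨ 16 ≤ j)
    (hi' : s.reg i < z.rows) (hj' : ρ j < g.N + z.R)
    (h : ∀ s', Rep g z ρ A s' → (∀ r, r ≠ 12 → s'.reg r = s.reg r) →
      s'.reg 12 = cellAddr g z (s.reg i) (ρ j) → Q (n + 5) s') :
    WP z.w (addrOf i j) Q n s := by
  have h1 : cellAddr g z (s.reg i) (ρ j) < 2 ^ z.w := hf.cellAddr_lt hi' hj'
  have h2 := hs.params.r10
  have h3 := hs.params.r11
  rw [← hs.reg _ (by omega)] at h2 h3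
  have h4 := hs.reg j hj
  have hj12 : j ≠ 12 := by omega
  rw [cellAddr] at h1
  refine .seq (.instr (.seq (.instr (.instr ?_))))
  simp only [Instr.exec]
  refine h _ (((hs.scratch (by omega) _).scratch (by omega) _).scratch (by omega) _) ?_ ?_
  · intro r hr
    simp [Store.setReg, Function.update_of_ne hr]
  · simp [Store.setReg, Function.update_of_ne hj12, cellAddr, h2, h3, h4]
    rw [Nat.mod_eq_of_lt, add_comm (s.reg i * _)]
    omega

lemma Rep.rdr {s : Store} (hf : Fits g z) (hs : Rep g z ρ A s) (hd : 4 ≤ d ∧ d < 8 ∨ 16 ≤ d)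
    (hj : j < 12 ∨ 16 ≤ j) (hi' : s.reg i < z.rows) (hj' : ρ j < g.N + z.R)
    (h : Q (n + 7) (Function.update ρ d (A (s.reg i) (ρ j))) A) :
    WP z.w (rdr d i j) (fun n s => ∃ ρ A, Rep g z ρ A s ∧ Q n ρ A) n s := by
  refine .seq (hs.addrOf hf hj hi' hj' fun s' hs' _ h12 => .instr ⟨_, _, ?_, h⟩)
  rw [← hs'.holds.cell _ hi' _ hj', ← h12]
  exact hs'.set hd _

lemma Rep.wrr {s : Store} (hf : Fits g z) (hs : Rep g z ρ A s) (hv : v < 12 ∨ 16 ≤ v)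
    (hj : j < 12 ∨ 16 ≤ j) (hi' : s.reg i < z.rows) (hj' : ρ j < g.N + z.R)
    (h : Q (n + 7) ρ (upd A (s.reg i) (ρ j) (ρ v))) :
    WP z.w (wrr i j v) (fun n s => ∃ ρ A, Rep g z ρ A s ∧ Q n ρ A) n s := by
  refine .seq (hs.addrOf hf hj hi' hj' fun s' hs' _ h12 => .instr ⟨_, _, ?_, h⟩)
  simp only [Instr.exec]
  rw [h12, hs'.reg v hv]
  exact ⟨hs'.params, hs'.holds.write hj' _, hs'.reg⟩

lemma Run.rdr (hf : Fits g z) (hd : 4 ≤ d ∧ d < 8 ∨ 16 ≤ d) (hi : i < 12 ∨ 16 ≤ i)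
    (hj : j < 12 ∨ 16 ≤ j) (hi' : ρ i < z.rows) (hj' : ρ j < g.N + z.R)
    (h : Q (n + 7) (Function.update ρ d (A (ρ i) (ρ j))) A) : Run g z (rdr d i j) Q n ρ A := by
  intro s hs
  rw [← hs.reg i hi] at hi' h
  exact hs.rdr hf hd hj hi' hj' h

lemma Run.wrr (hf : Fits g z) (hv : v < 12 ∨ 16 ≤ v) (hi : i < 12 ∨ 16 ≤ i)
    (hj : j < 12 ∨ 16 ≤ j) (hi' : ρ i < z.rows) (hj' : ρ j < g.N + z.R)
    (h : Q (n + 7) ρ (upd A (ρ i) (ρ j) (ρ v))) : Run g z (wrr i j v) Q n ρ A := by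
  intro s hs
  rw [← hs.reg i hi] at hi' h
  exact hs.wrr hf hv hj hi' hj' h

/-- A row number fits into a word because the address of a cell in that row does. -/
lemma const_reg (hf : Fits g z) (hk : k < z.rows) (hN : 0 < g.N + z.R) (s : Store) :
    ((Instr.const 13 k).exec z.w s).reg 13 = k := by
  have := hf.cellAddr_lt hk hN
  have h1 : k * 1 ≤ k * (g.N + z.R) := Nat.mul_le_mul_left _ hN
  unfold cellAddr at this
  simp only [Instr.exec, Store.setReg, Function.update_self]
  exact Nat.mod_eq_of_lt (by omega)

lemma Run.rdc (hf : Fits g z) (hd : 4 ≤ d ∧ d < 8 ∨ 16 ≤ d) (hk : k < z.rows)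
    (hj : j < 12 ∨ 16 ≤ j) (hj' : ρ j < g.N + z.R)
    (h : Q (n + 9) (Function.update ρ d (A k (ρ j))) A) : Run g z (rdc d k j) Q n ρ A := by
  intro s hs
  have hc := const_reg hf hk (by omega) s
  refine .seq (.instr ?_)
  refine Rep.rdr hf (ρ := ρ) (A := A) (hs.scratch (by omega) _) hd hj (by rwa [hc]) hj' ?_
  rwa [hc]

lemma Run.wrc (hf : Fits g z) (hv : v < 12 ∨ 16 ≤ v) (hk : k < z.rows)
    (hj : j < 12 ∨ 16 ≤ j) (hj' : ρ j < g.N + z.R)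
    (h : Q (n + 9) ρ (upd A k (ρ j) (ρ v))) : Run g z (wrc k j v) Q n ρ A := by
  intro s hs
  have hc := const_reg hf hk (by omega) s
  refine .seq (.instr ?_)
  refine Rep.wrr hf (ρ := ρ) (A := A) (hs.scratch (by omega) _) hv hj (by rwa [hc]) hj' ?_
  rwa [hc]

lemma Run.nbr (hf : Fits g z) (hx : ρ 30 < g.N) (hj : ρ 16 < g.D)
    (h : Q (n + 5) (Function.update ρ 17 (g.nb (ρ 30) (ρ 16))) A) : Run g z nbr Q n ρ A := by
  intro s hs
  have h1 := adjAddr_lt hx hj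
  have h2 := hf.addr
  have h3 := hs.params.r1
  have h4 := hs.holds.adj _ hx _ hj
  rw [← hs.reg 1 (by omega)] at h3
  rw [← hs.reg 30 (by omega), ← hs.reg 16 (by omega)] at h1 h4 h
  refine .seq (.instr (.seq (.instr (.instr ?_))))
  refine ⟨_, _, ?_, h⟩
  have e : (s.reg 30 * g.D % 2 ^ z.w + s.reg 16) % 2 ^ z.w = s.reg 30 * g.D + s.reg 16 := by
    rw [Nat.mod_add_mod, Nat.mod_eq_of_lt (by omega)]
  have h5 := (((hs.scratch (d := 12) (by omega) (s.reg 30 * g.D + s.reg 16)).set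
    (d := 17) (by omega) (g.nb (s.reg 30) (s.reg 16))))
  convert h5 using 1
  simp only [Instr.exec, Store.setReg, Function.update_self, h3, Function.update_idem, e, h4,
    Function.update_of_ne (show (16 : ℕ) ≠ 12 by omega)]

end Access

end DynMatch

/-! ### Loops over a neighbourhood, and the table that represents a state. -/

namespace DynMatch

open Finset

/-- Programs one after the other. -/
def seqs : List Prog → Prog
  | [] => .skip
  | p :: ps => .seq p (seqs ps)

/-- `ρ'` agrees with `ρ` in all registers but the scratch registers `16` to `29`. -/
def Fr (ρ ρ' : ℕ → ℕ) : Prop := ∀ r, (r < 16 ∨ 30 ≤ r) → ρ' r = ρ r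

lemma Fr.refl (ρ : ℕ → ℕ) : Fr ρ ρ := fun _ _ => rfl

lemma Fr.set {ρ ρ' : ℕ → ℕ} (h : Fr ρ ρ') {d : ℕ} (hd : 16 ≤ d ∧ d < 30) (v : ℕ) :
    Fr ρ (Function.update ρ' d v) :=
  fun r hr => (Function.update_of_ne (by omega) _ _).trans (h r hr)

/-- Run `body` for all neighbours of the left node in register `30`, which it finds in
register `17`. -/
def forD (body : Prog) : Prog :=
  seqs [.instr (.const 16 0),
    .loop (.lt 16 1) (seqs [nbr, body, .instr (.add 16 16 8)])]

variable {g : Net} {z : Sizes} {A : ℕ → ℕ → ℕ} {ρ : ℕ → ℕ}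
  {Q Q' : ℕ → (ℕ → ℕ) → (ℕ → ℕ → ℕ) → Prop} {n : ℕ}

lemma Run.cons {p : Prog} {ps : List Prog}
    (h : Run g z p (fun n ρ A => Run g z (seqs ps) Q n ρ A) (n + 1) ρ A) :
    Run g z (seqs (p :: ps)) Q n ρ A := Run.seq h

lemma Run.nil (h : Q (n + 1) ρ A) : Run g z (seqs []) Q n ρ A := Run.skip h

/-- The loop invariant may speak only of the counter, of registers `23` and `24`, where searches
keep their results, and of the table; the other scratch registers may change freely. -/
lemma Run.forD (hf : Fits g z) {body : Prog} (I : ℕ → ℕ → ℕ → (ℕ → ℕ → ℕ) → Prop) (τ : ℕ)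
    (hx : ρ 30 < g.N) (h0 : I 0 (ρ 23) (ρ 24) A)
    (hb : ∀ j < g.D, ∀ n ρ' A', Params g z ρ' → Fr ρ ρ' → ρ' 16 = j → ρ' 17 = g.nb (ρ 30) j →
      I j (ρ' 23) (ρ' 24) A' → Run g z body (fun n' ρ'' A'' => n' ≤ n + τ ∧ Fr ρ ρ'' ∧
        ρ'' 16 = j ∧ I (j + 1) (ρ'' 23) (ρ'' 24) A'') n ρ' A')
    (hQ : ∀ n' ρ' A', Params g z ρ' → n' ≤ n + (τ + 20) * g.D + 10 → Fr ρ ρ' →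
      I g.D (ρ' 23) (ρ' 24) A' → Q n' ρ' A') : Run g z (forD body) Q n ρ A := by
  have hD := hf.deg
  refine .of_params fun hp => ?_
  refine .cons (.const (by decide) (by have := hf.const; omega) (.cons ?_))
  refine Run.loop_lt (fun j n' ρ' A' => Params g z ρ' ∧ n' ≤ n + (τ + 20) * j + 5 ∧ Fr ρ ρ' ∧
    ρ' 16 = j ∧ I j (ρ' 23) (ρ' 24) A') g.D (by decide) (by decide) ?_ ?_ ?_
  · exact ⟨hp.set (by omega) _, by omega, (Fr.refl ρ).set (by omega) _, by simp, by simpa using h0⟩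
  · rintro j hj n' ρ' A' ⟨hp, hn, hfr, h16, hI⟩
    have h30 := hfr 30 (by omega)
    refine ⟨by rw [h16, hp.r1]; exact hj, .cons (.nbr hf (by omega) (by omega) (.cons ?_))⟩
    refine (hb j hj _ _ A' (hp.set (by omega) _) (hfr.set (by omega) _) ?_ ?_ ?_).mono ?_
    · simpa using h16
    · simp [h30, h16]
    · simpa using hI
    · rintro n'' ρ'' A'' hp'' ⟨hn'', hfr'', h16'', hI''⟩
      refine .cons (.add (by decide) (by decide) (by decide) (by rw [h16'', hp''.r8]; omega)
        (.nil ⟨hp''.set (by omega) _, ?_, hfr''.set (by omega) _, ?_, ?_⟩))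
      · rw [mul_add, mul_one]
        omega
      · simp [h16'', hp''.r8]
      · simpa using hI''
  · rintro n' ρ' A' ⟨hp, hn, hfr, h16, hI⟩
    exact ⟨by rw [h16, hp.r1], .nil (hQ _ _ _ hp (by omega) hfr hI)⟩

/-! ### The table of a state -/

/-- The indicator function of a finite set. -/
def ind (Y : Finset ℕ) (y : ℕ) : ℕ := if y ∈ Y then 1 else 0

lemma ind_eq_one {Y : Finset ℕ} {y : ℕ} : ind Y y = 1 ↔ y ∈ Y := by simp [ind]

lemma ind_eq_zero {Y : Finset ℕ} {y : ℕ} : ind Y y = 0 ↔ y ∉ Y := by simp [ind]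

lemma ind_le_one (Y : Finset ℕ) (y : ℕ) : ind Y y ≤ 1 := by
  unfold ind
  split_ifs <;> omega

lemma update_ind_one (Y : Finset ℕ) (y : ℕ) :
    Function.update (ind Y) y 1 = ind (insert y Y) := by
  funext x
  by_cases h : x = y <;> simp [ind, h]

lemma update_ind_zero (Y : Finset ℕ) (y : ℕ) :
    Function.update (ind Y) y 0 = ind (Y.erase y) := by
  funext x
  by_cases h : x = y <;> simp [ind, h]

/-- Change a row of a table to `v` on the set `Y`. -/
def fill (f : ℕ → ℕ) (Y : Finset ℕ) (v : ℕ → ℕ) (y : ℕ) : ℕ := if y ∈ Y then v y else f y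

lemma fill_empty (f : ℕ → ℕ) (v : ℕ → ℕ) : fill f ∅ v = f := by
  funext y
  simp [fill]

lemma fill_insert (f : ℕ → ℕ) (Y : Finset ℕ) (v : ℕ → ℕ) (y : ℕ) :
    fill f (insert y Y) v = Function.update (fill f Y v) y (v y) := by
  funext x
  by_cases h : x = y <;> simp [fill, h]

lemma fill_ind_one (Y Y' : Finset ℕ) : fill (ind Y) Y' (fun _ => 1) = ind (Y ∪ Y') := by
  funext x
  by_cases h : x ∈ Y' <;> simp [fill, ind, h]

lemma fill_ind_zero (Y Y' : Finset ℕ) : fill (ind Y) Y' (fun _ => 0) = ind (Y \ Y') := by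
  funext x
  by_cases h : x ∈ Y' <;> simp [fill, ind, h]

/-- The table `A` represents the state `s`. -/
structure Tab (g : Net) (s : St) (A : ℕ → ℕ → ℕ) : Prop where
  hl : A 0 = s.lay.hl
  hy : A 1 = s.lay.hy
  act : A 2 = ind s.lay.act
  inr : A 3 = ind s.lay.inr
  S : A 4 = ind s.S
  E : A 5 = ind s.E
  ptr : A 6 = s.lay.ptr g
  T : ∀ c < 2, A (8 + 4 * c) = ind (s.cp c).T
  F : ∀ c < 2, A (9 + 4 * c) = ind (s.cp c).F
  cnt : ∀ c < 2, A (10 + 4 * c) = (s.cp c).cnt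
  pl : ∀ c < 2, A (11 + 4 * c) = (s.cp c).pl
  occ : ∀ k, A (16 + 2 * k) = ind (s.lay.occ k)
  ring : ∀ k, A (17 + 2 * k) = s.lay.ring k

namespace Tab

variable {s : St}

lemma setHl (h : Tab g s A) (f : ℕ → ℕ) :
    Tab g { s with lay := { s.lay with hl := f } } (Function.update A 0 f) := by
  constructor
  case hl => exact Function.update_self _ _ _
  all_goals
    intros
    rw [Function.update_of_ne (by omega)]
    first
      | exact h.hl | exact h.hy | exact h.act | exact h.inr | exact h.S | exact h.E | exact h.ptr
      | exact h.T _ ‹_› | exact h.F _ ‹_› | exact h.cnt _ ‹_› | exact h.pl _ ‹_›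
      | exact h.occ _ | exact h.ring _

lemma setHy (h : Tab g s A) (f : ℕ → ℕ) :
    Tab g { s with lay := { s.lay with hy := f } } (Function.update A 1 f) := by
  constructor
  case hy => exact Function.update_self _ _ _
  all_goals
    intros
    rw [Function.update_of_ne (by omega)]
    first
      | exact h.hl | exact h.hy | exact h.act | exact h.inr | exact h.S | exact h.E | exact h.ptr
      | exact h.T _ ‹_› | exact h.F _ ‹_› | exact h.cnt _ ‹_› | exact h.pl _ ‹_›
      | exact h.occ _ | exact h.ring _

lemma setAct (h : Tab g s A) (Y : Finset ℕ) :
    Tab g { s with lay := { s.lay with act := Y } } (Function.update A 2 (ind Y)) := by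
  constructor
  case act => exact Function.update_self _ _ _
  all_goals
    intros
    rw [Function.update_of_ne (by omega)]
    first
      | exact h.hl | exact h.hy | exact h.act | exact h.inr | exact h.S | exact h.E | exact h.ptr
      | exact h.T _ ‹_› | exact h.F _ ‹_› | exact h.cnt _ ‹_› | exact h.pl _ ‹_›
      | exact h.occ _ | exact h.ring _

lemma setInr (h : Tab g s A) (Y : Finset ℕ) :
    Tab g { s with lay := { s.lay with inr := Y } } (Function.update A 3 (ind Y)) := by
  constructor
  case inr => exact Function.update_self _ _ _
  all_goals
    intros
    rw [Function.update_of_ne (by omega)]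
    first
      | exact h.hl | exact h.hy | exact h.act | exact h.inr | exact h.S | exact h.E | exact h.ptr
      | exact h.T _ ‹_› | exact h.F _ ‹_› | exact h.cnt _ ‹_› | exact h.pl _ ‹_›
      | exact h.occ _ | exact h.ring _

lemma setS (h : Tab g s A) (Y : Finset ℕ) :
    Tab g { s with S := Y } (Function.update A 4 (ind Y)) := by
  constructor
  case S => exact Function.update_self _ _ _
  all_goals
    intros
    rw [Function.update_of_ne (by omega)]
    first
      | exact h.hl | exact h.hy | exact h.act | exact h.inr | exact h.S | exact h.E | exact h.ptr
      | exact h.T _ ‹_› | exact h.F _ ‹_› | exact h.cnt _ ‹_› | exact h.pl _ ‹_›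
      | exact h.occ _ | exact h.ring _

lemma setE (h : Tab g s A) (Y : Finset ℕ) :
    Tab g { s with E := Y } (Function.update A 5 (ind Y)) := by
  constructor
  case E => exact Function.update_self _ _ _
  all_goals
    intros
    rw [Function.update_of_ne (by omega)]
    first
      | exact h.hl | exact h.hy | exact h.act | exact h.inr | exact h.S | exact h.E | exact h.ptr
      | exact h.T _ ‹_› | exact h.F _ ‹_› | exact h.cnt _ ‹_› | exact h.pl _ ‹_›
      | exact h.occ _ | exact h.ring _

lemma setOcc (h : Tab g s A) (k : ℕ) (Y : Finset ℕ) :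
    Tab g { s with lay := { s.lay with occ := Function.update s.lay.occ k Y } }
      (Function.update A (16 + 2 * k) (ind Y)) := by
  constructor
  case occ =>
    intro k'
    by_cases e : k' = k
    · subst e
      simp
    · rw [Function.update_of_ne (by omega), h.occ]
      simp [e]
  all_goals
    intros
    rw [Function.update_of_ne (by omega)]
    first
      | exact h.hl | exact h.hy | exact h.act | exact h.inr | exact h.S | exact h.E | exact h.ptr
      | exact h.T _ ‹_› | exact h.F _ ‹_› | exact h.cnt _ ‹_› | exact h.pl _ ‹_›
      | exact h.ring _

lemma setRing (h : Tab g s A) (k : ℕ) (f : ℕ → ℕ) :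
    Tab g { s with lay := { s.lay with ring := Function.update s.lay.ring k f } }
      (Function.update A (17 + 2 * k) f) := by
  constructor
  case ring =>
    intro k'
    by_cases e : k' = k
    · subst e
      simp
    · rw [Function.update_of_ne (by omega), h.ring]
      simp [e]
  all_goals
    intros
    rw [Function.update_of_ne (by omega)]
    first
      | exact h.hl | exact h.hy | exact h.act | exact h.inr | exact h.S | exact h.E | exact h.ptr
      | exact h.T _ ‹_› | exact h.F _ ‹_› | exact h.cnt _ ‹_› | exact h.pl _ ‹_›
      | exact h.occ _

lemma setCopy (h : Tab g s A) {c : ℕ} {C : Net.Copy} {B : ℕ → ℕ → ℕ}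
    (hB : ∀ i, (i < 8 + 4 * c ∨ 12 + 4 * c ≤ i) → B i = A i) (hT : B (8 + 4 * c) = ind C.T)
    (hF : B (9 + 4 * c) = ind C.F) (hcnt : B (10 + 4 * c) = C.cnt) (hpl : B (11 + 4 * c) = C.pl)
    (hc : c < 2) : Tab g { s with cp := Function.update s.cp c C } B := by
  constructor
  case T | F | cnt | pl =>
    intro c' hc'
    by_cases e : c' = c
    · subst e
      simpa
    · rw [hB _ (by omega)]
      first
        | simpa [e] using h.T c' hc'
        | simpa [e] using h.F c' hc'
        | simpa [e] using h.cnt c' hc'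
        | simpa [e] using h.pl c' hc'
  all_goals
    intros
    rw [hB _ (by omega)]
    first
      | exact h.hl | exact h.hy | exact h.act | exact h.inr | exact h.S | exact h.E | exact h.ptr
      | exact h.occ _ | exact h.ring _

/-- The counters `nh` and `arr` have no rows, but the pointers depend on `nh`. So a change of the
counters shows in the table only as a rewriting of row `6`. -/
lemma setPtr {s' : St} (h : Tab g s A) (hl : s'.lay.hl = s.lay.hl) (hy : s'.lay.hy = s.lay.hy)
    (act : s'.lay.act = s.lay.act) (inr : s'.lay.inr = s.lay.inr) (occ : s'.lay.occ = s.lay.occ)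
    (ring : s'.lay.ring = s.lay.ring) (hcp : s'.cp = s.cp) (hS : s'.S = s.S) (hE : s'.E = s.E) :
    Tab g s' (Function.update A 6 (s'.lay.ptr g)) := by
  constructor
  case ptr => exact Function.update_self _ _ _
  all_goals
    intros
    rw [Function.update_of_ne (by omega)]
    simp only [hl, hy, act, inr, occ, ring, hcp, hS, hE]
    apply_rules [h.hl, h.hy, h.act, h.inr, h.S, h.E, h.T, h.F, h.cnt, h.pl, h.occ, h.ring]

lemma setRem (h : Tab g s A) (r : ℕ) : Tab g { s with rem := r } A := { h with }

end Tab

end DynMatch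

/-! ### Searching, counting and writing over a neighbourhood. -/

namespace DynMatch

open Finset

variable {g : Net} {z : Sizes} {A : ℕ → ℕ → ℕ} {ρ : ℕ → ℕ}
  {Q : ℕ → (ℕ → ℕ) → (ℕ → ℕ → ℕ) → Prop} {n : ℕ}

lemma mem_nbrs {x y : ℕ} : y ∈ g.nbrs x ↔ ∃ j < g.D, g.nb x j = y := by
  simp [Net.nbrs]

lemma Fits.nbrs_lt (hf : Fits g z) {x y : ℕ} (hx : x < g.N) (hy : y ∈ g.nbrs x) : y < z.R := by
  obtain ⟨j, hj, rfl⟩ := mem_nbrs.1 hy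
  exact hf.nb x hx j hj

/-- Search a neighbour of the left node in register `30` with the entry `0` in the row whose number
is in register `33`. Register `23` tells whether there is one, register `24` is the neighbour. -/
def findFree : Prog :=
  seqs [.instr (.const 23 0), forD (seqs [rdr 18 33 17,
    .ite (.eq 18 9) (seqs [.instr (.move 23 8), .instr (.move 24 17)]) .skip])]

lemma Run.findFree (hf : Fits g z) (hx : ρ 30 < g.N) (h33 : ρ 33 < z.rows)
    (hQ : ∀ n' ρ', n' ≤ n + 40 * g.D + 15 → Fr ρ ρ' →
      (ρ' 23 = 1 ∧ ρ' 24 ∈ g.nbrs (ρ 30) ∧ A (ρ 33) (ρ' 24) = 0 ∨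
        ρ' 23 = 0 ∧ ∀ y ∈ g.nbrs (ρ 30), A (ρ 33) y ≠ 0) → Q n' ρ' A) :
    Run g z findFree Q n ρ A := by
  have h0 := hf.const
  refine .cons (.const (by decide) (by omega) (.cons ?_))
  refine .forD hf (fun j a b A' => A' = A ∧ (a = 1 ∧ b ∈ g.nbrs (ρ 30) ∧ A (ρ 33) b = 0 ∨
    a = 0 ∧ ∀ i < j, A (ρ 33) (g.nb (ρ 30) i) ≠ 0)) 16 (by simpa using hx)
    ⟨rfl, Or.inr ⟨by simp, by simp⟩⟩ ?_ ?_
  · rintro j hj n' ρ' A' hp hfr h16 h17 ⟨rfl, hI⟩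
    have h30 := hfr 30 (by omega)
    have h33' := hfr 33 (by omega)
    simp at h30 h33' h17
    have hnb := hf.nb _ hx j hj
    rw [← h17] at hnb
    refine .cons (.rdr hf (by decide) (by decide) (by decide) (by omega) (by omega) (.cons ?_))
    refine .ite_eq (by decide) (by decide) (fun h1 => ?_) fun h1 => ?_
    · refine .cons (.move (by decide) (by decide) (.cons (.move (by decide) (by decide)
        (.nil (.nil ⟨by omega, ?_, by simpa, rfl, Or.inl ⟨?_, ?_, ?_⟩⟩)))))
      · exact ((hfr.set (by omega) _).set (by omega) _).set (by omega) _
      · simp [hp.r8]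
      · simpa [h17, mem_nbrs] using ⟨j, hj, rfl⟩
      · simpa [hp.r9, h33'] using h1
    · refine .skip (.nil ⟨by omega, hfr.set (by omega) _, by simpa, rfl, ?_⟩)
      simp [hp.r9, h33', h17] at h1 ⊢
      rcases hI with hI | hI
      · exact Or.inl hI
      · refine Or.inr ⟨hI.1, fun i hi => ?_⟩
        rcases Nat.le_iff_lt_or_eq.1 hi with hi | rfl
        · exact hI.2 i hi
        · exact h1
  · rintro n' ρ' A' hp hn hfr ⟨rfl, hI⟩
    refine .nil (hQ _ _ (by omega) (fun r hr => (hfr r hr).trans ?_) ?_)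
    · exact Function.update_of_ne (by omega) _ _
    · refine hI.imp_right (And.imp_right fun h y hy => ?_)
      obtain ⟨j, hj, rfl⟩ := mem_nbrs.1 hy
      exact h j hj

/-- Select a neighbour of the left node in register `30` with the entry `0` in the row whose number
is in register `42`, of smallest entry in the row whose number is in register `43`. Register `24` is
the neighbour and register `23` the entry. -/
def findMin : Prog :=
  seqs [.instr (.move 23 11), forD (seqs [rdr 18 42 17,
    .ite (.eq 18 9) (seqs [rdr 18 43 17,
      .ite (.lt 18 23) (seqs [.instr (.move 23 18), .instr (.move 24 17)]) .skip]) .skip])]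

lemma Run.findMin (hf : Fits g z) (hx : ρ 30 < g.N) (h42 : ρ 42 < z.rows) (h43 : ρ 43 < z.rows)
    (hfree : ∃ y ∈ g.nbrs (ρ 30), A (ρ 42) y = 0)
    (hcnt : ∀ y ∈ g.nbrs (ρ 30), A (ρ 42) y = 0 → A (ρ 43) y < g.N + z.R)
    (hQ : ∀ n' ρ', n' ≤ n + 55 * g.D + 15 → Fr ρ ρ' →
      ρ' 24 ∈ g.nbrs (ρ 30) → A (ρ 42) (ρ' 24) = 0 →
      (∀ y ∈ g.nbrs (ρ 30), A (ρ 42) y = 0 → A (ρ 43) (ρ' 24) ≤ A (ρ 43) y) →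
      ρ' 23 = A (ρ 43) (ρ' 24) → Q n' ρ' A) :
    Run g z findMin Q n ρ A := by
  have h0 := hf.const
  -- Register `11` holds `N + R`, which serves as infinity: all counters of allowed neighbours are
  -- smaller.
  refine .of_params fun hp => .cons (.move (by decide) (by decide) (.cons ?_))
  refine .forD hf (fun j a b A' => A' = A ∧
    (∀ i < j, A (ρ 42) (g.nb (ρ 30) i) = 0 → a ≤ A (ρ 43) (g.nb (ρ 30) i)) ∧
    (a = g.N + z.R ∨ b ∈ g.nbrs (ρ 30) ∧ A (ρ 42) b = 0 ∧ a = A (ρ 43) b)) 31 (by simpa using hx)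
    ⟨rfl, by simp, Or.inl (by simp [hp.r11])⟩ ?_ ?_
  · rintro j hj n' ρ' A' hp hfr h16 h17 ⟨rfl, hI, hJ⟩
    have h30 := hfr 30 (by omega)
    have h42' := hfr 42 (by omega)
    have h43' := hfr 43 (by omega)
    simp at h30 h42' h43' h17
    have hnb := hf.nb _ hx j hj
    rw [← h17] at hnb
    refine .cons (.rdr hf (by decide) (by decide) (by decide) (by omega) (by omega) (.cons ?_))
    have hfr' := hfr.set (d := 18) (by omega) (A' (ρ' 42) (ρ' 17))
    refine .ite_eq (by decide) (by decide) (fun h1 => ?_) fun h1 => ?_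
    · simp [hp.r9, h42', h17] at h1
      refine .cons (.rdr hf (by decide) (by decide) (by decide) (by simp; omega) (by simp; omega)
        (.cons ?_))
      refine .ite_lt (by decide) (by decide) (fun h2 => ?_) fun h2 => ?_
      · simp [h43', h17] at h2
        refine .cons (.move (by decide) (by decide) (.cons (.move (by decide) (by decide)
          (.nil (.nil (.nil ⟨by omega, ?_, by simpa, rfl, ?_, Or.inr ⟨?_, ?_, ?_⟩⟩))))))
        · exact ((hfr'.set (by omega) _).set (by omega) _).set (by omega) _
        · intro i hi hi0
          simp [h43', h17]
          rcases Nat.lt_succ_iff_lt_or_eq.1 hi with hi | rfl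
          · exact h2.le.trans (hI i hi hi0)
          · rfl
        · simpa [h17, mem_nbrs] using ⟨j, hj, rfl⟩
        · simpa [h17] using h1
        · simp [h43']
      · simp [h43', h17] at h2
        refine .skip (.nil (.nil ⟨by omega, hfr'.set (by omega) _, by simpa, rfl, ?_, by simpa⟩))
        intro i hi hi0
        simp
        rcases Nat.lt_succ_iff_lt_or_eq.1 hi with hi | rfl
        · exact hI i hi hi0
        · exact h2
    · simp [hp.r9, h42', h17] at h1
      refine .skip (.nil ⟨by omega, hfr', by simpa, rfl, ?_, by simpa⟩)
      intro i hi hi0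
      simp
      rcases Nat.lt_succ_iff_lt_or_eq.1 hi with hi | rfl
      · exact hI i hi hi0
      · exact absurd hi0 h1
  · rintro n' ρ' A' hp hn hfr ⟨rfl, hI, hJ⟩
    have hmin : ∀ y ∈ g.nbrs (ρ 30), A' (ρ 42) y = 0 → ρ' 23 ≤ A' (ρ 43) y := by
      intro y hy hy0
      obtain ⟨j, hj, rfl⟩ := mem_nbrs.1 hy
      exact hI j hj hy0
    -- Some neighbour is allowed and its counter is below the initial value, so a candidate has been
    -- recorded.
    have hJ' : ρ' 24 ∈ g.nbrs (ρ 30) ∧ A' (ρ 42) (ρ' 24) = 0 ∧ ρ' 23 = A' (ρ 43) (ρ' 24) := by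
      refine hJ.resolve_left fun e => ?_
      obtain ⟨y, hy, hy0⟩ := hfree
      have h1 := hmin y hy hy0
      have h2 := hcnt y hy hy0
      omega
    refine .nil (hQ _ _ (by omega) (fun r hr => (hfr r hr).trans ?_) hJ'.1 hJ'.2.1 ?_ hJ'.2.2)
    · exact Function.update_of_ne (by omega) _ _
    · intro y hy hy0
      rw [← hJ'.2.2]
      exact hmin y hy hy0

/-- Count in register `23` the neighbours of the left node in register `30` that are marked in
row `5`. -/
def countMarked : Prog :=
  seqs [.instr (.const 23 0), forD (seqs [rdc 18 5 17, .instr (.add 23 23 18)])]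

lemma Run.countMarked (hf : Fits g z) (h5 : 5 < z.rows) (hx : ρ 30 < g.N) {E : Finset ℕ}
    (hE : A 5 = ind E) (hinj : Set.InjOn (g.nb (ρ 30)) (range g.D))
    (hQ : ∀ n' ρ', n' ≤ n + 40 * g.D + 15 → Fr ρ ρ' → ρ' 23 = (g.nbrs (ρ 30) ∩ E).card →
      Q n' ρ' A) :
    Run g z countMarked Q n ρ A := by
  have h0 := hf.const
  refine .cons (.const (by decide) (by omega) (.cons ?_))
  refine .forD hf (fun j a b A' => A' = A ∧ a = ∑ i ∈ range j, ind E (g.nb (ρ 30) i)) 16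
    (by simpa using hx) ⟨rfl, by simp⟩ ?_ ?_
  · rintro j hj n' ρ' A' hp hfr h16 h17 ⟨rfl, hI⟩
    have h30 := hfr 30 (by omega)
    simp at h30 h17
    have hnb := hf.nb _ hx j hj
    rw [← h17] at hnb
    have hle : ∑ i ∈ range j, ind E (g.nb (ρ 30) i) ≤ j := by
      refine (sum_le_card_nsmul _ _ 1 fun i _ => ind_le_one _ _).trans (by simp)
    have h1 := ind_le_one E (ρ' 17)
    have h2 := hf.deg
    refine .cons (.rdc hf (by decide) h5 (by decide) (by omega) (.cons ?_))
    refine .add (by decide) (by decide) (by decide) ?_ (.nil ⟨by omega, ?_, by simpa, rfl, ?_⟩)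
    · simp [hE, hI]
      omega
    · exact (hfr.set (by omega) _).set (by omega) _
    · rw [sum_range_succ]
      simp [hE, hI, h17]
  · rintro n' ρ' A' hp hn hfr ⟨rfl, hI⟩
    refine .nil (hQ _ _ (by omega) (fun r hr => (hfr r hr).trans ?_) ?_)
    · exact Function.update_of_ne (by omega) _ _
    -- The sum runs over adjacency list positions; it is a cardinality because the list has no
    -- repetitions.
    · rw [hI, Net.nbrs, ← filter_mem_eq_inter, card_filter, sum_image hinj]
      rfl

lemma nbrs_image_succ (x j : ℕ) :
    (range (j + 1)).image (g.nb x) = insert (g.nb x j) ((range j).image (g.nb x)) := by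
  rw [range_add_one, image_insert]

lemma upd_fill (A : ℕ → ℕ → ℕ) (k : ℕ) (Y : Finset ℕ) (v : ℕ → ℕ) (y : ℕ) :
    upd (Function.update A k (fill (A k) Y v)) k y (v y) =
      Function.update A k (fill (A k) (insert y Y) v) := by
  rw [upd, Function.update_self, Function.update_idem, fill_insert]

/-- Write register `v` to the entries of all neighbours in row `5`. -/
lemma run_fillMarked (hf : Fits g z) {v : ℕ} (h5 : 5 < z.rows) (hx : ρ 30 < g.N)
    (hv : v < 12)
    (hQ : ∀ n' ρ', n' ≤ n + 40 * g.D + 15 → Fr ρ ρ' →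
      Q n' ρ' (Function.update A 5 (fill (A 5) (g.nbrs (ρ 30)) fun _ => ρ v))) :
    Run g z (forD (wrc 5 17 v)) Q n ρ A := by
  refine .forD hf (fun j a b A' => A' = Function.update A 5
    (fill (A 5) ((range j).image (g.nb (ρ 30))) fun _ => ρ v)) 9 hx (by simp [fill_empty]) ?_ ?_
  · rintro j hj n' ρ' A' hp hfr h16 h17 hI
    have hnb := hf.nb _ hx j hj
    rw [← h17] at hnb
    refine .wrc hf (by omega) h5 (by decide) (by omega) ⟨by omega, hfr, h16, ?_⟩
    rw [hI, hfr v (by omega), h17, nbrs_image_succ]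
    exact upd_fill A 5 _ (fun _ => ρ v) _
  · rintro n' ρ' A' hp hn hfr rfl
    exact hQ _ _ (by omega) hfr

/-- Copy row `5` to the row in register `42` and clear the row in register `43`, at the
neighbours. -/
def finishNbrs : Prog := forD (seqs [rdc 18 5 17, wrr 42 17 18, wrr 43 17 9])

lemma Run.finishNbrs (hf : Fits g z) (h5 : 5 < z.rows) (hx : ρ 30 < g.N) (h42 : ρ 42 < z.rows)
    (h43 : ρ 43 < z.rows) (h1 : 5 < ρ 42) (h2 : ρ 42 < ρ 43)
    (hQ : ∀ n' ρ', n' ≤ n + 60 * g.D + 15 → Fr ρ ρ' →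
      Q n' ρ' (Function.update (Function.update A (ρ 42)
        (fill (A (ρ 42)) (g.nbrs (ρ 30)) (A 5))) (ρ 43)
        (fill (A (ρ 43)) (g.nbrs (ρ 30)) fun _ => 0))) :
    Run g z finishNbrs Q n ρ A := by
  refine .forD hf (fun j a b A' => A' = Function.update (Function.update A (ρ 42)
    (fill (A (ρ 42)) ((range j).image (g.nb (ρ 30))) (A 5))) (ρ 43)
    (fill (A (ρ 43)) ((range j).image (g.nb (ρ 30))) fun _ => 0)) 32 hx (by simp [fill_empty]) ?_ ?_
  · rintro j hj n' ρ' A' hp hfr h16 h17 hI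
    have hnb := hf.nb _ hx j hj
    rw [← h17] at hnb
    have h42' := hfr 42 (by omega)
    have h43' := hfr 43 (by omega)
    refine .cons (.rdc hf (by decide) h5 (by decide) (by omega) (.cons ?_))
    refine .wrr hf (by decide) (by decide) (by decide) (by simp; omega) (by simp; omega) (.cons ?_)
    refine .wrr hf (by decide) (by decide) (by decide) (by simp; omega) (by simp; omega)
      (.nil ⟨by omega, hfr.set (by omega) _, by simpa, ?_⟩)
    -- The loop writes only to rows beyond `5`, so it always copies from the original row.
    have e5 : A' 5 = A 5 := by
      rw [hI, Function.update_of_ne (by omega), Function.update_of_ne (by omega)]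
    simp only [Function.update_self, Function.update_of_ne (show (17 : ℕ) ≠ 18 by omega),
      Function.update_of_ne (show (42 : ℕ) ≠ 18 by omega),
      Function.update_of_ne (show (43 : ℕ) ≠ 18 by omega),
      Function.update_of_ne (show (9 : ℕ) ≠ 18 by omega), h42', h43', h17, hp.r9, e5]
    rw [hI, nbrs_image_succ, fill_insert, fill_insert]
    unfold upd
    funext i
    by_cases e1 : i = ρ 43
    · subst e1
      simp [h2.ne']
    · by_cases e2 : i = ρ 42
      · subst e2
        simp [e1]
      · simp [e1, e2]
  · rintro n' ρ' A' hp hn hfr rfl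
    exact hQ _ _ (by omega) hfr

end DynMatch

/-! ### Programs for the passes of the renewal. -/

namespace DynMatch

open Finset

namespace Net

variable {g : Net} {Λ : ℕ} {c : Copy} {S E H W : Finset ℕ}

/-- The counters are bounded in the virtual pass. -/
lemma Frozen.cnt_le (h : g.Expanding) (hΛ : 2 * g.K < 4 ^ Λ) {q : ℕ}
    (hf : g.Frozen Λ c S E H W (q + 1)) (hq : q / g.N = 1) {y : ℕ} (hy : y ∈ g.right)
    (hyF : y ∉ c.F) : c.cnt y ≤ Λ := by
  obtain ⟨hs, p, r, hr, he, hp⟩ := hf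
  have hK := h.pos
  have hKN := h.le
  have hW := hs.recent_card
  cases hp with
  | clear _ hu => exact hu.batch.cnt_le h hu.closed (by omega) hΛ hy hyF
  | mark _ hu => exact hu.batch.cnt_le h hu.closed (by omega) hΛ hy hyF
  | close _ _ _ _ hu => exact hu.batch.cnt_le h hu.closed (by omega) hΛ hy hyF
  | place _ hrd hu =>
    refine hu.batch.cnt_le h hu.closed ?_ hΛ hy hyF
    have h1 := card_union_le W (S.filter (r ≤ ·))
    have h2 := card_filter_le S (r ≤ ·)
    have h3 := hrd.card
    omega
  | finish =>
    rw [Nat.div_eq_of_lt (by omega)] at hq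
    omega

end Net

namespace Tab

variable {g : Net} {s : St} {A : ℕ → ℕ → ℕ}

lemma insertS (h : Tab g s A) (x : ℕ) : Tab g { s with S := insert x s.S } (upd A 4 x 1) := by
  rw [upd, h.S, update_ind_one]
  exact h.setS _

lemma eraseS (h : Tab g s A) (x : ℕ) : Tab g { s with S := s.S.erase x } (upd A 4 x 0) := by
  rw [upd, h.S, update_ind_zero]
  exact h.setS _

lemma insertE (h : Tab g s A) (y : ℕ) : Tab g { s with E := insert y s.E } (upd A 5 y 1) := by
  rw [upd, h.E, update_ind_one]
  exact h.setE _

lemma insertAct (h : Tab g s A) (x : ℕ) :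
    Tab g { s with lay := { s.lay with act := insert x s.lay.act } } (upd A 2 x 1) := by
  rw [upd, h.act, update_ind_one]
  exact h.setAct _

lemma eraseAct (h : Tab g s A) (x : ℕ) :
    Tab g { s with lay := { s.lay with act := s.lay.act.erase x } } (upd A 2 x 0) := by
  rw [upd, h.act, update_ind_zero]
  exact h.setAct _

lemma insertInr (h : Tab g s A) (x : ℕ) :
    Tab g { s with lay := { s.lay with inr := insert x s.lay.inr } } (upd A 3 x 1) := by
  rw [upd, h.inr, update_ind_one]
  exact h.setInr _

lemma eraseInr (h : Tab g s A) (x : ℕ) :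
    Tab g { s with lay := { s.lay with inr := s.lay.inr.erase x } } (upd A 3 x 0) := by
  rw [upd, h.inr, update_ind_zero]
  exact h.setInr _

lemma updHl (h : Tab g s A) (x v : ℕ) :
    Tab g { s with lay := { s.lay with hl := Function.update s.lay.hl x v } } (upd A 0 x v) := by
  rw [upd, h.hl]
  exact h.setHl _

lemma updHy (h : Tab g s A) (x v : ℕ) :
    Tab g { s with lay := { s.lay with hy := Function.update s.lay.hy x v } } (upd A 1 x v) := by
  rw [upd, h.hy]
  exact h.setHy _

lemma insertOcc (h : Tab g s A) (k y : ℕ) :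
    Tab g { s with lay := { s.lay with
      occ := Function.update s.lay.occ k (insert y (s.lay.occ k)) } } (upd A (16 + 2 * k) y 1) := by
  rw [upd, h.occ, update_ind_one]
  exact h.setOcc _ _

lemma eraseOcc (h : Tab g s A) (k y : ℕ) :
    Tab g { s with lay := { s.lay with
      occ := Function.update s.lay.occ k ((s.lay.occ k).erase y) } } (upd A (16 + 2 * k) y 0) := by
  rw [upd, h.occ, update_ind_zero]
  exact h.setOcc _ _

lemma updRing (h : Tab g s A) (k p v : ℕ) :
    Tab g { s with lay := { s.lay with
      ring := Function.update s.lay.ring k (Function.update (s.lay.ring k) p v) } }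
      (upd A (17 + 2 * k) p v) := by
  rw [upd, h.ring]
  exact h.setRing _ _

lemma assign (h : Tab g s A) {c : ℕ} (hc : c < 2) (x y : ℕ) :
    Tab g { s with cp := Function.update s.cp c ((s.cp c).assign x y) }
      (upd (upd A (11 + 4 * c) x y) (10 + 4 * c) y ((s.cp c).cnt y + 1)) := by
  unfold upd
  have h1 := h.T c hc
  have h2 := h.F c hc
  have h3 := h.cnt c hc
  have h4 := h.pl c hc
  refine h.setCopy (fun i hi => ?_) ?_ ?_ ?_ ?_ hc
  · rw [Function.update_of_ne (by omega), Function.update_of_ne (by omega)]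
  · rw [Function.update_of_ne (by omega), Function.update_of_ne (by omega), h1]
    rfl
  · rw [Function.update_of_ne (by omega), Function.update_of_ne (by omega), h2]
    rfl
  · rw [Function.update_self, Function.update_of_ne (by omega), h3]
    rfl
  · rw [Function.update_of_ne (by omega), Function.update_self, h4]
    rfl

end Tab

variable {g : Net} {z : Sizes} {A : ℕ → ℕ → ℕ} {ρ : ℕ → ℕ}
  {Q : ℕ → (ℕ → ℕ) → (ℕ → ℕ → ℕ) → Prop} {n : ℕ}

/-- The numbers of the rows of copy `c` are in registers `41` to `44`. -/
structure CopyRows (ρ : ℕ → ℕ) (c : ℕ) : Prop where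
  r41 : ρ 41 = 8 + 4 * c
  r42 : ρ 42 = 9 + 4 * c
  r43 : ρ 43 = 10 + 4 * c
  r44 : ρ 44 = 11 + 4 * c

/-- Compute the numbers of the rows of the copy in register `38`. -/
def copyRows : Prog :=
  seqs [.instr (.const 18 4), .instr (.mul 41 38 18), .instr (.const 18 8),
    .instr (.add 41 18 41), .instr (.add 42 41 8), .instr (.add 43 42 8), .instr (.add 44 43 8)]

lemma Run.copyRows (hf : Fits g z) (hc : ρ 38 < 2)
    (hQ : ∀ n' ρ', n' ≤ n + 20 → CopyRows ρ' (ρ 38) →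
      (∀ r, r ≠ 18 → (r < 41 ∨ 44 < r) → ρ' r = ρ r) → Q n' ρ' A) : Run g z copyRows Q n ρ A := by
  have h0 := hf.const
  refine .of_params fun hp => ?_
  refine .cons (.const (by decide) (by omega) (.cons (.mul (by decide) (by decide) (by decide)
    (by simp; omega) (.cons (.const (by decide) (by omega) (.cons (.add (by decide) (by decide)
    (by decide) (by simp; omega) (.cons (.add (by decide) (by decide) (by decide)
    (by simp [hp.r8]; omega) (.cons (.add (by decide) (by decide) (by decide)
    (by simp [hp.r8]; omega) (.cons (.add (by decide) (by decide) (by decide)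
    (by simp [hp.r8]; omega) (.nil (hQ _ _ (by omega) ?_ ?_)))))))))))))))
  · constructor <;> simp [hp.r8] <;> omega
  · intro r h1 h2
    rw [Function.update_of_ne (by omega), Function.update_of_ne (by omega),
      Function.update_of_ne (by omega), Function.update_of_ne (by omega),
      Function.update_of_ne (by omega), Function.update_of_ne (by omega),
      Function.update_of_ne (by omega)]

/-- What is known of registers during a step of the background computation, for the left node `x`
and the copy `c`. -/
structure BgRegs (ρ : ℕ → ℕ) (x c : ℕ) : Prop extends CopyRows ρ c where
  r30 : ρ 30 = x
  r38 : ρ 38 = c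

lemma BgRegs.of_fr {ρ' : ℕ → ℕ} {x c : ℕ} (h : BgRegs ρ x c) (hfr : Fr ρ ρ') : BgRegs ρ' x c :=
  ⟨⟨by rw [hfr _ (by omega), h.r41], by rw [hfr _ (by omega), h.r42],
    by rw [hfr _ (by omega), h.r43], by rw [hfr _ (by omega), h.r44]⟩,
    by rw [hfr _ (by omega), h.r30], by rw [hfr _ (by omega), h.r38]⟩

/-- The result of a step of the background computation in pass `p` for the left node `x` in
copy `c`. -/
def Stepped (g : Net) (s : St) (p x c n : ℕ) (ρ : ℕ → ℕ) (n' : ℕ) (ρ' : ℕ → ℕ)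
    (A' : ℕ → ℕ → ℕ) : Prop :=
  n' ≤ n + 200 * g.D + 200 ∧ Fr ρ ρ' ∧ ∃ C S E,
    g.BgStep (s.lay.homes g c) (s.cp c) s.S s.E p x C S E ∧
    Tab g { s with cp := Function.update s.cp c C, S := S, E := E } A'

lemma Stepped.of_eq {s : St} {p x c n' : ℕ} {ρ' : ℕ → ℕ} {A' : ℕ → ℕ → ℕ} {S E : Finset ℕ}
    (hn : n' ≤ n + 200 * g.D + 200) (hfr : Fr ρ ρ')
    (hb : g.BgStep (s.lay.homes g c) (s.cp c) s.S s.E p x (s.cp c) S E)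
    (ht : Tab g { s with S := S, E := E } A') : Stepped g s p x c n ρ n' ρ' A' := by
  refine ⟨hn, hfr, _, _, _, hb, ?_⟩
  rwa [Function.update_eq_self]

section Steps

variable {s : St} {x c : ℕ}

/-- Clear the sets under construction, at one left node. -/
def bgClear : Prog := seqs [forD (wrc 5 17 9), wrc 4 30 9]

lemma run_bgClear (hf : Fits g z) (hr : 16 ≤ z.rows) (ht : Tab g s A) (h : BgRegs ρ x c)
    (hx : x < g.N) : Run g z bgClear (Stepped g s (g.N + 3) x c n ρ) n ρ A := by
  refine .of_params fun hp => .cons (run_fillMarked hf (by omega) (h.r30 ▸ hx) (by decide) ?_)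
  intro n' ρ' hn hfr
  refine .cons (.wrc hf (by decide) (by omega) (by decide) ?_ (.nil ?_))
  · rw [hfr _ (by omega), h.r30]
    omega
  · refine .of_eq (by omega) hfr (.clear x) ?_
    rw [hfr 30 (by omega), hfr 9 (by omega), h.r30, hp.r9, ht.E, fill_ind_zero]
    have := ht.setE (s.E \ g.nbrs x)
    exact this.eraseS x

/-- Mark the right node of a home, at one left node. -/
def bgMark : Prog :=
  seqs [rdc 18 0 30, .instr (.add 19 38 8),
    .ite (.eq 18 19) (seqs [rdr 18 44 30, wrc 5 18 8]) .skip]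

lemma run_bgMark (hf : Fits g z) (hr : 16 ≤ z.rows) (ht : Tab g s A) (h : BgRegs ρ x c)
    (hx : x < g.N) (hc : c < 2) (hH : x ∈ s.lay.homes g c ↔ s.lay.hl x = c + 1)
    (hpl : s.lay.hl x = c + 1 → (s.cp c).pl x < z.R) :
    Run g z bgMark (Stepped g s (g.N + 2) x c n ρ) n ρ A := by
  have h0 := hf.const
  have h30 := h.r30
  refine .of_params fun hp => .cons (.rdc hf (by decide) (by omega) (by decide) (by omega)
    (.cons (.add (by decide) (by decide) (by decide) (by simp [hp.r8, h.r38]; omega)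
      (.cons ?_))))
  have hfr : Fr ρ _ := ((Fr.refl ρ).set (d := 18) (by omega) (A 0 (ρ 30))).set (d := 19) (by omega)
    (c + 1)
  refine .ite_eq (by decide) (by decide) (fun h1 => ?_) fun h1 => ?_
  · simp [ht.hl, h30, h.r38, hp.r8] at h1
    refine .cons (.rdr hf (by decide) (by decide) (by decide) (by simp [h.r44]; omega)
      (by simp [h30]; omega) (.cons (.wrc hf (by decide) (by omega) (by decide) ?_
        (.nil (.nil ?_)))))
    · have := hpl h1
      simp [h.r44, h30, ht.pl c hc]
      omega
    · refine .of_eq (by omega) ?_ (.mark x (hH.2 h1)) ?_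
      · simpa [hp.r8, h.r38] using hfr.set (d := 18) (by omega) _
      · simp [h.r44, h30, ht.pl c hc, hp.r8]
        exact ht.insertE _
  · simp [ht.hl, h30, h.r38, hp.r8] at h1
    refine .skip (.nil (.of_eq (by omega) ?_ (.markSkip x fun h' => h1 (hH.1 h')) ht))
    simpa [hp.r8, h.r38] using hfr

/-- Reserve the left node in register `30` if it has many forbidden neighbours. -/
def bgClose : Prog :=
  seqs [rdc 18 4 30, .ite (.eq 18 9) (seqs [countMarked, .instr (.const 18 3),
    .instr (.mul 23 23 18), .ite (.lt 23 1) .skip (seqs [wrc 4 30 8, forD (wrc 5 17 8)])]) .skip]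

lemma run_bgClose (hf : Fits g z) (hr : 16 ≤ z.rows) (ht : Tab g s A) (h : BgRegs ρ x c)
    (hx : x < g.N) (hinj : Set.InjOn (g.nb x) (range g.D)) {p : ℕ} (hp1 : 2 ≤ p)
    (hp2 : p < g.N + 2) :
    Run g z bgClose (Stepped g s p x c n ρ) n ρ A := by
  have h0 := hf.const
  have h30 := h.r30
  refine .of_params fun hp => .cons (.rdc hf (by decide) (by omega) (by decide) (by omega)
    (.cons ?_))
  have hfr : Fr ρ _ := (Fr.refl ρ).set (d := 18) (by omega) (A 4 (ρ 30))
  refine .ite_eq (by decide) (by decide) (fun h1 => ?_) fun h1 => ?_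
  · simp [ht.S, h30, hp.r9, ind_eq_zero] at h1
    refine .cons (.countMarked hf (by omega) (by simpa [h30]) ht.E
      (by simpa only [Function.update_of_ne (show (30 : ℕ) ≠ 18 by omega), h30] using hinj)
      fun n' ρ' hn hfr' h23 => ?_)
    have hfr : Fr ρ ρ' := fun r hr => (hfr' r hr).trans (hfr r hr)
    have h30' := (hfr 30 (by omega)).trans h30
    have h3 : (g.nbrs x ∩ s.E).card ≤ g.D := (card_le_card inter_subset_left).trans
      (g.card_nbrs_le x)
    have h4 := hf.deg
    simp [h30] at h23
    refine .cons (.const (by decide) (by omega) (.cons (.mul (by decide) (by decide) (by decide)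
      (by simp [h23]; omega) (.cons ?_))))
    have hfr3 : Fr ρ _ := (hfr.set (d := 18) (by omega) 3).set (d := 23) (by omega)
      ((g.nbrs x ∩ s.E).card * 3)
    refine .of_params fun hp => .ite_lt (by decide) (by decide) (fun h2 => ?_) fun h2 => ?_
    · rw [hp.r1] at h2
      simp [h23] at h2
      refine .skip (.nil (.nil (.of_eq (by omega) (by simpa [h23] using hfr3)
        (.closeSkip p x hp1 hp2 (Or.inr (by omega))) ht)))
    · rw [hp.r1] at h2
      simp [h23] at h2
      refine .cons (.wrc hf (by decide) (by omega) (by decide) (by simp [h30']; omega) (.cons ?_))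
      refine run_fillMarked hf (by omega) (by simp [h30']; omega) (by decide)
        fun n'' ρ'' hn' hfr'' => .nil (.nil (.nil (.of_eq (by omega) ?_
          (.close p x hp1 hp2 h1 (by omega)) ?_)))
      · intro r hr
        refine (hfr'' r hr).trans ?_
        simpa [h23] using hfr3 r hr
      · have h8 := hp.r8
        simp [h30'] at h8 ⊢
        rw [h8]
        have := (ht.insertS x)
        rw [show upd A 4 x 1 5 = A 5 from Function.update_of_ne (by omega) _ _, ht.E,
          fill_ind_one]
        exact this.setE _
  · simp [ht.S, h30, hp.r9, ind_eq_zero] at h1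
    exact .skip (.nil (.of_eq (by omega) hfr (.closeSkip p x hp1 hp2 (Or.inl h1)) ht))

/-- Select a right node in a copy and place the left node in register `30` there. -/
def selectHome : Prog :=
  seqs [findMin, wrr 44 30 24, .instr (.add 23 23 8), wrr 43 24 23]

/-- Place the left node in register `30` if it is newly reserved. -/
def bgPlace : Prog :=
  seqs [rdc 18 4 30, .ite (.eq 18 9) .skip (seqs [rdr 18 41 30,
    .ite (.eq 18 9) (seqs [rdc 18 0 30, .instr (.add 19 38 8),
      .ite (.eq 18 19) .skip selectHome]) .skip])]

/-- The selection of a right node in a copy succeeds. -/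
lemma Run.selectHome (hf : Fits g z) (hr : 16 ≤ z.rows) (ht : Tab g s A) (h : CopyRows ρ c)
    (h30 : ρ 30 = x) (hx : x < g.N) (hc : c < 2) (hfree : ∃ y ∈ g.nbrs x, y ∉ (s.cp c).F)
    (hcnt : ∀ y ∈ g.nbrs x, y ∉ (s.cp c).F → (s.cp c).cnt y < g.N + z.R)
    (hQ : ∀ n' ρ', n' ≤ n + 55 * g.D + 60 → Fr ρ ρ' → g.Select (s.cp c) x (ρ' 24) →
      Q n' ρ' (upd (upd A (11 + 4 * c) x (ρ' 24)) (10 + 4 * c) (ρ' 24)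
        ((s.cp c).cnt (ρ' 24) + 1))) :
    Run g z selectHome Q n ρ A := by
  have hN := hf.addr
  have hrow : g.N + z.R ≤ z.rows * (g.N + z.R) := Nat.le_mul_of_pos_left _ (by omega)
  refine .cons (.findMin hf (by omega) (by rw [h.r42]; omega) (by rw [h.r43]; omega) ?_ ?_ ?_)
  · obtain ⟨y, hy, hyF⟩ := hfree
    refine ⟨y, by rwa [h30], ?_⟩
    rwa [h.r42, ht.F c hc, ind_eq_zero]
  · rw [h30, h.r42, h.r43, ht.F c hc, ht.cnt c hc]
    exact fun y hy h0 => hcnt y hy (ind_eq_zero.1 h0)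
  · rw [h30, h.r42, h.r43, ht.F c hc, ht.cnt c hc]
    intro n' ρ' hn hfr hy hy0 hmin h23
    rw [ind_eq_zero] at hy0
    have h2 := hcnt _ hy hy0
    have h3 := hf.nbrs_lt hx hy
    have h30' := (hfr 30 (by omega)).trans h30
    have h44' := (hfr 44 (by omega)).trans h.r44
    have h43' := (hfr 43 (by omega)).trans h.r43
    refine .of_params fun hp => .cons (.wrr hf (by decide) (by decide) (by decide) (by omega)
      (by omega) (.cons (.add (by decide) (by decide) (by decide) (by rw [hp.r8]; omega)
      (.cons (.wrr hf (by decide) (by decide) (by decide) (by simp; omega) (by simp; omega)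
      (.nil ?_))))))
    simp [h44', h43', h30', hp.r8, h23]
    have := hQ (n' + 1 + 7 + 1 + 1 + 1 + 7 + 1) (Function.update ρ' 23 ((s.cp c).cnt (ρ' 24) + 1))
      (by omega) (hfr.set (by omega) _)
    simp at this
    exact this ⟨hy, hy0, fun y' hy' hyF => hmin y' hy' (ind_eq_zero.2 hyF)⟩

lemma run_bgPlace (hf : Fits g z) (hr : 16 ≤ z.rows) (ht : Tab g s A) (h : BgRegs ρ x c)
    (hx : x < g.N) (hc : c < 2) (hH : x ∈ s.lay.homes g c ↔ s.lay.hl x = c + 1)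
    (hfree : x ∉ (s.cp c).T → ∃ y ∈ g.nbrs x, y ∉ (s.cp c).F)
    (hcnt : ∀ y ∈ g.nbrs x, y ∉ (s.cp c).F → (s.cp c).cnt y < g.N + z.R) :
    Run g z bgPlace (Stepped g s 1 x c n ρ) n ρ A := by
  have h0 := hf.const
  have h30 := h.r30
  refine .of_params fun hp => .cons (.rdc hf (by decide) (by omega) (by decide) (by omega)
    (.cons ?_))
  have hfr : Fr ρ _ := (Fr.refl ρ).set (d := 18) (by omega) (A 4 (ρ 30))
  refine .ite_eq (by decide) (by decide) (fun h1 => ?_) fun h1 => ?_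
  · simp [ht.S, h30, hp.r9, ind_eq_zero] at h1
    exact .skip (.nil (.of_eq (by omega) hfr (.placeSkip x (Or.inl h1)) ht))
  · simp [ht.S, h30, hp.r9, ind_eq_zero] at h1
    refine .cons (.rdr hf (by decide) (by decide) (by decide) (by simp [h.r41]; omega)
      (by simp [h30]; omega) (.cons ?_))
    simp [h.r41, h30, ht.T c hc]
    have hfr : Fr ρ _ := (Fr.refl ρ).set (d := 18) (by omega) (ind (s.cp c).T x)
    refine .ite_eq (by decide) (by decide) (fun h2 => ?_) fun h2 => ?_
    · simp [hp.r9, ind_eq_zero] at h2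
      refine .cons (.rdc hf (by decide) (by omega) (by decide) (by simp [h30]; omega)
        (.cons (.add (by decide) (by decide) (by decide) (by simp [hp.r8, h.r38]; omega)
        (.cons ?_))))
      simp [h30, h.r38, hp.r8, ht.hl]
      have hfr : Fr ρ _ := ((Fr.refl ρ).set (d := 18) (by omega) (s.lay.hl x)).set (d := 19)
        (by omega) (c + 1)
      refine .ite_eq (by decide) (by decide) (fun h3 => ?_) fun h3 => ?_
      · simp at h3
        exact .skip (.nil (.nil (.nil (.of_eq (by omega) hfr
          (.placeSkip x (Or.inr (Or.inr (hH.2 h3)))) ht))))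
      · simp at h3
        have hc' := h.of_fr hfr
        refine .selectHome hf hr ht hc'.toCopyRows hc'.r30 hx hc (hfree h2) hcnt
          fun n' ρ' hn hfr' hsel => .nil (.nil (.nil ⟨by omega,
            fun r hr => (hfr' r hr).trans (hfr r hr), _, _, _,
            .place x _ h1 h2 (fun h' => h3 (hH.1 h')) hsel, ht.assign hc x _⟩))
    · simp [hp.r9, ind_eq_zero] at h2
      exact .skip (.nil (.nil (.of_eq (by omega) hfr (.placeSkip x (Or.inr (Or.inl h2))) ht)))

/-- Replace the sets of the copy by those under construction, at one left node. -/
def bgFinish : Prog := seqs [rdc 18 4 30, wrr 41 30 18, finishNbrs]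

lemma run_bgFinish (hf : Fits g z) (hr : 16 ≤ z.rows) (ht : Tab g s A) (h : BgRegs ρ x c)
    (hx : x < g.N) (hc : c < 2) : Run g z bgFinish (Stepped g s 0 x c n ρ) n ρ A := by
  have h30 := h.r30
  refine .cons (.rdc hf (by decide) (by omega) (by decide) (by omega) (.cons (.wrr hf (by decide)
    (by decide) (by decide) (by simp [h.r41]; omega) (by simp [h30]; omega) (.cons ?_))))
  simp [h.r41, h30, ht.S]
  have hfr : Fr ρ _ := (Fr.refl ρ).set (d := 18) (by omega) (ind s.S x)
  have hc' := h.of_fr hfr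
  refine .finishNbrs hf (by omega) (by rw [hc'.r30]; omega) (by rw [hc'.r42]; omega)
    (by rw [hc'.r43]; omega) (by rw [hc'.r42]; omega) (by rw [hc'.r42, hc'.r43]; omega)
    fun n' ρ' hn hfr' => .nil ⟨by omega, fun r hr => (hfr' r hr).trans (hfr r hr), _, _, _,
      .finish x, ?_⟩
  rw [hc'.r42, hc'.r43, hc'.r30]
  have h1 := ht.T c hc
  have h2 := ht.F c hc
  have h3 := ht.cnt c hc
  have h4 := ht.pl c hc
  unfold upd
  refine ht.setCopy (fun i hi => ?_) ?_ ?_ ?_ ?_ hc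
  · rw [Function.update_of_ne (by omega), Function.update_of_ne (by omega),
      Function.update_of_ne (by omega)]
  · rw [Function.update_of_ne (by omega), Function.update_of_ne (by omega), Function.update_self,
      h1]
    by_cases hS : x ∈ s.S
    · rw [ind_eq_one.2 hS, update_ind_one, if_pos hS]
    · rw [ind_eq_zero.2 hS, update_ind_zero, if_neg hS]
  · rw [Function.update_of_ne (by omega), Function.update_self, Function.update_of_ne (by omega),
      h2, Function.update_of_ne (by omega), ht.E]
    funext y
    by_cases hy : y ∈ g.nbrs x <;> simp [fill, ind, hy]
  · rw [Function.update_self, Function.update_of_ne (by omega), h3]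
    rfl
  · rw [Function.update_of_ne (by omega), Function.update_of_ne (by omega),
      Function.update_of_ne (by omega), h4]

end Steps

end DynMatch

/-! ### Programs for one renewal step and for the choice of a home. -/

namespace DynMatch

open Finset

/-- The conditions on the graph, the sizes, the number `l` of levels and the load `Λ` of a copy. -/
structure Machine (g : Net) (z : Sizes) (l Λ : ℕ) : Prop where
  expanding : g.Expanding
  fits : Fits g z
  rows : 20 + 2 * l ≤ z.rows
  load : 2 * g.K < 4 ^ Λ
  load_lt : Λ < g.N + z.R
  levels_le : l + 2 ≤ g.N + z.R
  levels : ∀ i, 2 ^ i < 2 * (g.N * (g.N + 4)) ↔ i < l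

variable {g : Net} {z : Sizes} {A : ℕ → ℕ → ℕ} {ρ : ℕ → ℕ}
  {Q : ℕ → (ℕ → ℕ) → (ℕ → ℕ → ℕ) → Prop} {n l Λ d : ℕ} {s : St}

lemma Machine.add_lt (hm : Machine g z l Λ) : g.N + z.R < 2 ^ z.w := by
  have h1 := hm.fits.addr
  have h2 := hm.rows
  have : g.N + z.R ≤ z.rows * (g.N + z.R) := Nat.le_mul_of_pos_left _ (by omega)
  omega

/-- It bounds the pass number by `N + 3`, so once the other passes are excluded by tests, a closure
pass remains. -/
lemma Net.Frozen.lt {c : Net.Copy} {S E H W : Finset ℕ} {q : ℕ}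
    (hf : g.Frozen Λ c S E H W (q + 1)) : q < g.N * (g.N + 4) := by
  obtain ⟨-, p, r, hr, he, hp⟩ := hf
  have h1 : p ≤ g.N + 3 := by
    cases hp <;> omega
  have h2 := Nat.mul_le_mul_right g.N h1
  have h3 : g.N * (g.N + 4) = (g.N + 3) * g.N + g.N := by ring
  omega

/-- One step of the background computation. -/
def background : Prog :=
  .ite (.eq 7 9) .skip (seqs [.instr (.sub 7 7 8), .instr (.div 37 7 0), .instr (.mod 30 7 0),
    .instr (.sub 38 8 6), .instr (.const 18 2), .instr (.add 40 0 18), .instr (.add 39 40 8),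
    copyRows,
    .ite (.eq 37 9) bgFinish (.ite (.eq 37 8) bgPlace (.ite (.eq 37 39) bgClear
      (.ite (.eq 37 40) bgMark bgClose)))])

lemma Run.background (hm : Machine g z l Λ) (hi : s.Inv g l Λ d) (ht : Tab g s A)
    (h6 : ρ 6 = s.lay.cur g) (h7 : ρ 7 = s.rem)
    (hQ : ∀ n' ρ' A' s', n' ≤ n + 200 * g.D + 300 → s.Bg g s' → Tab g s' A' → ρ' 7 = s'.rem →
      (∀ r, r < 12 → r ≠ 7 → ρ' r = ρ r) → Q n' ρ' A') : Run g z background Q n ρ A := by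
  have hf := hm.fits
  have hrows := hm.rows
  have h0 := hf.const
  have hadd := hm.add_lt
  have hcount := hf.count
  have hR : 6 ≤ g.D := hm.expanding.six_le
  have hN : 1 ≤ g.N := hm.expanding.pos.trans hm.expanding.le
  have hN4 : g.N + 4 ≤ g.N * (g.N + 4) := Nat.le_mul_of_pos_left _ hN
  have hcur := s.lay.cur_lt (g := g)
  refine .of_params fun hp => .ite_eq (by decide) (by decide) (fun h1 => ?_) fun h1 => ?_
  · rw [h7, hp.r9] at h1
    exact .skip (hQ _ _ _ s (by omega) (.idle h1) ht h7 fun _ _ _ => rfl)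
  rw [h7, hp.r9] at h1
  obtain ⟨q, hq⟩ : ∃ q, s.rem = q + 1 := ⟨s.rem - 1, by omega⟩
  have hfz := hi.frozen
  rw [hq] at hfz
  have hlt := hfz.lt
  have hx : q % g.N < g.N := Nat.mod_lt _ hN
  have hpass : q / g.N < g.N + 4 := Nat.div_lt_of_lt_mul hlt
  have hc : 1 - s.lay.cur g < 2 := by omega
  have hH := Lay.mem_homes hi.ok (g := g) (k := 1 - s.lay.cur g) (x := q % g.N)
  refine .cons (.sub (by decide) (by decide) (by decide) (.cons (.div (by decide) (by decide)
    (by decide) (.cons (.mod (by decide) (by decide) (by decide) (.cons (.sub (by decide)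
    (by decide) (by decide) (.cons (.const (by decide) (by omega) (.cons (.add (by decide)
    (by decide) (by decide) ?_ (.cons (.add (by decide) (by decide) (by decide) ?_ (.cons ?_)))))
    )))))))))
  · simp [hp.r0]
    omega
  · simp [hp.r0, hp.r8]
    omega
  refine .copyRows hf ?_ fun n' ρ' hn hcr hfr => .cons ?_
  · simp [hp.r8, h6]
  have e30 : ρ' 30 = q % g.N := by
    rw [hfr 30 (by omega) (by omega)]
    simp [hp.r0, hp.r8, h7, hq]
  have e37 : ρ' 37 = q / g.N := by
    rw [hfr 37 (by omega) (by omega)]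
    simp [hp.r0, hp.r8, h7, hq]
  have e38 : ρ' 38 = 1 - s.lay.cur g := by
    rw [hfr 38 (by omega) (by omega)]
    simp [hp.r8, h6]
  have e39 : ρ' 39 = g.N + 3 := by
    rw [hfr 39 (by omega) (by omega)]
    simp [hp.r8, hp.r0]
  have e40 : ρ' 40 = g.N + 2 := by
    rw [hfr 40 (by omega) (by omega)]
    simp [hp.r0]
  have e7 : ρ' 7 = q := by
    rw [hfr 7 (by omega) (by omega)]
    simp [hp.r8, h7, hq]
  have elow : ∀ r, r < 12 → r ≠ 7 → ρ' r = ρ r := by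
    intro r hr hr7
    rw [hfr r (by omega) (by omega), Function.update_of_ne (by omega),
      Function.update_of_ne (by omega), Function.update_of_ne (by omega),
      Function.update_of_ne (by omega), Function.update_of_ne (by omega),
      Function.update_of_ne (by omega), Function.update_of_ne (by omega)]
  have hbr : BgRegs ρ' (q % g.N) (1 - s.lay.cur g) := by
    refine ⟨?_, e30, e38⟩
    convert hcr using 1
    simp [hp.r8, h6]
  -- The common end of the five branches; `k` is the number of tests made in the dispatch.
  have hfin : ∀ k, k ≤ 4 → ∀ pr : Prog,
      Run g z pr (Stepped g s (q / g.N) (q % g.N) (1 - s.lay.cur g) (n' + 1 + k) ρ') (n' + 1 + k)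
        ρ' A → Run g z pr (fun n ρ A => Run g z (seqs []) Q n ρ A) (n' + 1 + k) ρ' A := by
    intro k hk pr hrun
    refine hrun.mono fun n'' ρ'' A'' _ ⟨hn'', hfr'', C, S, E, hb, ht'⟩ => .nil ?_
    refine hQ _ _ _ _ (by omega) (.step q C S E hq hb) (ht'.setRem q) ?_ fun r hr hr7 => ?_
    · rw [hfr'' 7 (by omega), e7]
    · rw [hfr'' r (by omega), elow r hr hr7]
  refine .of_params fun hp => .ite_eq (by decide) (by decide) (fun h2 => ?_) fun h2 => ?_
  · rw [e37, hp.r9] at h2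
    refine hfin 1 (by omega) _ ?_
    rw [h2]
    exact run_bgFinish hf (by omega) ht hbr hx hc
  rw [e37, hp.r9] at h2
  refine .ite_eq (by decide) (by decide) (fun h3 => ?_) fun h3 => ?_
  · rw [e37, hp.r8] at h3
    refine hfin 2 (by omega) _ ?_
    rw [h3]
    refine run_bgPlace hf (by omega) ht hbr hx hc hH (fun hT => ?_) fun y hy hyF => ?_
    · exact (hfz.closed hm.expanding h3).exists_free hm.expanding hx hT
    · exact (hfz.cnt_le hm.expanding hm.load h3 (Net.nbrs_subset_right hx hy) hyF).trans_lt
        hm.load_lt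
  rw [e37, hp.r8] at h3
  refine .ite_eq (by decide) (by decide) (fun h4 => ?_) fun h4 => ?_
  · rw [e37, e39] at h4
    refine hfin 3 (by omega) _ ?_
    rw [h4]
    exact run_bgClear hf (by omega) ht hbr hx
  rw [e37, e39] at h4
  refine .ite_eq (by decide) (by decide) (fun h5 => ?_) fun h5 => ?_
  · rw [e37, e40] at h5
    refine hfin 4 (by omega) _ ?_
    rw [h5]
    refine run_bgMark hf (by omega) ht hbr hx hc hH fun hhl => ?_
    rw [hi.pl _ hc _ hhl]
    exact hf.nbrs_lt hx (hi.ok.hy_mem _ (by omega))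
  · rw [e37, e40] at h5
    refine hfin 4 (by omega) _ ?_
    exact run_bgClose hf (by omega) ht hbr hx (hm.expanding.inj _ hx) (by omega) (by omega)

/-- Search a free level for the left node in register `30`. Register `37` tells whether there is
one, register `32` is its kind and register `5` the right node. -/
def findLevel : Prog :=
  seqs [.instr (.const 18 4), .instr (.add 36 0 18), .instr (.mul 36 36 0),
    .instr (.add 36 36 36), .instr (.const 32 2), .instr (.const 33 20), .instr (.const 35 1),
    .instr (.const 37 0),
    .loop (.lt 35 36) (seqs [
      .ite (.eq 37 9) (seqs [findFree,
        .ite (.eq 23 8) (seqs [.instr (.move 37 8), .instr (.move 5 24)])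
          (seqs [.instr (.add 32 32 8), .instr (.add 33 33 8), .instr (.add 33 33 8)])]) .skip,
      .instr (.add 35 35 35)])]

/-- The invariant of the search for a free level. -/
structure Search (g : Net) (s : St) (l x i : ℕ) (ρ ρ' : ℕ → ℕ) : Prop where
  frame : ∀ r, (r < 12 ∧ r ≠ 5 ∨ r = 30) → ρ' r = ρ r
  r35 : ρ' 35 = 2 ^ i
  r36 : ρ' 36 = 2 * (g.N * (g.N + 4))
  res : (ρ' 37 = 0 ∧ ρ' 32 = i + 2 ∧ ρ' 33 = 20 + 2 * i ∧ ∀ j < i, g.nbrs x ⊆ s.lay.occ (j + 2)) ∨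
    (ρ' 37 = 1 ∧ ∃ i' < l, ρ' 32 = i' + 2 ∧ (∀ j < i', g.nbrs x ⊆ s.lay.occ (j + 2)) ∧
      ρ' 5 ∈ g.nbrs x ∧ ρ' 5 ∉ s.lay.occ (i' + 2))

/-- The machine does not know `l`. It doubles a register until `2 * N * (N + 4)` is reached, which
by `Machine.levels` takes exactly `l` rounds; once a free level is found, the remaining rounds do
not search. -/
lemma Run.findLevel (hm : Machine g z l Λ) (ht : Tab g s A) {x : ℕ} (hx : x < g.N)
    (h30 : ρ 30 = x) (hQ : ∀ n' ρ', n' ≤ n + (40 * g.D + 50) * l + 30 → Search g s l x l ρ ρ' →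
      Q n' ρ' A) : Run g z findLevel Q n ρ A := by
  have hf := hm.fits
  have hrows := hm.rows
  have h0 := hf.const
  have hadd := hm.add_lt
  have hcount := hf.count
  have hN4 : g.N + 4 ≤ g.N * (g.N + 4) := Nat.le_mul_of_pos_left _ (by omega)
  refine .of_params fun hp => .cons (.const (by decide) (by omega) (.cons (.add (by decide)
    (by decide) (by decide) (by simp [hp.r0]; omega) (.cons (.mul (by decide) (by decide)
    (by decide) (by simp [hp.r0, mul_comm (g.N + 4)]; omega) (.cons (.add (by decide) (by decide)
    (by decide) (by simp [hp.r0, mul_comm (g.N + 4)]; omega) (.cons (.const (by decide) (by omega)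
    (.cons (.const (by decide) (by omega) (.cons (.const (by decide) (by omega) (.cons (.const
    (by decide) (by omega) (.cons ?_))))))))))))))))
  refine .loop_lt (fun i n' ρ' A' => Params g z ρ' ∧ A' = A ∧
    n' ≤ n + (40 * g.D + 50) * i + 20 ∧ Search g s l x i ρ ρ') l (by decide) (by decide) ?_ ?_ ?_
  · refine ⟨?_, rfl, by omega, ?_, by simp, ?_, Or.inl ⟨by simp, by simp, by simp, by simp⟩⟩
    · exact ((((((((hp.set (by omega) _).set (by omega) _).set (by omega) _).set (by omega) _).set
        (by omega) _).set (by omega) _).set (by omega) _).set (by omega) _)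
    · intro r hr
      rw [Function.update_of_ne (by omega), Function.update_of_ne (by omega),
        Function.update_of_ne (by omega), Function.update_of_ne (by omega),
        Function.update_of_ne (by omega), Function.update_of_ne (by omega),
        Function.update_of_ne (by omega), Function.update_of_ne (by omega)]
    · simp [hp.r0]
      ring
  · rintro i hi n' ρ' A' ⟨hp, rfl, hn, hs⟩
    have hlev := (hm.levels i).2 hi
    refine ⟨by rw [hs.r35, hs.r36]; exact hlev, .cons ?_⟩
    have h30' : ρ' 30 = x := (hs.frame 30 (by omega)).trans h30
    -- The common end of all branches of a round: doubling the register that controls the loop.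
    have hdouble : ∀ n'' ρ'', n'' ≤ n' + 40 * g.D + 40 → Params g z ρ'' →
        (∀ r, (r < 12 ∧ r ≠ 5 ∨ r = 30) → ρ'' r = ρ' r) → ρ'' 35 = ρ' 35 → ρ'' 36 = ρ' 36 →
        ((ρ'' 37 = 0 ∧ ρ'' 32 = i + 1 + 2 ∧ ρ'' 33 = 20 + 2 * (i + 1) ∧
            ∀ j < i + 1, g.nbrs x ⊆ s.lay.occ (j + 2)) ∨
          (ρ'' 37 = 1 ∧ ∃ i' < l, ρ'' 32 = i' + 2 ∧ (∀ j < i', g.nbrs x ⊆ s.lay.occ (j + 2)) ∧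
            ρ'' 5 ∈ g.nbrs x ∧ ρ'' 5 ∉ s.lay.occ (i' + 2))) →
        Run g z (seqs [.instr (.add 35 35 35)]) (fun n' ρ' B => Params g z ρ' ∧ B = A' ∧
          n' ≤ n + (40 * g.D + 50) * (i + 1) + 20 ∧ Search g s l x (i + 1) ρ ρ') n'' ρ'' A' := by
      intro n'' ρ'' hn'' hp'' hfr e35 e36 hres
      rw [hs.r35] at e35
      refine .cons (.add (by decide) (by decide) (by decide) (by rw [e35]; omega)
        (.nil ⟨hp''.set (by omega) _, rfl, ?_, ?_, ?_, ?_, ?_⟩))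
      · rw [mul_add, mul_one]
        omega
      · intro r hr
        rw [Function.update_of_ne (by omega), hfr r hr, hs.frame r hr]
      · simp [e35, pow_succ]
        ring
      · simpa [e36] using hs.r36
      · simpa using hres
    refine .ite_eq (by decide) (by decide) (fun h1 => ?_) fun h1 => ?_
    · rw [hp.r9] at h1
      obtain ⟨-, h32, h33, hfull⟩ := hs.res.resolve_right fun h => by omega
      refine .cons (.findFree hf (by omega) (by omega) fun n'' ρ'' hn'' hfr'' hres => .cons ?_)
      have erow : A' (ρ' 33) = ind (s.lay.occ (i + 2)) := by
        rw [h33, ← ht.occ]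
        congr 1
        ring
      rw [erow, h30'] at hres
      refine .of_params fun hp'' => .ite_eq (by decide) (by decide) (fun h2 => ?_) fun h2 => ?_
      · rw [hp''.r8] at h2
        obtain ⟨-, hy, hy0⟩ := hres.resolve_right fun h => by omega
        rw [ind_eq_zero] at hy0
        refine .cons (.move (by decide) (by decide) (.cons (.move (by decide) (by decide)
          (.nil (.nil (hdouble _ _ (by omega) ((hp''.set (by omega) _).set (by omega) _) ?_ ?_ ?_
            (Or.inr ⟨?_, i, hi, ?_, hfull, ?_, ?_⟩)))))))
        · intro r hr
          rw [Function.update_of_ne (by omega), Function.update_of_ne (by omega),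
            hfr'' r (by omega)]
        · simpa using hfr'' 35 (by omega)
        · simpa using hfr'' 36 (by omega)
        · simpa using hp''.r8
        · simpa [hfr'' 32 (by omega)] using h32
        · simpa using hy
        · simpa using hy0
      · rw [hp''.r8] at h2
        obtain ⟨-, hall⟩ := hres.resolve_left fun h => h2 h.1
        have e32 := (hfr'' 32 (by omega)).trans h32
        have e33 := (hfr'' 33 (by omega)).trans h33
        have e37 := (hfr'' 37 (by omega)).trans h1
        have e8 := hp''.r8
        have hlevels := hm.levels_le
        have h100 : 2 * l + 20 < 2 ^ z.w := by
          have h1 := hf.addr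
          have : z.rows * 1 ≤ z.rows * (g.N + z.R) := Nat.mul_le_mul_left _ (by omega)
          omega
        refine .cons (.add (by decide) (by decide) (by decide) (by omega)
          (.cons (.add (by decide) (by decide) (by decide) (by simp; omega)
          (.cons (.add (by decide) (by decide) (by decide) (by simp; omega)
          (.nil (.nil (hdouble _ _ (by omega) (((hp''.set (by omega) _).set (by omega) _).set
            (by omega) _) ?_ ?_ ?_ (Or.inl ⟨?_, ?_, ?_, ?_⟩)))))))))
        · intro r hr
          rw [Function.update_of_ne (by omega), Function.update_of_ne (by omega),
            Function.update_of_ne (by omega), hfr'' r (by omega)]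
        · simpa using hfr'' 35 (by omega)
        · simpa using hfr'' 36 (by omega)
        · simpa using e37
        · simp [e32, e8]
        · simp [e33, e8]
          omega
        · intro j hj y hy
          rcases Nat.lt_succ_iff_lt_or_eq.1 hj with hj | rfl
          · exact hfull j hj hy
          · have := hall y hy
            rwa [Ne, ind_eq_zero, not_not] at this
    · rw [hp.r9] at h1
      refine .skip (hdouble _ _ (by omega) hp (fun _ _ => rfl) rfl rfl ?_)
      exact Or.inr (hs.res.resolve_left fun h => h1 h.1)
  · rintro n' ρ' A' ⟨hp, rfl, hn, hs⟩
    refine ⟨?_, .nil (hQ _ _ (by omega) hs)⟩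
    rw [hs.r35, hs.r36]
    exact not_lt.1 fun h => absurd ((hm.levels l).1 h) (lt_irrefl _)

/-- Choose a home for the left node in register `30`. Register `32` is the kind and register `5` the
right node. -/
def choose : Prog :=
  seqs [findLevel, .ite (.eq 37 9) (seqs [.instr (.move 38 6), copyRows, .instr (.move 32 6),
    rdr 18 41 30, .ite (.eq 18 9) (seqs [selectHome, .instr (.move 5 24)]) (rdr 5 44 30)]) .skip]

lemma Run.choose (hm : Machine g z l Λ) (hi : s.Inv g l Λ d) (ht : Tab g s A) {x : ℕ}
    (hx : x < g.N) (h30 : ρ 30 = x) (h6 : ρ 6 = s.lay.cur g)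
    (hQ : ∀ n' ρ' A' s', n' ≤ n + (40 * g.D + 50) * l + 55 * g.D + 200 →
      s.Choice g l x (ρ' 32) (ρ' 5) s' → Tab g s' A' →
      (∀ r, (r < 12 ∧ r ≠ 5 ∨ r = 30) → ρ' r = ρ r) → Q n' ρ' A') :
    Run g z choose Q n ρ A := by
  have hf := hm.fits
  have hrows := hm.rows
  have hcur := s.lay.cur_lt (g := g)
  refine .cons (.findLevel hm ht hx h30 fun n' ρ' hn hs => .cons ?_)
  refine .of_params fun hp => .ite_eq (by decide) (by decide) (fun h1 => ?_) fun h1 => ?_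
  · rw [hp.r9] at h1
    obtain ⟨-, -, -, hfull⟩ := hs.res.resolve_right fun h => by omega
    have h6' := (hs.frame 6 (by omega)).trans h6
    have h30' := (hs.frame 30 (by omega)).trans h30
    refine .cons (.move (by decide) (by decide) (.cons (.copyRows hf (by simp; omega)
      fun n'' ρ'' hn' hcr hfr => .cons (.move (by decide) (by decide) (.cons ?_)))))
    simp [h6'] at hcr
    have e6 : ρ'' 6 = s.lay.cur g := by simpa [h6'] using hfr 6 (by omega) (by omega)
    have e30 : ρ'' 30 = x := by simpa [h30'] using hfr 30 (by omega) (by omega)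
    have elow : ∀ r, (r < 12 ∧ r ≠ 5 ∨ r = 30) → ρ'' r = ρ r := by
      intro r hr
      rw [hfr r (by omega) (by omega), Function.update_of_ne (by omega), hs.frame r hr]
    refine .rdr hf (by decide) (by decide) (by decide) (by simp [hcr.r41]; omega)
      (by simp [e30]; omega) (.cons ?_)
    simp [hcr.r41, e30, ht.T _ hcur, e6]
    refine .of_params fun hp3 => .ite_eq (by decide) (by decide) (fun h2 => ?_) fun h2 => ?_
    · rw [hp3.r9] at h2
      simp [ind_eq_zero] at h2
      have hcr' : CopyRows (Function.update (Function.update ρ'' 32 (s.lay.cur g)) 18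
          (ind (s.cp (s.lay.cur g)).T x)) (s.lay.cur g) := by
        constructor <;> simp [hcr.r41, hcr.r42, hcr.r43, hcr.r44]
      refine .cons (.selectHome hf (by omega) ht hcr' (by simpa) hx hcur
        (hi.inUse.closed.exists_free hm.expanding hx h2) ?_ fun n3 ρ3 hn3 hfr3 hsel =>
          .cons (.move (by decide) (by decide) (.nil (.nil (.nil
            (hQ _ _ _ (s.assign g x (ρ3 24)) (by omega) ?_ (ht.assign hcur x _) ?_))))))
      · intro y hy hyF
        refine (hi.inUse.batch.cnt_le hm.expanding hi.inUse.closed ?_ hm.load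
          (Net.nbrs_subset_right hx hy) hyF).trans_lt hm.load_lt
        have h1 := s.lay.card_recent_le (s.lay.cur g) (s.lay.ptr g (s.lay.cur g))
        have h2 := s.lay.ptr_lt hm.expanding.pos (s.lay.cur g)
        omega
      · have e32 : ρ3 32 = s.lay.cur g := by simpa using hfr3 32 (by omega)
        simp [e32]
        exact .select _ hfull h2 hsel
      · intro r hr
        rw [Function.update_of_ne (by omega), hfr3 r (by omega), Function.update_of_ne (by omega),
          Function.update_of_ne (by omega), elow r hr]
    · rw [hp3.r9] at h2
      simp [ind_eq_zero] at h2
      refine .rdr hf (by decide) (by decide) (by decide) (by simp [hcr.r44]; omega)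
        (by simp [e30]; omega) (.nil (.nil (hQ _ _ _ s (by omega) ?_ ht ?_)))
      · simp [hcr.r44, e30, ht.pl _ hcur]
        exact .reserved hfull h2
      · intro r hr
        rw [Function.update_of_ne (by omega), Function.update_of_ne (by omega),
          Function.update_of_ne (by omega), elow r hr]
  · rw [hp.r9] at h1
    obtain ⟨-, i, hil, h32, hfull, hy, hyo⟩ := hs.res.resolve_left fun h => h1 h.1
    refine .skip (.nil (hQ _ _ _ s (by omega) ?_ ht hs.frame))
    rw [h32]
    exact .level i _ hil hfull hy hyo

end DynMatch

/-! ### Programs for releasing and granting homes, for requests and for retractions. -/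

namespace DynMatch

open Finset

variable {g : Net} {z : Sizes} {A : ℕ → ℕ → ℕ} {ρ : ℕ → ℕ}
  {Q : ℕ → (ℕ → ℕ) → (ℕ → ℕ → ℕ) → Prop} {n l Λ d : ℕ} {s : St}

lemma Lay.ptr_congr {s s' : Lay} (h : s.nh = s'.nh) : s.ptr g = s'.ptr g := by
  funext k
  unfold ptr cur
  rw [h]

/-- Release the home of the left node in register `36`; the row of the occupied right nodes of its
kind is in register `33`. -/
def releaseHome : Prog := seqs [rdc 18 1 36, wrr 33 18 9, wrc 0 36 9]

lemma Run.releaseHome (hf : Fits g z) (hr : 16 ≤ z.rows) (ht : Tab g s A) {k u : ℕ}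
    (h36 : ρ 36 = u) (h33 : ρ 33 = 16 + 2 * k) (hk : 16 + 2 * k < z.rows) (hu : u < g.N)
    (hhy : s.lay.hy u < z.R)
    (hQ : ∀ n' ρ' A', n' ≤ n + 40 → Tab g { s with lay := s.lay.release k u } A' → Fr ρ ρ' →
      Q n' ρ' A') : Run g z releaseHome Q n ρ A := by
  refine .of_params fun hp => .cons (.rdc hf (by decide) (by omega) (by decide) (by omega)
    (.cons (.wrr hf (by decide) (by decide) (by decide) (by simp; omega) ?_
    (.cons (.wrc hf (by decide) (by omega) (by decide) (by simp; omega)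
      (.nil (hQ _ _ _ (by omega) ?_ ((Fr.refl ρ).set (by omega) _))))))))
  · simp [h36, ht.hy]
    omega
  · simp [h36, h33, ht.hy, hp.r9]
    exact (ht.eraseOcc k (s.lay.hy u)).updHl u 0

/-- Evict the node in the slot in register `35` of the ring whose row is in register `34`. -/
def evictSlot : Prog :=
  seqs [rdr 36 34 35, .ite (.eq 36 9) .skip (seqs [.instr (.sub 36 36 8), rdc 18 2 36,
    .ite (.eq 18 9) releaseHome (wrc 3 36 9), wrr 34 35 9])]

lemma Run.evictSlot (hm : Machine g z l Λ) (ok : s.lay.Ok g l) (ht : Tab g s A) {k p : ℕ}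
    (hk : k < l + 2) (hp : p < g.K) (h33 : ρ 33 = 16 + 2 * k) (h34 : ρ 34 = 17 + 2 * k)
    (h35 : ρ 35 = p)
    (hQ : ∀ n' ρ' A', n' ≤ n + 100 → Tab g { s with lay := s.lay.evict k p } A' →
      (∀ r, r < 16 ∨ 30 ≤ r → r ≠ 36 → ρ' r = ρ r) → Q n' ρ' A') : Run g z evictSlot Q n ρ A := by
  have hf := hm.fits
  have hrows := hm.rows
  have hK := hm.expanding.le
  refine .of_params fun hpar => .cons (.rdr hf (by decide) (by decide) (by decide) (by omega)
    (by omega) (.cons ?_))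
  simp [h34, h35, ht.ring]
  refine .ite_eq (by decide) (by decide) (fun h1 => ?_) fun h1 => ?_
  · simp [hpar.r9] at h1
    refine .skip (.nil (hQ _ _ _ (by omega) ?_ fun r _ hr => Function.update_of_ne hr _ _))
    rw [Lay.evict, if_pos h1]
    exact ht
  · simp [hpar.r9] at h1
    obtain ⟨u, hu⟩ : ∃ u, s.lay.ring k p = u + 1 := ⟨s.lay.ring k p - 1, by omega⟩
    obtain ⟨hhl, hinr⟩ := ok.ring_val k p u hp hu
    have huN : u < g.N := ok.lt u (by omega)
    have hhy : s.lay.hy u < z.R := hf.nbrs_lt huN (ok.hy_mem u (by omega))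
    refine .cons (.sub (by decide) (by decide) (by decide) (.cons ?_))
    simp [hpar.r8, hu]
    refine .rdc hf (by decide) (by omega) (by decide) (by simp; omega) (.cons ?_)
    simp [ht.act]
    have hslot : ∀ n' ρ' A' (s' : St), n' ≤ n + 80 → Tab g s' A' →
        { s with lay := s.lay.evict k p } =
          { s' with lay := s'.lay.clearSlot k p } →
        (∀ r, r < 16 ∨ 30 ≤ r → r ≠ 36 → ρ' r = ρ r) →
        Run g z (seqs [DynMatch.wrr 34 35 9])
          (fun n ρ A => Run g z (seqs []) Q n ρ A) n' ρ' A' := by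
      intro n' ρ' A' s' hn' ht' he hfr
      have e34 := hfr 34 (by omega) (by omega)
      have e35 := hfr 35 (by omega) (by omega)
      have e9 := hfr 9 (by omega) (by omega)
      refine .cons (.wrr hf (by decide) (by decide) (by decide) (by omega) (by omega)
        (.nil (.nil (hQ _ _ _ (by omega) ?_ hfr))))
      rw [he, e34, h34, e35, h35, e9, hpar.r9]
      exact ht'.updRing k p 0
    have hfr0 : ∀ r, r < 16 ∨ 30 ≤ r → r ≠ 36 → Function.update (Function.update ρ 36 u) 18
        (ind s.lay.act u) r = ρ r := fun r hr h36 => by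
      rw [Function.update_of_ne (by omega), Function.update_of_ne h36]
    refine .ite_eq (by decide) (by decide) (fun h2 => ?_) fun h2 => ?_
    · simp [hpar.r9, ind_eq_zero] at h2
      refine .releaseHome hf (by omega) ht (k := k) (u := u) (by simp) (by simpa) (by omega) huN hhy
        fun n' ρ' A' hn ht' hfr => ?_
      refine hslot _ _ _ _ (by omega) ht' ?_ fun r hr h36 => (hfr r hr).trans (hfr0 r hr h36)
      rw [Lay.evict, if_neg (by omega), hu, Nat.add_sub_cancel, if_neg h2]
    · simp [hpar.r9, ind_eq_zero] at h2
      refine .wrc hf (by decide) (by omega) (by decide) (by simp; omega) ?_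
      simp [hpar.r9]
      refine hslot _ _ _ _ (by omega) (ht.eraseInr u) ?_ hfr0
      rw [Lay.evict, if_neg (by omega), hu, Nat.add_sub_cancel, if_pos h2]

/-- Grant the right node in register `5`, in the kind in register `32`, to the left node in
register `30`. -/
def placeHome : Prog :=
  seqs [.instr (.const 18 16), .instr (.add 33 32 32), .instr (.add 33 18 33),
    .instr (.add 34 33 8), rdc 35 6 32, evictSlot,
    .instr (.add 18 32 8), wrc 0 30 18, wrc 1 30 5, wrc 2 30 8, wrc 3 30 8, wrr 33 5 8,
    .instr (.add 18 30 8), wrr 34 35 18, .instr (.add 35 35 8),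
    .ite (.eq 35 3) (seqs [.instr (.move 35 9), .instr (.const 18 2),
      .ite (.lt 32 18) (seqs [.instr (.sub 6 8 6), .instr (.const 18 4), .instr (.add 7 0 18),
        .instr (.mul 7 0 7)]) .skip]) .skip,
    wrc 6 32 35]

lemma Tab.put (h : Tab g s A) {k p x y : ℕ} {f : ℕ → ℕ} {s' : St}
    (hs' : s'.lay = s.lay.put l k p x y) (hcp : s'.cp = s.cp) (hS : s'.S = s.S) (hE : s'.E = s.E)
    (hf : s'.lay.ptr g = f) :
    Tab g s' (Function.update (upd (upd (upd (upd (upd (upd A 0 x (k + 1)) 1 x y) 2 x 1) 3 x 1)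
      (16 + 2 * k) y 1) (17 + 2 * k) p (x + 1)) 6 f) := by
  rw [← hf]
  have h1 := ((((((h.updHl x (k + 1)).updHy x y).insertAct x).insertInr x).insertOcc k y).updRing
    k p (x + 1))
  refine h1.setPtr ?_ ?_ ?_ ?_ ?_ ?_ hcp hS hE <;> rw [hs'] <;> rfl

lemma Run.placeHome (hm : Machine g z l Λ) (ok : s.lay.Ok g l) (ht : Tab g s A) {k x y : ℕ}
    (ha : s.lay.Arrive g l k x y) (h30 : ρ 30 = x) (h32 : ρ 32 = k) (h5 : ρ 5 = y)
    (h6 : ρ 6 = s.lay.cur g) (h7 : ρ 7 = s.rem)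
    (hQ : ∀ n' ρ' A', n' ≤ n + 300 → Tab g (s.place g l k x y) A' →
      ρ' 6 = (s.place g l k x y).lay.cur g → ρ' 7 = (s.place g l k x y).rem → ρ' 5 = y →
      (∀ r, r < 4 → ρ' r = ρ r) → Q n' ρ' A') :
    Run g z placeHome Q n ρ A := by
  have hf := hm.fits
  have hrows := hm.rows
  have h0 := hf.const
  have hadd := hm.add_lt
  have hcount := hf.count
  have hK := hm.expanding.pos
  have hKN := hm.expanding.le
  have hlev := hm.levels_le
  have hk := ha.kind
  have hxN := ha.lt
  have hyR := hf.nbrs_lt hxN ha.mem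
  have hp := s.lay.ptr_lt hK k
  have hcur := s.lay.cur_lt (g := g)
  have hplace := Lay.place_ptr (l := l) (x := x) (y := y) hK s.lay ha.cur
  have hplcur := Lay.place_cur (l := l) (x := x) (y := y) hK s.lay ha.cur
  have h100 : 2 * l + 20 < 2 ^ z.w := by
    have h1 := hf.addr
    have : z.rows * 1 ≤ z.rows * (g.N + z.R) := Nat.mul_le_mul_left _ (by omega)
    omega
  refine .of_params fun hpar => .cons (.const (by decide) (by omega) (.cons (.add (by decide)
    (by decide) (by decide) (by simp; omega) (.cons (.add (by decide) (by decide) (by decide)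
    (by simp; omega) (.cons (.add (by decide) (by decide) (by decide) (by simp [hpar.r8]; omega)
    (.cons (.rdc hf (by decide) (by omega) (by decide) (by simp; omega) (.cons ?_))))))))))
  simp [h32, hpar.r8, ht.ptr]
  refine .evictSlot hm ok ht hk hp (by simp; omega) (by simp; omega) (by simp)
    fun n₁ ρ₁ A₁ hn₁ ht₁ hfr => ?_
  have e5 : ρ₁ 5 = y := by rw [hfr 5 (by omega) (by omega)]; simpa
  have e6 : ρ₁ 6 = s.lay.cur g := by rw [hfr 6 (by omega) (by omega)]; simpa
  have e7 : ρ₁ 7 = s.rem := by rw [hfr 7 (by omega) (by omega)]; simpa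
  have e30 : ρ₁ 30 = x := by rw [hfr 30 (by omega) (by omega)]; simpa
  have e32 : ρ₁ 32 = k := by rw [hfr 32 (by omega) (by omega)]; simpa
  have e33 : ρ₁ 33 = 16 + 2 * k := by rw [hfr 33 (by omega) (by omega)]; simp; omega
  have e34 : ρ₁ 34 = 17 + 2 * k := by rw [hfr 34 (by omega) (by omega)]; simp; omega
  have e35 : ρ₁ 35 = s.lay.ptr g k := by rw [hfr 35 (by omega) (by omega)]; simp
  have elow : ∀ r, r < 4 → ρ₁ r = ρ r := by
    intro r hr
    rw [hfr r (by omega) (by omega), Function.update_of_ne (by omega),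
      Function.update_of_ne (by omega), Function.update_of_ne (by omega),
      Function.update_of_ne (by omega)]
  clear hfr
  refine .of_params fun hpar₁ => ?_
  have e8 := hpar₁.r8
  have e9 := hpar₁.r9
  have e0 := hpar₁.r0
  have e3 := hpar₁.r3
  refine .cons (.add (by decide) (by decide) (by decide) (by omega)
    (.cons (.wrc hf (by decide) (by omega) (by decide) (by simp; omega)
    (.cons (.wrc hf (by decide) (by omega) (by decide) (by simp; omega)
    (.cons (.wrc hf (by decide) (by omega) (by decide) (by simp; omega)
    (.cons (.wrc hf (by decide) (by omega) (by decide) (by simp; omega)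
    (.cons (.wrr hf (by decide) (by decide) (by decide) (by simp; omega) (by simp; omega)
    (.cons (.add (by decide) (by decide) (by decide) (by simp; omega)
    (.cons (.wrr hf (by decide) (by decide) (by decide) (by simp; omega) (by simp; omega)
    (.cons (.add (by decide) (by decide) (by decide) (by simp; omega)
    (.cons ?_))))))))))))))))))
  simp [e5, e30, e32, e33, e34, e35, e8]
  -- All branches end by storing the new pointer, which also makes the table agree with the
  -- increased counters.
  have hfinal : ∀ n₂ ρ₂ v, n₂ ≤ n + 280 → ρ₂ 32 = k → ρ₂ 35 = v →
      v = (if s.lay.ptr g k + 1 = g.K then 0 else s.lay.ptr g k + 1) →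
      ρ₂ 6 = (s.place g l k x y).lay.cur g → ρ₂ 7 = (s.place g l k x y).rem → ρ₂ 5 = y →
      (∀ r, r < 4 → ρ₂ r = ρ r) →
      Run g z (seqs [DynMatch.wrc 6 32 35]) Q n₂ ρ₂
        (upd (upd (upd (upd (upd (upd A₁ 0 x (k + 1)) 1 x y) 2 x 1) 3 x 1) (16 + 2 * k) y 1) (17 + 2 * k) (s.lay.ptr g k) (x + 1)) := by
    intro n₂ ρ₂ v hn₂ h32 h35 hv h6 h7 h5 hlow
    refine .cons (.wrc hf (by decide) (by omega) (by decide) (by omega)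
      (.nil (hQ _ _ _ (by omega) ?_ h6 h7 h5 hlow)))
    rw [h32, h35, upd]
    refine ht₁.put (l := l) rfl rfl rfl rfl ?_
    have eptr : A₁ 6 = s.lay.ptr g := by
      rw [ht₁.ptr]
      exact Lay.ptr_congr (s.lay.evict_nh _ _)
    funext k'
    rw [show (s.place g l k x y).lay = s.lay.place g l k x y from rfl, hplace, ← hv]
    by_cases hk' : k' = k
    · subst hk'
      simp
    · rw [if_neg hk', Function.update_of_ne hk']
      unfold upd
      rw [Function.update_of_ne (by omega), Function.update_of_ne (by omega),
        Function.update_of_ne (by omega), Function.update_of_ne (by omega),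
        Function.update_of_ne (by omega), Function.update_of_ne (by omega), eptr]
  have hlow₂ : ∀ v w r, r < 4 → Function.update (Function.update ρ₁ 18 v) 35 w r = ρ r := by
    intro v w r hr
    rw [Function.update_of_ne (by omega), Function.update_of_ne (by omega), elow r hr]
  refine .ite_eq (by decide) (by decide) (fun h1 => ?_) fun h1 => ?_
  · simp [e3] at h1
    refine .cons (.move (by decide) (by decide) (.cons (.const (by decide) (by omega) (.cons ?_))))
    refine .ite_lt (by decide) (by decide) (fun h2 => ?_) fun h2 => ?_
    · simp [e32] at h2
      have hwrap : k < 2 ∧ s.lay.ptr g k + 1 = g.K := ⟨by omega, h1⟩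
      rw [if_pos hwrap] at hplcur
      have hN4 : g.N + 4 ≤ g.N * (g.N + 4) := Nat.le_mul_of_pos_left _ (by omega)
      refine .cons (.sub (by decide) (by decide) (by decide) (.cons (.const (by decide) (by omega)
        (.cons (.add (by decide) (by decide) (by decide) (by simp; omega) (.cons (.mul (by decide)
        (by decide) (by decide) (by simp [e0]; omega) (.nil (.nil (hfinal _ _ 0 (by omega) ?_ ?_ ?_
        ?_ ?_ ?_ ?_))))))))))
      · simpa
      · simpa
      · rw [if_pos h1]
      · simp [e6, e8, St.place, hplcur]
      · simp [e0, St.place, hwrap, St.total]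
      · simpa
      · intro r hr
        rw [Function.update_of_ne (by omega), Function.update_of_ne (by omega),
          Function.update_of_ne (by omega), Function.update_of_ne (by omega),
          Function.update_of_ne (by omega), Function.update_of_ne (by omega), hlow₂ _ _ r hr]
    · simp [e32] at h2
      have hwrap : ¬(k < 2 ∧ s.lay.ptr g k + 1 = g.K) := fun h => by omega
      rw [if_neg hwrap] at hplcur
      refine .skip (.nil (hfinal _ _ 0 (by omega) ?_ ?_ ?_ ?_ ?_ ?_ ?_))
      · simpa
      · simpa
      · rw [if_pos h1]
      · simp [e6, St.place, hplcur]
      · simp only [St.place, if_neg hwrap]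
        simpa
      · simpa
      · intro r hr
        rw [Function.update_of_ne (by omega), Function.update_of_ne (by omega), hlow₂ _ _ r hr]
  · simp [e3] at h1
    have hwrap : ¬(k < 2 ∧ s.lay.ptr g k + 1 = g.K) := fun h => h1 h.2
    rw [if_neg hwrap] at hplcur
    refine .skip (hfinal _ _ (s.lay.ptr g k + 1) (by omega) ?_ ?_ ?_ ?_ ?_ ?_ ?_)
    · simpa
    · simp
    · rw [if_neg h1]
    · simp [e6, St.place, hplcur]
    · simp only [St.place, if_neg hwrap]
      simpa
    · simpa
    · exact hlow₂ _ _

/-- Process a request, after the parameters are computed. -/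
def requestBody : Prog :=
  seqs [rdc 18 0 4, .ite (.eq 18 9) (seqs [background, .instr (.move 30 4), choose, placeHome])
    (seqs [wrc 2 4 8, rdc 5 1 4])]

/-- A node that still has a home only becomes active again: no arrival is counted and no renewal
step is made. Otherwise one renewal step and one arrival go together, which keeps the credit of the
epoch balanced. -/
lemma Run.requestBody (hm : Machine g z l Λ) (hl : 1 ≤ l) (hG : St.total g ≤ 2 ^ (l - 1))
    (hi : s.Inv g l Λ 0) (ht : Tab g s A) {x : ℕ} (hx : x < g.N) (h4 : ρ 4 = x)
    (h6 : ρ 6 = s.lay.cur g) (h7 : ρ 7 = s.rem) (hcard : (insert x s.lay.act).card ≤ g.K)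
    (hQ : ∀ n' ρ' A' s', n' ≤ n + 1000 * (g.D * (l + 1)) → St.Inv g l Λ 0 s' → Tab g s' A' →
      ρ' 6 = s'.lay.cur g → ρ' 7 = s'.rem → (∀ r, r < 4 → ρ' r = ρ r) →
      s'.lay.act = insert x s.lay.act → (∀ u ∈ s.lay.act, s'.lay.hy u = s.lay.hy u) →
      ρ' 5 = s'.lay.hy x → Q n' ρ' A') : Run g z requestBody Q n ρ A := by
  have hf := hm.fits
  have hrows := hm.rows
  have hK := hm.expanding.pos
  have hD : 6 ≤ g.D := hm.expanding.six_le
  have hDl : g.D ≤ g.D * l := Nat.le_mul_of_pos_right _ hl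
  have hDl' : 6 * l ≤ g.D * l := Nat.mul_le_mul_right _ hD
  rw [mul_add, mul_one] at hQ
  refine .of_params fun hpar => .cons (.rdc hf (by decide) (by omega) (by decide) (by omega)
    (.cons ?_))
  refine .ite_eq (by decide) (by decide) (fun h1 => ?_) fun h1 => ?_
  · simp [h4, hpar.r9, ht.hl] at h1
    refine .cons (.background hm hi ht (by simpa) (by simpa) fun n₁ ρ₁ A₁ s₁ hn₁ hb ht₁ h7₁ hfr₁ =>
      .cons (.move (by decide) (by decide) (.cons ?_)))
    obtain ⟨hi₁, hlay⟩ := hi.bg hm.expanding hm.load hb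
    have e4 : ρ₁ 4 = x := by rw [hfr₁ 4 (by omega) (by omega)]; simpa
    have e6 : ρ₁ 6 = s₁.lay.cur g := by rw [hfr₁ 6 (by omega) (by omega), hlay]; simpa
    refine .choose hm hi₁ ht₁ hx (by simpa) (by simpa) fun n₂ ρ₂ A₂ s₂ hn₂ hc ht₂ hfr₂ => .cons ?_
    rw [← hlay] at h1 hcard
    have ha := hc.arrive hi₁ h1 hx hcard
    rw [← hc.lay] at ha
    have hinv := St.Inv.place hm.expanding hl hG hi₁ hc h1 hx hcard
    refine .placeHome hm (by rw [hc.lay]; exact hi₁.ok) ht₂ ha ?_ rfl rfl ?_ ?_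
      fun n₃ ρ₃ A₃ hn₃ ht₃ h6₃ h7₃ h5₃ hlow => .nil (.nil (hQ _ _ _ _ ?_ hinv ht₃ h6₃ h7₃ ?_ ?_ ?_
        ?_))
    · rw [hfr₂ 30 (by omega)]; simpa
    · rw [hfr₂ 6 (by omega), hc.lay]; simpa
    · rw [hfr₂ 7 (by omega), hc.sets.2.2]; simpa
    · have e : (40 * g.D + 50) * l = 40 * (g.D * l) + 50 * l := by ring
      omega
    · intro r hr
      rw [hlow r hr, hfr₂ r (by omega), Function.update_of_ne (by omega),
        hfr₁ r (by omega) (by omega), Function.update_of_ne (by omega)]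
    · simp [St.place, Lay.place_act, hc.lay, hlay]
    · intro u hu
      have hux : u ≠ x := by
        rintro rfl
        exact hi.ok.act_hl u hu (hlay ▸ h1)
      simp only [St.place]
      rw [Lay.place_hy_of_ne _ hux, hc.lay, hlay]
    · rw [h5₃]
      exact (Lay.place_hy_self _ _ _ _).symm
  · simp [h4, hpar.r9, ht.hl] at h1
    refine .cons (.wrc hf (by decide) (by omega) (by decide) (by simp; omega)
      (.cons (.rdc hf (by decide) (by omega) (by decide) (by simp; omega)
      (.nil (.nil (hQ _ _ _ _ (by omega) (hi.touch hK h1 hcard) ?_ ?_ ?_ ?_ rfl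
        (fun _ _ => rfl) ?_))))))
    · simp [h4, hpar.r8]
      exact ht.insertAct x
    · simp [h6, Lay.cur]
    · simpa
    · intro r hr
      rw [Function.update_of_ne (by omega), Function.update_of_ne (by omega)]
    · have e : upd A 2 x 1 1 = A 1 := Function.update_of_ne (by omega) _ _
      simp [h4, hpar.r8, e, ht.hy]

/-- Process a retraction, after the parameters are computed. -/
def retractBody : Prog :=
  seqs [wrc 2 4 9, rdc 18 3 4, .ite (.eq 18 9) (seqs [rdc 18 0 4, .instr (.add 19 18 18),
    .instr (.const 20 14), .instr (.add 33 20 19), .instr (.move 36 4), releaseHome]) .skip]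

lemma Run.retractBody (hm : Machine g z l Λ) (hi : s.Inv g l Λ 0) (ht : Tab g s A) {x : ℕ}
    (hx : x ∈ s.lay.act) (h4 : ρ 4 = x) (h6 : ρ 6 = s.lay.cur g) (h7 : ρ 7 = s.rem)
    (hQ : ∀ n' ρ' A' s', n' ≤ n + 200 → St.Inv g l Λ 0 s' → Tab g s' A' →
      ρ' 6 = s'.lay.cur g → ρ' 7 = s'.rem → (∀ r, r < 4 → ρ' r = ρ r) →
      s'.lay.act = s.lay.act.erase x → s'.lay.hy = s.lay.hy → Q n' ρ' A') :
    Run g z retractBody Q n ρ A := by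
  have hf := hm.fits
  have hrows := hm.rows
  have h0 := hf.const
  have hK := hm.expanding.pos
  have hlx := hi.ok.act_hl x hx
  have hxN := hi.ok.lt x hlx
  have hhl := hi.ok.hl_le x
  have hlev := hm.levels_le
  have hyR := hf.nbrs_lt hxN (hi.ok.hy_mem x hlx)
  have h100 : 2 * l + 20 < 2 ^ z.w := by
    have h1 := hf.addr
    have : z.rows * 1 ≤ z.rows * (g.N + z.R) := Nat.mul_le_mul_left _ (by omega)
    omega
  have hinv := hi.retract hK hx
  refine .of_params fun hpar => .cons (.wrc hf (by decide) (by omega) (by decide) (by omega)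
    (.cons (.rdc hf (by decide) (by omega) (by decide) (by omega) (.cons ?_))))
  have e3 : upd A 2 x 0 3 = A 3 := Function.update_of_ne (by omega) _ _
  have e0 : upd A 2 x 0 0 = A 0 := Function.update_of_ne (by omega) _ _
  simp [h4, hpar.r9, e3, ht.inr]
  have ht₁ := ht.eraseAct x
  have hdone : ∀ n' ρ' A', n' ≤ n + 150 → Tab g { s with lay := s.lay.retract x } A' →
      (∀ r, r < 8 → ρ' r = ρ r) → Run g z (seqs []) Q n' ρ' A' := by
    intro n' ρ' A' hn' ht' hlow
    refine .nil (hQ _ _ _ _ (by omega) hinv ht' ?_ ?_ (fun r hr => hlow r (by omega)) ?_ ?_)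
    · rw [hlow 6 (by omega), h6]
      exact (s.lay.cur_retract x).symm
    · rw [hlow 7 (by omega), h7]
    · exact s.lay.retract_act x
    · exact s.lay.retract_hy x
  refine .ite_eq (by decide) (by decide) (fun h1 => ?_) fun h1 => ?_
  · simp [hpar.r9, ind_eq_zero] at h1
    refine .cons (.rdc hf (by decide) (by omega) (by decide) (by simp; omega) (.cons ?_))
    simp [h4, e0, ht.hl]
    -- The stored value is the kind plus one, so `14` plus twice this value is the row `16 + 2 * k`
    -- of the occupied right nodes.
    refine .add (by decide) (by decide) (by decide) (by simp; omega) (.cons (.const (by decide)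
      (by omega) (.cons (.add (by decide) (by decide) (by decide) (by simp; omega)
      (.cons (.move (by decide) (by decide) (.cons (.releaseHome hf (by omega) ht₁
        (k := s.lay.hl x - 1) (u := x) (by simpa) (by simp; omega) (by omega) hxN hyR
        fun n' ρ' A' hn ht' hfr => .nil (hdone _ _ _ (by omega) ?_ ?_)))))))))
    · rw [Lay.retract, if_neg h1]
      exact ht'
    · intro r hr
      rw [hfr r (by omega), Function.update_of_ne (by omega), Function.update_of_ne (by omega),
        Function.update_of_ne (by omega), Function.update_of_ne (by omega),
        Function.update_of_ne (by omega)]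
  · simp [hpar.r9, ind_eq_zero] at h1
    refine .skip (hdone _ _ _ (by omega) ?_ fun r hr => Function.update_of_ne (by omega) _ _)
    rw [Lay.retract, if_pos h1]
    exact ht₁

end DynMatch

namespace DynMatch

open Finset

/-! ### The data structure -/

/-- Compute the parameters. -/
def computeParams : Prog :=
  .seq (.instr (.const 8 1)) (.seq (.instr (.const 9 0)) (.seq (.instr (.mul 10 0 1))
    (.instr (.add 11 0 2))))

/-- The data structure. -/
def dataStructure : DataStructure where
  request := .seq computeParams requestBody
  retract := .seq computeParams retractBody

variable {g : Net} {z : Sizes} {l Λ : ℕ} {st : St} {s : Store}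

/-- The store represents the state, between operations. -/
structure Sound (g : Net) (z : Sizes) (l Λ : ℕ) (st : St) (s : Store) : Prop where
  inv : st.Inv g l Λ 0
  tab : ∃ A, Tab g st A ∧ Holds g z A s.mem
  r0 : s.reg 0 = g.N
  r1 : s.reg 1 = g.D
  r2 : s.reg 2 = z.R
  r3 : s.reg 3 = g.K
  r6 : s.reg 6 = st.lay.cur g
  r7 : s.reg 7 = st.rem

lemma Sound.setReg (h : Sound g z l Λ st s) {d : ℕ} (hd : d = 4 ∨ d = 5) (v : ℕ) :
    Sound g z l Λ st (s.setReg d v) := by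
  have e : ∀ r, r ≠ 4 → r ≠ 5 → (s.setReg d v).reg r = s.reg r :=
    fun r h4 h5 => Function.update_of_ne (by omega) _ _
  exact ⟨h.inv, h.tab, by rw [e 0 (by omega) (by omega), h.r0],
    by rw [e 1 (by omega) (by omega), h.r1], by rw [e 2 (by omega) (by omega), h.r2],
    by rw [e 3 (by omega) (by omega), h.r3], by rw [e 6 (by omega) (by omega), h.r6],
    by rw [e 7 (by omega) (by omega), h.r7]⟩

lemma Sound.computeParams (hm : Machine g z l Λ) (h : Sound g z l Λ st s) {x : ℕ}
    (h4 : s.reg 4 = x) {p : Prog} {Q : ℕ → Store → Prop}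
    (hp : ∀ ρ A, Tab g st A → ρ 4 = x → ρ 6 = st.lay.cur g → ρ 7 = st.rem →
      Run g z p (fun n ρ' A' => ∀ s', Rep g z ρ' A' s' → Q n s') 8 ρ A) :
    WP z.w (.seq DynMatch.computeParams p) Q 0 s := by
  obtain ⟨A, ht, hh⟩ := h.tab
  have h1 := hm.fits.const
  have h2 := hm.fits.addr
  have h3 := hm.add_lt
  have hw1 : 1 < 2 ^ z.w := by omega
  refine .seq (.seq (.instr (.seq (.instr (.seq (.instr (.instr ?_)))))))
  set s₁ := Instr.exec z.w (Instr.exec z.w (Instr.exec z.w (Instr.exec z.w s (.const 8 1))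
    (.const 9 0)) (.mul 10 0 1)) (.add 11 0 2) with hs₁
  have e : ∀ r, (r < 8 ∨ 11 < r) → s₁.reg r = s.reg r := by
    intro r hr
    simp only [hs₁, Instr.exec, Store.setReg]
    rw [Function.update_of_ne (by omega), Function.update_of_ne (by omega),
      Function.update_of_ne (by omega), Function.update_of_ne (by omega)]
  have hrep : Rep g z s₁.reg A s₁ := by
    refine ⟨⟨?_, ?_, ?_, ?_, ?_, ?_, ?_, ?_⟩, hh, fun _ _ => rfl⟩
    · rw [e 0 (by omega), h.r0]
    · rw [e 1 (by omega), h.r1]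
    · rw [e 2 (by omega), h.r2]
    · rw [e 3 (by omega), h.r3]
    · simp [hs₁, Instr.exec, Store.setReg, Nat.mod_eq_of_lt hw1]
    · simp [hs₁, Instr.exec, Store.setReg]
    · simp only [hs₁, Instr.exec, Store.setReg]
      simp [h.r0, h.r1]
      exact Nat.mod_eq_of_lt (by omega)
    · simp only [hs₁, Instr.exec, Store.setReg]
      simp [h.r0, h.r2]
      exact Nat.mod_eq_of_lt h3
  refine (hp s₁.reg A ht ?_ ?_ ?_ s₁ hrep).mono fun n s' ⟨ρ', A', h5, h6⟩ => h6 s' h5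
  · rw [e 4 (by omega), h4]
  · rw [e 6 (by omega), h.r6]
  · rw [e 7 (by omega), h.r7]

lemma Rep.sound {ρ : ℕ → ℕ} {A : ℕ → ℕ → ℕ} (h : Rep g z ρ A s) (hi : st.Inv g l Λ 0)
    (ht : Tab g st A) (h6 : ρ 6 = st.lay.cur g) (h7 : ρ 7 = st.rem) : Sound g z l Λ st s :=
  ⟨hi, ⟨A, ht, h.holds⟩, by rw [h.reg 0 (by omega), h.params.r0],
    by rw [h.reg 1 (by omega), h.params.r1], by rw [h.reg 2 (by omega), h.params.r2],
    by rw [h.reg 3 (by omega), h.params.r3], by rw [h.reg 6 (by omega), h6],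
    by rw [h.reg 7 (by omega), h7]⟩

lemma Sound.request (hm : Machine g z l Λ) (hl : 1 ≤ l) (hG : St.total g ≤ 2 ^ (l - 1))
    (h : Sound g z l Λ st s) {x : ℕ} (hx : x < g.N) (h4 : s.reg 4 = x)
    (hcard : (insert x st.lay.act).card ≤ g.K) :
    WP z.w dataStructure.request (fun n s' => n ≤ 1000 * (g.D * (l + 1)) + 8 ∧
      ∃ st' : St, Sound g z l Λ st' s' ∧ st'.lay.act = insert x st.lay.act ∧
        (∀ u ∈ st.lay.act, st'.lay.hy u = st.lay.hy u) ∧ s'.reg 5 = st'.lay.hy x) 0 s := by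
  refine h.computeParams hm h4 fun ρ A ht e4 e6 e7 => ?_
  refine .requestBody hm hl hG h.inv ht hx e4 e6 e7 hcard
    fun n' ρ' A' st' hn hi' ht' h6 h7 _ hact hhy h5 s' hs' => ?_
  refine ⟨by omega, st', hs'.sound hi' ht' h6 h7, hact, hhy, ?_⟩
  rw [hs'.reg 5 (by omega), h5]

lemma Sound.retract (hm : Machine g z l Λ) (h : Sound g z l Λ st s) {x : ℕ}
    (hx : x ∈ st.lay.act) (h4 : s.reg 4 = x) :
    WP z.w dataStructure.retract (fun n s' => n ≤ 208 ∧ ∃ st' : St, Sound g z l Λ st' s' ∧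
      st'.lay.act = st.lay.act.erase x ∧ st'.lay.hy = st.lay.hy) 0 s := by
  refine h.computeParams hm h4 fun ρ A ht e4 e6 e7 => ?_
  exact .retractBody hm h.inv ht hx e4 e6 e7 fun n' ρ' A' st' hn hi' ht' h6 h7 _ hact hhy s' hs' =>
    ⟨by omega, st', hs'.sound hi' ht' h6 h7, hact, hhy⟩

/-! ### Strategies from data structures -/

section Strategy

variable {N D R K ℓ τ w : ℕ} {G : LeftRegularGraph N D R} {P : DataStructure}

/-- A turn of Requester removes a whole set of edges; the data structure simulates it by single
retractions. -/
lemma Reachable.sdiff (h : P.PlaysWithin G K ℓ τ w) {s : Store} {M : Finset (Fin N × Fin R)}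
    (hM : Reachable P G K w s M) (T : Finset (Fin N × Fin R)) :
    ∃ s', Reachable P G K w s' (M \ T) := by
  induction T using Finset.induction_on with
  | empty => exact ⟨s, by simpa⟩
  | insert e T _ ih =>
    obtain ⟨s₁, h₁⟩ := ih
    rw [sdiff_insert]
    by_cases he : e ∈ M \ T
    · obtain ⟨s₂, h₂⟩ := h.retract _ _ h₁ e.1 e.2 he
      exact ⟨s₂, .retract e.1 e.2 h₁ he h₂⟩
    · rw [erase_eq_of_notMem he]
      exact ⟨s₁, h₁⟩

/-- The positions when Matcher answers by a fixed function of the position and the request. -/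
def replies (f : Finset (Fin N × Fin R) → Fin N → Option (Fin N × Fin R)) :
    List (Turn N R) → Finset (Fin N × Fin R)
  | [] => ∅
  | u :: h => addReply (replies f h \ u.removed) (f (replies f h \ u.removed) u.request)

/-- The strategy that answers by a fixed function of the position and the request. -/
def positional (f : Finset (Fin N × Fin R) → Fin N → Option (Fin N × Fin R)) : Strategy N R
  | [] => none
  | u :: h => f (replies f h \ u.removed) u.request

lemma position_positional (f : Finset (Fin N × Fin R) → Fin N → Option (Fin N × Fin R))
    (h : List (Turn N R)) : position (positional f) h = replies f h := by
  induction h with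
  | nil => rfl
  | cons u h ih => rw [position, ih, replies, positional]

/-- A data structure that plays the game yields a strategy. -/
lemma DataStructure.PlaysWithin.hasDynamicMatching (h : P.PlaysWithin G K ℓ τ w) :
    G.HasDynamicMatching K ℓ := by
  -- The strategy need not remember the store: for each edge set that occurs with some reachable
  -- store, it can answer by any such store, as every one leads to a safe reply and again to a
  -- reachable pair.
  have key : ∀ M : Finset (Fin N × Fin R), ∀ x, ∃ e : Option (Fin N × Fin R),
      (∃ s, Reachable P G K w s M) → M.card + 1 ≤ K → ∃ y, e = some (x, y) ∧ y ∈ G.neighbors x ∧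
        (∀ v, load (insert (x, y) M) v ≤ ℓ) ∧ ∃ s, Reachable P G K w s (insert (x, y) M) := by
    intro M x
    by_cases hM : (∃ s, Reachable P G K w s M) ∧ M.card + 1 ≤ K
    · obtain ⟨⟨s, hs⟩, hK⟩ := hM
      obtain ⟨s', h1, y, h2, h3, h4⟩ := h.request s M hs hK x
      exact ⟨some (x, y), fun _ _ => ⟨y, rfl, h3, h4, s', .request x y hs hK h1 h2⟩⟩
    · exact ⟨none, fun h1 h2 => absurd ⟨h1, h2⟩ hM⟩
  choose f hf using key
  have hreach : ∀ t : List (Turn N R), LegalPlay K (positional f) t →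
      ∃ s, Reachable P G K w s (replies f t) := by
    intro t
    induction t with
    | nil => exact fun _ => ⟨_, .start⟩
    | cons u t ih =>
      rintro ⟨h1, -, h3⟩
      rw [position_positional] at h3
      obtain ⟨s, hs⟩ := ih h1
      obtain ⟨y, h4, -, -, h5⟩ := hf _ u.request (hs.sdiff h _) h3
      rw [replies, h4]
      exact h5
  refine ⟨positional f, fun u t ⟨h1, _, h3⟩ => ?_⟩
  rw [position_positional] at h3
  obtain ⟨s, hs⟩ := hreach t h1
  obtain ⟨y, h4, h5, h6, -⟩ := hf _ u.request (hs.sdiff h _) h3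
  have e : positional f (u :: t) = some (u.request, y) := h4
  have e' : position (positional f) (u :: t) = insert (u.request, y) (replies f t \ u.removed) := by
    rw [position_positional, replies, h4]
    rfl
  rw [e, e']
  refine ⟨fun e he => ?_, ⟨y, mem_insert_self _ _⟩, h6⟩
  obtain rfl := Option.some_injective _ he
  exact h5

end Strategy

end DynMatch

/-! ### The given graph, the constants, and the invariant of the play. -/

namespace DynMatch

open Finset

section Graph

variable {N D R : ℕ} (G : LeftRegularGraph N D R) (K : ℕ)

/-- The graph on natural numbers. -/
def LeftRegularGraph.net : Net where
  N := N
  D := D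
  K := min K N
  nb x j := if h : x < N ∧ j < D then G.nbr ⟨x, h.1⟩ ⟨j, h.2⟩ else 0

variable {G K}

lemma net_nb (x : Fin N) (j : Fin D) : (G.net K).nb x j = G.nbr x j := by
  simp [LeftRegularGraph.net]

lemma mem_net_nbrs {x : Fin N} {v : ℕ} :
    v ∈ (G.net K).nbrs x ↔ ∃ y ∈ G.neighbors x, (y : ℕ) = v := by
  rw [mem_nbrs]
  constructor
  · rintro ⟨j, hj, rfl⟩
    exact ⟨G.nbr x ⟨j, hj⟩, mem_map_of_mem _ (mem_univ _), (net_nb x ⟨j, hj⟩).symm⟩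
  · rintro ⟨y, hy, rfl⟩
    obtain ⟨j, -, rfl⟩ := mem_map.1 hy
    exact ⟨j, j.2, net_nb x j⟩

lemma card_neighbors (x : Fin N) : (G.neighbors x).card = D := by
  simp [LeftRegularGraph.neighbors]

lemma net_expanding (hN : 2 ≤ N) (hK : 1 ≤ K) (hG : G.HasExpansion (2 / 3 * (D : ℝ) + 2) K) :
    (G.net K).Expanding where
  six_le := by
    -- A single left node has `D` neighbours, so expansion gives `D ≥ 2D/3 + 2`, that is `D ≥ 6`.
    have h := hG {⟨0, by omega⟩} (by simpa)
    rw [LeftRegularGraph.neighborSet, singleton_biUnion, card_neighbors, card_singleton] at h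
    have : (6 : ℝ) ≤ D := by
      push_cast at h
      linarith
    exact_mod_cast this
  pos := le_min hK (by omega)
  -- The capacity is cut down to `min K N`, so that the `N` passes of the closure suffice; at most
  -- `N` left nodes can be active anyway.
  le := min_le_right _ _
  inj := by
    intro x hx i hi j hj h
    have hi' : i < D := by simpa [LeftRegularGraph.net] using hi
    have hj' : j < D := by simpa [LeftRegularGraph.net] using hj
    have h1 := net_nb (G := G) (K := K) ⟨x, hx⟩ ⟨i, hi'⟩
    have h2 := net_nb (G := G) (K := K) ⟨x, hx⟩ ⟨j, hj'⟩
    have h3 : G.nbr ⟨x, hx⟩ ⟨i, hi'⟩ = G.nbr ⟨x, hx⟩ ⟨j, hj'⟩ :=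
      Fin.ext (h1.symm.trans (h.trans h2))
    exact congrArg Fin.val ((G.nbr ⟨x, hx⟩).injective h3)
  expand := by
    intro S hS hc
    have hSN : ∀ x ∈ S, x < N := fun x hx => mem_range.1 (hS hx)
    have hcard : (S.attachFin hSN).card = S.card := card_attachFin _ _
    have h := hG (S.attachFin hSN) (hcard.trans_le (hc.trans (min_le_left _ _)))
    have e : (G.net K).nbrsOf S = (G.neighborSet (S.attachFin hSN)).map Fin.valEmbedding := by
      ext v
      simp only [Net.nbrsOf, mem_biUnion, mem_map, LeftRegularGraph.neighborSet, mem_attachFin,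
        Fin.valEmbedding_apply]
      constructor
      · rintro ⟨x, hx, hv⟩
        obtain ⟨y, hy, rfl⟩ := mem_net_nbrs.1
          (show v ∈ (G.net K).nbrs (⟨x, hSN x hx⟩ : Fin N) from hv)
        exact ⟨y, ⟨_, hx, hy⟩, rfl⟩
      · rintro ⟨y, ⟨x, hx, hy⟩, rfl⟩
        exact ⟨x, hx, mem_net_nbrs.2 ⟨y, hy, rfl⟩⟩
    rw [e, card_map]
    rw [hcard] at h
    have : ((2 * D + 6 : ℕ) : ℝ) * (S.card : ℝ) ≤
        3 * ((G.neighborSet (S.attachFin hSN)).card : ℝ) := by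
      push_cast
      linarith
    exact_mod_cast this

/-- The choice of constants. The number `l` of levels makes `2 ^ (l - 1)` at least the length of a
renewal and is `O(log N)`; `Λ = log N + 1` gives `4 ^ Λ > 2N`, which suffices for `2K`; words of `3
* clog (N + R)` bits can address the table and hold all counters. -/
lemma machine (hN : 2 ≤ N) (hg : (G.net K).Expanding) (hR : D ≤ R) :
    Machine (G.net K) ⟨R, 20 + 2 * Nat.clog 2 (2 * (N * (N + 4))), 3 * Nat.clog 2 (N + R)⟩
        (Nat.clog 2 (2 * (N * (N + 4)))) (Nat.log 2 N + 1) ∧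
      1 ≤ Nat.clog 2 (2 * (N * (N + 4))) ∧
      St.total (G.net K) ≤ 2 ^ (Nat.clog 2 (2 * (N * (N + 4))) - 1) ∧
      Nat.clog 2 (2 * (N * (N + 4))) ≤ 2 * Nat.log 2 N + 4 := by
  have hD : 6 ≤ D := hg.six_le
  set l := Nat.clog 2 (2 * (N * (N + 4))) with hl
  set L := Nat.log 2 N with hL
  have hL1 : 1 ≤ L := Nat.log_pos (by omega) hN
  have hNL : N < 2 ^ (L + 1) := Nat.lt_pow_succ_log_self (by omega) N
  have hLN : 2 ^ L ≤ N := Nat.pow_log_le_self 2 (by omega)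
  have h2L : 2 * L ≤ 2 ^ L := by
    rcases Nat.exists_eq_succ_of_ne_zero (show L ≠ 0 by omega) with ⟨m, hm⟩
    rw [hm, pow_succ]
    have := Nat.lt_two_pow_self (n := m)
    omega
  have hlL : l ≤ 2 * L + 4 := by
    refine Nat.clog_le_of_le_pow ?_
    have h1 : N + 4 ≤ 2 * 2 ^ (L + 1) := by
      have : 2 ^ 1 ≤ 2 ^ L := Nat.pow_le_pow_right (by omega) hL1
      rw [pow_succ] at hNL ⊢
      omega
    calc 2 * (N * (N + 4)) ≤ 2 * (2 ^ (L + 1) * (2 * 2 ^ (L + 1))) :=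
          Nat.mul_le_mul_left _ (Nat.mul_le_mul hNL.le h1)
      _ = 2 ^ (2 * L + 4) := by ring
  have hN12 : 12 ≤ N * (N + 4) := Nat.mul_le_mul hN (show 6 ≤ N + 4 by omega)
  have hl1 : 1 ≤ l := Nat.clog_pos (by omega) (by omega)
  have hpow : 2 * (N * (N + 4)) ≤ 2 ^ l := Nat.le_pow_clog (by omega) _
  have hw : (N + R) ^ 3 ≤ 2 ^ (3 * Nat.clog 2 (N + R)) := by
    rw [mul_comm, pow_mul]
    exact Nat.pow_le_pow_left (Nat.le_pow_clog (by omega) _) 3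
  -- Here `N + R ≥ 8`, because `N ≥ 2` and `R ≥ D ≥ 6`.
  have hm8 : 8 * ((N + R) * (N + R)) ≤ (N + R) ^ 3 := by
    rw [pow_succ, pow_two, mul_comm]
    exact Nat.mul_le_mul_left _ (by omega)
  have hm64 : 8 * (N + R) ≤ (N + R) * (N + R) := Nat.mul_le_mul_right _ (by omega)
  refine ⟨⟨hg, ⟨?_, ?_, ?_, ?_, ?_⟩, le_rfl, ?_, ?_, ?_, ?_⟩, hl1, ?_, hlL⟩
  · have h1 : N * D ≤ (N + R) * (N + R) := Nat.mul_le_mul (by omega) (by omega)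
    have h2 : (20 + 2 * l) * (N + R) ≤ 5 * (N + R) * (N + R) := Nat.mul_le_mul_right _ (by omega)
    rw [mul_assoc] at h2
    simp only [LeftRegularGraph.net]
    omega
  · have h1 : N * (N + 4) ≤ (N + R) * (N + R) := Nat.mul_le_mul (by omega) (by omega)
    simp only [LeftRegularGraph.net]
    omega
  · simp only [LeftRegularGraph.net]
    omega
  · simp only
    omega
  · intro x hx j hj
    rw [net_nb (⟨x, hx⟩ : Fin N) (⟨j, hj⟩ : Fin D)]
    exact Fin.is_lt _
  · have h1 : 2 * 2 ^ (L + 1) ≤ 4 ^ (L + 1) := by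
      rw [show (4 : ℕ) = 2 * 2 from rfl, mul_pow]
      refine Nat.mul_le_mul_right _ ?_
      rw [pow_succ]
      have := Nat.one_le_two_pow (n := L)
      omega
    have h2 : (G.net K).K ≤ N := min_le_right _ _
    omega
  · simp only [LeftRegularGraph.net]
    omega
  · simp only [LeftRegularGraph.net]
    omega
  · exact fun i => (Nat.lt_clog_iff_pow_lt (by omega)).symm
  · obtain ⟨m, hm⟩ : ∃ m, l = m + 1 := ⟨l - 1, by omega⟩
    rw [hm, pow_succ] at hpow
    rw [hm, Nat.add_sub_cancel]
    simp only [St.total, LeftRegularGraph.net]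
    omega

variable {z : Sizes} {l Λ : ℕ}

/-- The edge set of a state. -/
def Matches (M : Finset (Fin N × Fin R)) (st : St) : Prop :=
  ∀ (x : Fin N) (y : Fin R), (x, y) ∈ M ↔ (x : ℕ) ∈ st.lay.act ∧ st.lay.hy x = y

lemma Matches.card {M : Finset (Fin N × Fin R)} {st : St} (h : Matches M st)
    (hm : Machine (G.net K) z l Λ) (hz : z.R = R) (ok : st.lay.Ok (G.net K) l) :
    st.lay.act.card ≤ M.card := by
  have : st.lay.act ⊆ M.image fun e => (e.1 : ℕ) := by
    intro x hx
    have hl := ok.act_hl x hx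
    have hxN := ok.lt x hl
    have hy := hm.fits.nbrs_lt hxN (ok.hy_mem x hl)
    rw [hz] at hy
    exact mem_image.2 ⟨(⟨x, hxN⟩, ⟨st.lay.hy x, hy⟩), (h _ _).2 ⟨hx, rfl⟩, rfl⟩
  exact (card_le_card this).trans card_image_le

lemma Matches.card_insert {M : Finset (Fin N × Fin R)} {st : St} (h : Matches M st)
    (hm : Machine (G.net K) z l Λ) (hz : z.R = R) (ok : st.lay.Ok (G.net K) l) (hK : M.card + 1 ≤ K)
    (x : Fin N) : (insert (x : ℕ) st.lay.act).card ≤ (G.net K).K := by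
  refine le_min ?_ ?_
  · have h1 := h.card hm hz ok
    have h2 := card_insert_le (x : ℕ) st.lay.act
    omega
  · have h1 : insert (x : ℕ) st.lay.act ⊆ range N := insert_subset (mem_range.2 x.2) fun u hu =>
      mem_range.2 (ok.lt u (ok.act_hl u hu))
    simpa using card_le_card h1

lemma Matches.load_le {M : Finset (Fin N × Fin R)} {st : St} (h : Matches M st) (y : Fin R) :
    load M y ≤ (st.lay.act.filter fun x => st.lay.hy x = y).card := by
  refine card_le_card_of_injOn (fun e => (e.1 : ℕ)) ?_ ?_
  · rintro ⟨x, y'⟩ he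
    obtain ⟨hM, hy⟩ := mem_filter.1 he
    obtain rfl : y' = y := hy
    exact mem_filter.2 ((h x y').1 hM)
  · rintro ⟨x, y₁⟩ h₁ ⟨x', y₂⟩ h₂ e
    obtain ⟨-, rfl⟩ := mem_filter.1 h₁
    obtain ⟨-, e₂⟩ := mem_filter.1 h₂
    exact Prod.ext (Fin.ext e) e₂.symm

lemma sound_init (hg : (G.net K).Expanding) (hw : z.R = R) :
    Sound (G.net K) z l Λ St.init (initStore G K) := by
  refine ⟨St.init_inv hg, ⟨fun _ _ => 0, ?_, ?_, ?_⟩, rfl, rfl, ?_, rfl, ?_, rfl⟩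
  · constructor <;> intros <;> funext j <;> simp [St.init, ind, Lay.ptr, Lay.cur]
  · intro x hx j hj
    have hx' : x < N := hx
    have hj' : j < D := hj
    have hlt := adjAddr_lt hx hj
    have h1 : (x * D + j) / D = x := by
      rw [mul_comm, Nat.mul_add_div (by omega), Nat.div_eq_of_lt hj', add_zero]
    have h2 : (x * D + j) % D = j := by
      rw [mul_comm, Nat.mul_add_mod, Nat.mod_eq_of_lt hj']
    simp only [initStore, LeftRegularGraph.net] at hlt ⊢
    rw [dif_pos hlt, dif_pos ⟨hx', hj'⟩]
    congr
  · intro i hi j hj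
    simp only [initStore, cellAddr, LeftRegularGraph.net]
    rw [dif_neg (by omega)]
  · rw [hw]
    rfl
  · simp [initStore, St.init, Lay.cur]

/-- Induction on the play. The programs establish the invariant for the store in which they halt,
and determinism identifies it with the store of the play. -/
lemma Reachable.sound (hm : Machine (G.net K) z l Λ) (hz : z.R = R) (hl : 1 ≤ l)
    (hG : St.total (G.net K) ≤ 2 ^ (l - 1)) {s : Store} {M : Finset (Fin N × Fin R)}
    (h : Reachable dataStructure G K z.w s M) :
    ∃ st, Sound (G.net K) z l Λ st s ∧ Matches M st := by
  induction h with
  | start => exact ⟨St.init, sound_init hm.expanding hz, fun x y => by simp [St.init]⟩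
  | @retract s s' M t x y _ hxy ht ih =>
    obtain ⟨st, hs, hM⟩ := ih
    obtain ⟨hx, hy⟩ := (hM x y).1 hxy
    have hs' : Sound (G.net K) z l Λ st (retractInput s x y) :=
      (hs.setReg (Or.inl rfl) _).setReg (Or.inr rfl) _
    obtain ⟨s₁, h1, n, -, st', h2, h3, h4⟩ := (hs'.retract hm hx rfl).halts fun n s h => h.1
    obtain rfl := ht.unique h1
    refine ⟨st', h2, fun u v => ?_⟩
    -- An active node has only the edge to its home, so erasing the edge amounts to making the node
    -- inactive.
    rw [mem_erase, hM, h3, h4, mem_erase, Ne, Prod.mk.injEq, Ne, Fin.val_inj]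
    constructor
    · rintro ⟨h5, h6, h7⟩
      refine ⟨⟨?_, h6⟩, h7⟩
      rintro rfl
      exact h5 ⟨rfl, Fin.ext (h7.symm.trans hy)⟩
    · rintro ⟨⟨h5, h6⟩, h7⟩
      exact ⟨fun h => h5 h.1, h6, h7⟩
  | @request s s' M t x y _ hK ht hy ih =>
    obtain ⟨st, hs, hM⟩ := ih
    obtain ⟨n, -, st', h2, h3, h4, h5⟩ : ∃ n, n ≤ _ ∧ ∃ st', Sound (G.net K) z l Λ st' s' ∧
        st'.lay.act = insert (x : ℕ) st.lay.act ∧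
        (∀ u ∈ st.lay.act, st'.lay.hy u = st.lay.hy u) ∧ s'.reg 5 = st'.lay.hy x := by
      have hs' : Sound (G.net K) z l Λ st (requestInput s x) := hs.setReg (Or.inl rfl) _
      obtain ⟨s₁, h1, n, h⟩ := (hs'.request hm hl hG x.2 rfl
        (hM.card_insert hm hz hs.inv.ok hK x)).halts fun n s h => h.1
      obtain rfl := ht.unique h1
      exact ⟨n, h⟩
    refine ⟨st', h2, fun u v => ?_⟩
    rw [mem_insert, hM, h3, mem_insert, Prod.mk.injEq, Fin.val_inj]
    constructor
    · rintro (⟨rfl, rfl⟩ | ⟨h6, h7⟩)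
      · exact ⟨Or.inl rfl, h5.symm.trans hy⟩
      · exact ⟨Or.inr h6, (h4 _ h6).trans h7⟩
    · rintro ⟨rfl | h6, h7⟩
      · exact Or.inl ⟨rfl, Fin.ext (h7.symm.trans (h5.symm.trans hy))⟩
      · exact Or.inr ⟨h6, (h4 _ h6).symm.trans h7⟩

lemma playsWithin (hm : Machine (G.net K) z l Λ) (hz : z.R = R) (hl : 1 ≤ l)
    (hG : St.total (G.net K) ≤ 2 ^ (l - 1)) :
    dataStructure.PlaysWithin G K (l + 2 * Λ) (1000 * (D * (l + 1)) + 8) z.w where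
  retract := by
    intro s M h x y hxy
    obtain ⟨st, hs, hM⟩ := h.sound hm hz hl hG
    obtain ⟨hx, -⟩ := (hM x y).1 hxy
    have hs' : Sound (G.net K) z l Λ st (retractInput s x y) :=
      (hs.setReg (Or.inl rfl) _).setReg (Or.inr rfl) _
    have hD : 6 ≤ D := hm.expanding.six_le
    have h1 : 6 * 1 ≤ D * (l + 1) := Nat.mul_le_mul hD (by omega)
    obtain ⟨s', h2, -⟩ := (hs'.retract hm hx rfl).halts
      (τ := 1000 * (D * (l + 1)) + 8) fun n s h => by have := h.1; omega
    exact ⟨s', h2⟩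
  request := by
    intro s M h hK x
    obtain ⟨st, hs, hM⟩ := h.sound hm hz hl hG
    have hs' : Sound (G.net K) z l Λ st (requestInput s x) := hs.setReg (Or.inl rfl) _
    obtain ⟨s', h1, n, -, st', h2, h3, h4, h5⟩ := (hs'.request hm hl hG x.2 rfl
      (hM.card_insert hm hz hs.inv.ok hK x)).halts fun n s h => h.1
    have hx : (x : ℕ) ∈ st'.lay.act := h3 ▸ mem_insert_self _ _
    obtain ⟨y, hy, he⟩ := mem_net_nbrs.1 (h2.inv.ok.hy_mem x (h2.inv.ok.act_hl x hx))
    have hy5 : s'.reg 5 = y := h5.trans he.symm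
    -- The position after the match is reachable too, so its load is bounded by the invariant of the
    -- state that represents it.
    obtain ⟨st₂, hs₂, hM₂⟩ := (Reachable.request x y h hK h1 hy5).sound hm hz hl hG
    exact ⟨s', h1, y, hy5, hy, fun v => (hM₂.load_le v).trans
      (hs₂.inv.load_le hm.expanding hm.load _)⟩

lemma DataStructure.PlaysWithin.mono {P : DataStructure} {ℓ ℓ' τ τ' w : ℕ}
    (h : P.PlaysWithin G K ℓ τ w) (hℓ : ℓ ≤ ℓ') (hτ : τ ≤ τ') : P.PlaysWithin G K ℓ' τ' w := by
  have hmono : ∀ {p : Prog} {s s' : Store}, HaltsWithin w p s τ s' → HaltsWithin w p s τ' s' := by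
    intro p s s' hp
    unfold HaltsWithin at hp ⊢
    rw [show τ' = (τ' - τ) + τ by omega, Function.iterate_add_apply, hp]
    exact iterate_step_nil _ _
  constructor
  · intro s M hr x y hxy
    obtain ⟨s', h1⟩ := h.retract s M hr x y hxy
    exact ⟨s', hmono h1⟩
  · intro s M hr hK x
    obtain ⟨s', h1, y, h2, h3, h4⟩ := h.request s M hr hK x
    exact ⟨s', hmono h1, y, h2, h3, fun v => (h4 v).trans hℓ⟩

/-- No request is legal, so no edge ever appears. This case is separate because the invariants need
`K ≥ 1`. -/
lemma playsWithin_zero {P : DataStructure} {ℓ τ w : ℕ} : P.PlaysWithin G 0 ℓ τ w := by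
  have h : ∀ s M, Reachable P G 0 w s M → M = ∅ := by
    intro s M h
    induction h with
    | start => rfl
    | retract x y _ hxy _ ih => simp [ih] at hxy
    | request x y _ hK => omega
  constructor
  · intro s M hr x y hxy
    simp [h s M hr] at hxy
  · intro s M _ hK
    omega

end Graph

end DynMatch

theorem theorem1 :
    ∃ (P : DynMatch.DataStructure) (c C : ℕ),
      ∀ (N D R K : ℕ) (G : DynMatch.LeftRegularGraph N D R),
        2 ≤ N → G.HasExpansion (2 / 3 * (D : ℝ) + 2) K →
          G.HasDynamicMatching K (C * Nat.log 2 N) ∧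
          P.PlaysWithin G K (C * Nat.log 2 N) (C * (D * Nat.log 2 N))
            (c * Nat.clog 2 (N + R)) := by
  refine ⟨DynMatch.dataStructure, 3, 8000, fun N D R K G hN hG => ?_⟩
  suffices h : DynMatch.dataStructure.PlaysWithin G K (8000 * Nat.log 2 N)
      (8000 * (D * Nat.log 2 N)) (3 * Nat.clog 2 (N + R)) from ⟨h.hasDynamicMatching, h⟩
  rcases Nat.eq_zero_or_pos K with rfl | hK
  · exact DynMatch.playsWithin_zero
  have hg := DynMatch.net_expanding hN hK hG
  have hR : D ≤ R := by
    have := Finset.card_le_univ (G.neighbors ⟨0, by omega⟩)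
    rwa [DynMatch.card_neighbors, Fintype.card_fin] at this
  obtain ⟨hm, hl, hT, hlL⟩ := DynMatch.machine hN hg hR
  have hL : 1 ≤ Nat.log 2 N := Nat.log_pos (by omega) hN
  have hD : 6 ≤ D := hg.six_le
  -- With `L = log N ≥ 1`, the load is at most `(2L + 4) + 2(L + 1) ≤ 10L`. For the time, `l + 1 ≤
  -- 2L + 5 ≤ 7L` gives `7000 * D * L + 8`, and the constant is absorbed since `D * L ≥ 6`.
  refine (DynMatch.playsWithin hm rfl hl hT).mono (by omega) ?_
  have h1 : D * (Nat.clog 2 (2 * (N * (N + 4))) + 1) ≤ D * (7 * Nat.log 2 N) :=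
    Nat.mul_le_mul_left _ (by omega)
  have h2 : 6 * 1 ≤ D * Nat.log 2 N := Nat.mul_le_mul hD hL
  rw [show D * (7 * Nat.log 2 N) = 7 * (D * Nat.log 2 N) by ring] at h1
  omega
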